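/- **Notation.** Let $n\ge 1$, $N=2n+1$, $e_{ik}$ the elementary $N\times N$ matrices, $C_n=\sum_{i=1}^{N}(-1)^{n+i-1}e_{i,N+1-i}$, and let $\mathbb R^{n+1,n}$ be $\mathbb R^{N}$ with the form $\langle X,Y\rangle=X^tC_nY$; $V^\perp$ is the orthogonal complement of $V$ for this form. If $\mathbb R^{n+1,n}=V\oplus V^\perp$, the projection onto $V$ along $V^\perp$ is called an $O(n+1,n)$-projection. Let $b=\sum_{i=1}^{2n}e_{i+1,i}$, $J=b+\lambda e_{1,N}$, and let $\mathcal B_n^+$ be the space of upper triangular $A$ with $A^tC_n+C_nA=0$. For a smooth $q(x,t)\in\mathcal B_n^+$ let $S(q,\lambda)=\sum_{i\le m}S_i\lambda^i$ be the formal series with real matrix coefficients such that $C_nS(-\lambda)^tC_n+S(\lambda)=0$, $[\partial_x+J+q,S]=0$ and $S$ is conjugate to $J$; write $S_{k,0}(q)$ for the coefficient of $\lambda^0$ in $S(q,\lambda)^k$ and $(\cdot)_+$ for the part of a series with nonnegative powers of $\lambda$. Fix $j\ge 0$ with $2j-1\not\equiv 0 \pmod{2n+1}$ and consider the flow $$q_t=[\partial_x+b+q,\;S_{2j-1,0}(q)].\qquad(*)$$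 A frame of a solution $q$ on an open set $U\subseteq\mathbb R^2$ is a map $F(x,t,\lambda)\in SL(N,\mathbb C)$, continuous on $U\times\mathbb C$, smooth in $(x,t)\in U$, entire in $\lambda$, with $\overline{F(x,t,\bar\lambda)}=F(x,t,\lambda)$, $F(x,t,-\lambda)^tC_nF(x,t,\lambda)=C_n$, $F^{-1}F_x=J+q$ and $F^{-1}F_t=(S(q,\lambda)^{2j-1})_+$. For $\alpha\in\mathbb R\setminus\{0\}$ and an $O(n+1,n)$-projection $\pi$ put $g_{\alpha,\pi}(\lambda)=I+\frac{2\alpha}{\lambda-\alpha}(I-\pi)$. Given a solution $q$ on $U$ with frame $F$, let $\tilde V(x,t)=F(x,t,\alpha)^{-1}(\mathrm{Im}\,\pi)$ and let $U'\subseteq U$ be the set of points where $\mathbb R^{n+1,n}=\tilde V\oplus\tilde V^\perp$. On $U'$ let $\tilde\pi(x,t)$ be the $O(n+1,n)$-projection onto $\tilde V(x,t)$, and set $$g_{\alpha,\pi}\bullet q=q+2\alpha[e_{1,N},\tilde\pi],\qquad \tilde F=g_{\alpha,\pi}\,F\,g_{\alpha,\tilde\pi}^{-1},$$ the removable singularities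 of $\tilde F$ at $\lambda=\pm\alpha$ being filled in. We say that $U'$ is the domain of $g_{\alpha,\pi}\bullet q$; a further transformation of $g_{\alpha,\pi}\bullet q$ is formed with $\tilde F$. **Theorem (Permutability).** Let $q$ be a solution of $(*)$ on an open set $U\subseteq\mathbb R^2$ (for instance $U=\mathbb R^2$) with frame $F$. Let $\alpha_1,\alpha_2\in\mathbb R\setminus\{0\}$ with $|\alpha_1|\ne|\alpha_2|$, let $\pi_1,\pi_2$ be $O(n+1,n)$-projections, and suppose that $$\phi=\alpha_1-\alpha_2+2\alpha_2\pi_2-2\alpha_1\pi_1$$ is invertible. Set $\tau_i=\phi\pi_i\phi^{-1}$. Then: 1. $\tau_1,\tau_2$ are $O(n+1,n)$-projections. 2. For $i=1,2$ the domain $U_i$ of $q_i=g_{\alpha_i,\pi_i}\bullet q=q+2\alpha_i[e_{1,N},\tilde\pi_i]$ is open, $q_i$ is a solution of $(*)$ on $U_i$, and $\tilde F$ (formed with $\alpha_i,\pi_i$) is a frame of it. 3. The domains $U_{12}\subseteq U_1$ of $q_{12}=g_{\alpha_2,\tau_2}\bullet(g_{\alpha_1,\pi_1}\bullet q)$ and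 $U_{21}\subseteq U_2$ of $q_{21}=g_{\alpha_1,\tau_1}\bullet(g_{\alpha_2,\pi_2}\bullet q)$ are open, and $q_{12},q_{21}$ are solutions of $(*)$ on them. 4. Put $\tilde\phi=\alpha_1-\alpha_2+2\alpha_2\tilde\pi_2-2\alpha_1\tilde\pi_1$ on $U_1\cap U_2$. A point of $U_1\cap U_2$ lies in $U_{12}$ if and only if $\tilde\phi$ is invertible there, and likewise for $U_{21}$. At each such point $\tilde\tau_i=\tilde\phi\,\tilde\pi_i\,\tilde\phi^{-1}$ ($i=1,2$) are $O(n+1,n)$-projections and $$q_{12}=q_{21}=q_1+2\alpha_2[e_{1,N},\tilde\tau_2]=q_2+2\alpha_1[e_{1,N},\tilde\tau_1].$$ -/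

import Mathlib

open Matrix Topology
open scoped ContDiff

noncomputable section

namespace IsotropicKdV

/-- Square matrices of size `2n+1`; rows and columns are numbered from `0`. -/
abbrev Mat (n : ℕ) (R : Type*) := Matrix (Fin (2 * n + 1)) (Fin (2 * n + 1)) R

/-- The matrix `C_n = ∑ (-1)^(n+i-1) e_{i,2n+2-i}` (with `i` counted from `1`). -/
def formMatrix (n : ℕ) : Mat n ℝ :=
  Matrix.of fun i k => if (i : ℕ) + (k : ℕ) = 2 * n then (-1 : ℝ) ^ (n + (i : ℕ)) else 0

/-- The matrix `b = ∑ e_{i+1,i}`. -/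
def shiftMatrix (n : ℕ) : Mat n ℝ :=
  Matrix.of fun i k => if (i : ℕ) = (k : ℕ) + 1 then 1 else 0

/-- The matrix `e_{1,2n+1}`. -/
def cornerMatrix (n : ℕ) : Mat n ℝ :=
  Matrix.single 0 (Fin.last (2 * n)) 1

/-! ### Linear algebra of `ℝ^{n+1,n}` -/

/-- The bilinear form `⟨X, Y⟩ = Xᵗ C_n Y` on `ℝ^{2n+1}`. -/
def form (n : ℕ) : LinearMap.BilinForm ℝ (Fin (2 * n + 1) → ℝ) :=
  Matrix.toBilin' (formMatrix n)

/-- The orthogonal complement `V^⊥` for the form of `ℝ^{n+1,n}`. -/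
def perp {n : ℕ} (V : Submodule ℝ (Fin (2 * n + 1) → ℝ)) :
    Submodule ℝ (Fin (2 * n + 1) → ℝ) :=
  (form n).orthogonal V

open Classical in
/-- The projection of `ℝ^{n+1,n}` onto `V` along `V^⊥` when `ℝ^{n+1,n} = V ⊕ V^⊥`
(and `0` otherwise). -/
def orthProj {n : ℕ} (V : Submodule ℝ (Fin (2 * n + 1) → ℝ)) : Mat n ℝ :=
  if h : IsCompl V (perp V) then LinearMap.toMatrix' (V.projection (perp V) h) else 0

/-- An `O(n+1,n)`-projection: the projection onto some `V` along `V^⊥`,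
where `ℝ^{n+1,n} = V ⊕ V^⊥`. -/
def IsOProjection {n : ℕ} (P : Mat n ℝ) : Prop :=
  ∃ V : Submodule ℝ (Fin (2 * n + 1) → ℝ), IsCompl V (perp V) ∧ P = orthProj V

/-- The image of a matrix. -/
def image {n : ℕ} (A : Mat n ℝ) : Submodule ℝ (Fin (2 * n + 1) → ℝ) :=
  LinearMap.range (Matrix.toLin' A)

/-- Upper triangular elements of the Lie algebra `o(n+1,n)`. (Trace zero is automatic.) -/
def IsBPlus {n : ℕ} (A : Mat n ℝ) : Prop :=
  (∀ i k, k < i → A i k = 0) ∧ Aᵀ * formMatrix n + formMatrix n * A = 0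

/-! ### Matrices depending on `(x,t)`, and formal Laurent series in `λ⁻¹` -/

/-- Entrywise `∂/∂x` of a matrix function of `(x,t)`. -/
def partialX {n : ℕ} {K : Type*} [NormedAddCommGroup K] [NormedSpace ℝ K]
    (A : ℝ × ℝ → Mat n K) (p : ℝ × ℝ) : Mat n K :=
  Matrix.of fun i k => deriv (fun x => A (x, p.2) i k) p.1

/-- Entrywise `∂/∂t` of a matrix function of `(x,t)`. -/
def partialT {n : ℕ} {K : Type*} [NormedAddCommGroup K] [NormedSpace ℝ K]
    (A : ℝ × ℝ → Mat n K) (p : ℝ × ℝ) : Mat n K :=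
  Matrix.of fun i k => deriv (fun t => A (p.1, t) i k) p.2

/-- Entrywise smoothness on a set. -/
def SmoothOn {n : ℕ} {K : Type*} [NormedAddCommGroup K] [NormedSpace ℝ K]
    (U : Set (ℝ × ℝ)) (A : ℝ × ℝ → Mat n K) : Prop :=
  ∀ i k, ContDiffOn ℝ ∞ (fun p => A p i k) U

/-- Series `∑_{k ≤ m} A_k λ^k` with real matrix coefficients. They are stored as matrices of
Laurent series whose variable stands for `λ⁻¹`. -/
abbrev Loop (n : ℕ) := Mat n (LaurentSeries ℝ)

/-- The coefficient of `λ^k`. -/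
def Loop.coeff {n : ℕ} (A : Loop n) (k : ℤ) : Mat n ℝ :=
  A.map fun s => HahnSeries.coeff s (-k)

/-- A matrix, as a series that is constant in `λ`. -/
def Loop.const {n : ℕ} (A : Mat n ℝ) : Loop n :=
  A.map (HahnSeries.C : ℝ →+* LaurentSeries ℝ)

/-- The series `λ`. -/
def Loop.lam : LaurentSeries ℝ := HahnSeries.single (-1 : ℤ) (1 : ℝ)

/-- `J = b + e_{1,2n+1} λ`, as a series. -/
def Loop.J (n : ℕ) : Loop n :=
  Loop.const (shiftMatrix n) + Loop.lam • Loop.const (cornerMatrix n)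

/-- The value at `z ∈ ℂ` of the polynomial part `A_+ = ∑_{k ≥ 0} A_k λ^k`
(a finite sum). -/
def Loop.plusEval {n : ℕ} (A : Loop n) (z : ℂ) : Mat n ℂ :=
  ∑ᶠ k : ℕ, z ^ k • (A.coeff (k : ℤ)).map Complex.ofReal

/-- `J = b + e_{1,2n+1} z`, at the complex number `z`. -/
def evalJ (n : ℕ) (z : ℂ) : Mat n ℂ :=
  (shiftMatrix n).map Complex.ofReal + z • (cornerMatrix n).map Complex.ofReal

/-! ### The flows on upper triangular potentials -/

/-- `S = S(q,λ)` on `U`: the series in the twisted loop algebra (`C_n S(-λ)ᵗ C_n + S(λ) = 0`)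
that commutes with `∂_x + J + q` and is conjugate to `J`. (The trace of `S` vanishes because that
of `J` does.) -/
structure IsResolvent {n : ℕ} (U : Set (ℝ × ℝ)) (q : ℝ × ℝ → Mat n ℝ)
    (S : ℝ × ℝ → Loop n) : Prop where
  smooth : ∀ k : ℤ, SmoothOn U fun p => (S p).coeff k
  bounded : ∃ m : ℤ, ∀ p ∈ U, ∀ k > m, (S p).coeff k = 0
  twisted : ∀ p ∈ U, ∀ k : ℤ,
    (-1 : ℝ) ^ k • (formMatrix n * ((S p).coeff k)ᵀ * formMatrix n) + (S p).coeff k = 0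
  commutes : ∀ p ∈ U, ∀ k : ℤ,
    partialX (fun p' => (S p').coeff k) p
      + Loop.coeff ((Loop.J n + Loop.const (q p)) * S p
          - S p * (Loop.J n + Loop.const (q p))) k = 0
  conj : ∀ p ∈ U, IsConj (Loop.J n) (S p)

/-- `q : U → B_n^+` is a smooth solution on `U` of the `(2j-1)`-th flow
`q_t = [∂_x + b + q, S_{2j-1,0}(q)]`, where `S_{2j-1,0}(q)` is the coefficient of `λ^0` in
`S(q,λ)^{2j-1}`. -/
def IsSolution (n j : ℕ) (U : Set (ℝ × ℝ)) (q : ℝ × ℝ → Mat n ℝ) : Prop :=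
  SmoothOn U q ∧ (∀ p ∈ U, IsBPlus (q p)) ∧
  ∃ S : ℝ × ℝ → Loop n, IsResolvent U q S ∧
    ∀ p ∈ U, partialT q p =
      partialX (fun p' => Loop.coeff (S p' ^ (2 * (j : ℤ) - 1)) 0) p
        + ⁅shiftMatrix n + q p, Loop.coeff (S p ^ (2 * (j : ℤ) - 1)) 0⁆

/-- `F(x,t,λ)` is a frame on `U` of the solution `q` of the `(2j-1)`-th flow: it is entire in
`λ`, lies in the twisted loop group, and satisfies
`F⁻¹ F_x = J + q`, `F⁻¹ F_t = (S^{2j-1}(q,λ))_+`. -/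
structure IsFrame (n j : ℕ) (U : Set (ℝ × ℝ)) (q : ℝ × ℝ → Mat n ℝ)
    (F : ℝ × ℝ → ℂ → Mat n ℂ) : Prop where
  holomorphic : ∀ p ∈ U, ∀ i k, Differentiable ℂ fun z => F p z i k
  smooth : ∀ z : ℂ, SmoothOn U fun p => F p z
  continuous : ∀ i k,
    ContinuousOn (fun w : (ℝ × ℝ) × ℂ => F w.1 w.2 i k) (U ×ˢ Set.univ)
  real : ∀ p ∈ U, ∀ z : ℂ, F p (starRingEnd ℂ z) = (F p z).map (starRingEnd ℂ)
  det_eq_one : ∀ p ∈ U, ∀ z : ℂ, (F p z).det = 1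
  twisted : ∀ p ∈ U, ∀ z : ℂ,
    (F p (-z))ᵀ * (formMatrix n).map Complex.ofReal * F p z
      = (formMatrix n).map Complex.ofReal
  lax : ∃ S : ℝ × ℝ → Loop n, IsResolvent U q S ∧ ∀ p ∈ U, ∀ z : ℂ,
    (F p z)⁻¹ * partialX (fun p' => F p' z) p = evalJ n z + (q p).map Complex.ofReal ∧
    (F p z)⁻¹ * partialT (fun p' => F p' z) p
      = Loop.plusEval (S p ^ (2 * (j : ℤ) - 1)) z

/-! ### Bäcklund transformations -/

/-- `g_{α,π}(λ) = I + 2α/(λ-α) (I - π)`. -/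
def simpleElement {n : ℕ} (α : ℝ) (P : Mat n ℝ) (z : ℂ) : Mat n ℂ :=
  1 + (2 * (α : ℂ) / (z - (α : ℂ))) • (1 - P.map Complex.ofReal)

/-- `Ṽ(x,t) = F(x,t,α)⁻¹ (V)` with `V` the image of `π`. For real `α` the matrix `F(x,t,α)` of a
frame is real. -/
def tildeSpace {n : ℕ} (α : ℝ) (P : Mat n ℝ) (F : ℝ × ℝ → ℂ → Mat n ℂ) (p : ℝ × ℝ) :
    Submodule ℝ (Fin (2 * n + 1) → ℝ) :=
  (image P).map (Matrix.toLin' ((F p (α : ℂ)).map Complex.re)⁻¹)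

/-- The points of `U` at which `ℝ^{n+1,n} = Ṽ ⊕ Ṽ^⊥`. -/
def regularSet {n : ℕ} (U : Set (ℝ × ℝ)) (α : ℝ) (P : Mat n ℝ)
    (F : ℝ × ℝ → ℂ → Mat n ℂ) : Set (ℝ × ℝ) :=
  {p | p ∈ U ∧ IsCompl (tildeSpace α P F p) (perp (tildeSpace α P F p))}

/-- `π̃(x,t)`, the `O(n+1,n)`-projection onto `Ṽ(x,t)`. -/
def tildeProj {n : ℕ} (α : ℝ) (P : Mat n ℝ) (F : ℝ × ℝ → ℂ → Mat n ℂ) (p : ℝ × ℝ) :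
    Mat n ℝ :=
  orthProj (tildeSpace α P F p)

/-- The transformed potential `g_{α,π} • q = q + 2α [e_{1,2n+1}, π̃]`, computed with the frame `F`
of `q`. -/
def backlund {n : ℕ} (α : ℝ) (P : Mat n ℝ) (F : ℝ × ℝ → ℂ → Mat n ℂ)
    (q : ℝ × ℝ → Mat n ℝ) (p : ℝ × ℝ) : Mat n ℝ :=
  q p + (2 * α) • ⁅cornerMatrix n, tildeProj α P F p⁆

/-- The transformed frame `F̃ = g_{α,π} F g_{α,π̃}⁻¹`. The limit only serves to fill in the
removable singularities at `λ = ±α`. -/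
def backlundFrame {n : ℕ} (α : ℝ) (P : Mat n ℝ) (F : ℝ × ℝ → ℂ → Mat n ℂ)
    (p : ℝ × ℝ) (z : ℂ) : Mat n ℂ :=
  Filter.limUnder (𝓝[≠] z) fun w =>
    simpleElement α P w * F p w * (simpleElement α (tildeProj α P F p) w)⁻¹

/-- `φ = α₁ - α₂ + 2 α₂ π₂ - 2 α₁ π₁`. -/
def phi {n : ℕ} (α₁ α₂ : ℝ) (P₁ P₂ : Mat n ℝ) : Mat n ℝ :=
  (α₁ - α₂) • (1 : Mat n ℝ) + (2 * α₂) • P₂ - (2 * α₁) • P₁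

end IsotropicKdV

end

noncomputable section

namespace IsotropicKdV

/-! ### Linear algebra of projections -/

section LinearAlgebra

variable {n : ℕ}

/-! The `O(n+1,n)`-projections are exactly the idempotents `P` with `PᵗC = CP`
(`IsOProjection.isFormProj`, `IsFormProj.isOProjection`). One fact about them is used at every
stage. If `Mmᵗ C Mp = C`, then the orthogonal complement of `Mp (Im P)` is `Mm (Ker P)`
(`perp_image_mul`). Hence, for nonzero `a`, `b`, the space `Mp (Im P)` is nondegenerate if and only
if `Ψ = a Mp P + b Mm (1 - P)` is invertible, and its orthogonal projection is then `Ψ P Ψ⁻¹`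
(`isCompl_iff_isUnit_splitMap`, `orthProj_image_mul`). With the inverse frames at `±α` this makes
the domain open and `π̃` smooth. With `g_{α₁,π₁}(±α₂)` the map `Ψ` is `φ` itself
(`phi_eq_splitMap`).

A single transformation. The choice of `Ṽ` annihilates `g F g̃⁻¹` at its two possible poles `±α`, so
the new frame is entire (`backlundFrame_spec`). Along a line where `F' = F A`, differentiating the
relations between `π` and `π̃` gives `π̃' = π̃ A(-α) (1 - π̃) - (1 - π̃) A(α) π̃`
(`projection_ode`). This is what makes the gauge transform of the polynomial `A` by `g_{α,π̃}` a
polynomial again (`exists_isGauge`); for `A = J + q` the result is `J + q + 2α[e,π̃]`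
(`isGauge_potential`). Conjugation by `g_{α,π̃}` carries the resolvent of `q` to one of the new
potential (`IsResolvent.dressConj`). As `g` is `I` plus negative powers of `λ`, the gauge transform
of a polynomial part is the polynomial part of the conjugate (`IsPlusPart.dressConj`). Thus the new
frame satisfies the right linear system away from `±α`, and Cauchy's formula on a large circle
extends this to all `λ` (`frame_extension`). Finally, a smooth potential in `B_n^+` with a frame
solves the flow, by equality of mixed partials at `λ = 0` (`IsFrame.isSolution`). Two applications
cover the iterated transformations.

Permutability. Since `Im τ₂ = g_{α₁,π₁}(α₂) Im π₂`, the factor `g_{α₁,π₁}(α₂)` cancels in the second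
step, and the space to be projected onto is `g_{α₁,π̃₁}(α₂) Im π̃₂` (`tildeSpace_backlundFrame`).
This is the initial configuration with tildes, so its nondegeneracy means invertibility of `φ̃`, and
its projection is `τ̃₂`. Moreover `φ̃` is an affine function of `α₁π̃₁ - α₂π̃₂` and commutes with
it; therefore `α₁τ̃₁ - α₂τ̃₂ = α₁π̃₁ - α₂π̃₂` (`phi_conj_sub`), and bracketing with `e` shows that
the two potentials agree. -/

lemma formMatrix_transpose : (formMatrix n)ᵀ = formMatrix n := by
  ext i k
  simp only [formMatrix, Matrix.transpose_apply, Matrix.of_apply]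
  by_cases h : (i : ℕ) + (k : ℕ) = 2 * n
  · have h' : (k : ℕ) + (i : ℕ) = 2 * n := by omega
    rw [if_pos h, if_pos h', pow_add, pow_add]
    congr 1
    have hi : (-1 : ℝ) ^ (i : ℕ) * (-1 : ℝ) ^ (k : ℕ) = 1 := by
      rw [← pow_add, h, pow_mul]; simp
    rcases neg_one_pow_eq_or ℝ (i : ℕ) with h1 | h1 <;> rw [h1] at hi ⊢ <;> linarith
  · have h' : ¬ (k : ℕ) + (i : ℕ) = 2 * n := by omega
    rw [if_neg h, if_neg h']

lemma formMatrix_mul_self : formMatrix n * formMatrix n = 1 := by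
  ext i k
  rw [Matrix.mul_apply, Finset.sum_eq_single (Fin.rev i)]
  · simp only [formMatrix, Matrix.of_apply, Fin.val_rev, Matrix.one_apply]
    have hi := i.2
    rw [if_pos (by omega)]
    by_cases h : i = k
    · subst h
      rw [if_pos (by omega), if_pos rfl, ← pow_add]
      have : n + (i : ℕ) + (n + (2 * n + 1 - ((i : ℕ) + 1))) = 2 * (2 * n) := by omega
      rw [this, pow_mul]; simp
    · rw [if_neg h, if_neg, mul_zero]
      intro h'
      exact h (Fin.ext (by omega))
  · intro l _ hl
    simp only [formMatrix, Matrix.of_apply]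
    rw [if_neg, zero_mul]
    intro h'
    apply hl
    ext
    rw [Fin.val_rev]
    omega
  · simp

lemma cornerMatrix_form :
    (cornerMatrix n)ᵀ * formMatrix n = formMatrix n * cornerMatrix n := by
  ext i k
  simp only [cornerMatrix, Matrix.transpose_single, Matrix.mul_apply, Matrix.single_apply,
    formMatrix, Matrix.of_apply]
  rw [Finset.sum_eq_single 0, Finset.sum_eq_single 0]
  · have hi := i.2
    have hk := k.2
    by_cases h1 : Fin.last (2 * n) = i <;> by_cases h2 : Fin.last (2 * n) = k
    · subst h1; subst h2; simp [pow_add]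
    · have h3 : ¬ ((k : ℕ) = 2 * n) := fun h => h2 (Fin.ext (by simp [h]))
      subst h1
      simp [h3, h2]
    · have h3 : ¬ ((i : ℕ) = 2 * n) := fun h => h1 (Fin.ext (by simp [h]))
      simp [h1, h3]
    · simp [h1, h2]
  · intro l _ hl
    simp [Ne.symm hl]
  · simp
  · intro l _ hl
    simp [Ne.symm hl]
  · simp

lemma form_apply (x y : Fin (2 * n + 1) → ℝ) :
    form n x y = x ⬝ᵥ (formMatrix n *ᵥ y) := by
  simp [form, Matrix.toBilin'_apply']

lemma mem_image {A : Mat n ℝ} {x : Fin (2 * n + 1) → ℝ} :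
    x ∈ image A ↔ ∃ y, A *ᵥ y = x := by
  simp [image]

/-- A symmetric idempotent for the form of `ℝ^{n+1,n}`. -/
def IsFormProj (P : Mat n ℝ) : Prop :=
  P * P = P ∧ Pᵀ * formMatrix n = formMatrix n * P

lemma mem_perp_image {A : Mat n ℝ} {y : Fin (2 * n + 1) → ℝ} :
    y ∈ perp (image A) ↔ (Aᵀ * formMatrix n) *ᵥ y = 0 := by
  simp only [perp, LinearMap.BilinForm.mem_orthogonal_iff, mem_image, form_apply]
  constructor
  · intro h
    apply dotProduct_eq_zero
    intro w
    have := h (A *ᵥ w) ⟨w, rfl⟩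
    rwa [← Matrix.vecMul_transpose, ← Matrix.dotProduct_mulVec, Matrix.mulVec_mulVec,
      dotProduct_comm] at this
  · rintro h _ ⟨w, rfl⟩
    rw [← Matrix.vecMul_transpose, ← Matrix.dotProduct_mulVec, Matrix.mulVec_mulVec, h]
    simp

/-- Orthogonality to the image means `PᵗCy = 0`, which by self-adjointness is `CPy = 0`; and `C` is
an involution. -/
lemma IsFormProj.perp_eq_ker {P : Mat n ℝ} (hP : IsFormProj P) :
    perp (image P) = LinearMap.ker (Matrix.toLin' P) := by
  ext y
  rw [mem_perp_image, hP.2, LinearMap.mem_ker, Matrix.toLin'_apply]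
  constructor
  · intro h
    have := congrArg (fun v => formMatrix n *ᵥ v) h
    simpa [Matrix.mulVec_mulVec, ← mul_assoc, formMatrix_mul_self] using this
  · intro h
    rw [← Matrix.mulVec_mulVec, h, Matrix.mulVec_zero]

lemma IsFormProj.isCompl {P : Mat n ℝ} (hP : IsFormProj P) :
    IsCompl (image P) (perp (image P)) := by
  rw [hP.perp_eq_ker]
  have : IsIdempotentElem (Matrix.toLin' P) := by
    rw [IsIdempotentElem, Module.End.mul_eq_comp, ← Matrix.toLin'_mul, hP.1]
  exact (LinearMap.IsIdempotentElem.isCompl this)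

lemma IsFormProj.orthProj_image {P : Mat n ℝ} (hP : IsFormProj P) :
    orthProj (image P) = P := by
  have h := hP.isCompl
  rw [orthProj, dif_pos h]
  apply Matrix.toLin'.injective
  rw [Matrix.toLin'_toMatrix']
  refine LinearMap.ext fun x => ?_
  have hx : x = P *ᵥ x + (x - P *ᵥ x) := by abel
  have h1 : P *ᵥ x ∈ image P := mem_image.2 ⟨x, rfl⟩
  have h2 : x - P *ᵥ x ∈ perp (image P) := by
    rw [hP.perp_eq_ker, LinearMap.mem_ker, Matrix.toLin'_apply, Matrix.mulVec_sub,
      Matrix.mulVec_mulVec, hP.1, sub_self]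
  conv_lhs => rw [hx]
  rw [map_add, Submodule.projection_apply_of_mem_left h h1,
    Submodule.projection_apply_of_mem_right h h2, add_zero, Matrix.toLin'_apply]

lemma IsFormProj.isOProjection {P : Mat n ℝ} (hP : IsFormProj P) : IsOProjection P :=
  ⟨image P, hP.isCompl, hP.orthProj_image.symm⟩

/-- As `y - Ty` is orthogonal to `V`, both `⟨Tx, y⟩` and `⟨x, Ty⟩` equal `⟨Tx, Ty⟩`, the latter by
symmetry of the form. -/
lemma isFormProj_orthProj {V : Submodule ℝ (Fin (2 * n + 1) → ℝ)} (h : IsCompl V (perp V)) :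
    IsFormProj (orthProj V) := by
  rw [orthProj, dif_pos h]
  set T := V.projection (perp V) h with hT
  constructor
  · rw [← LinearMap.toMatrix'_mul]
    congr 1
    exact Submodule.isIdempotentElem_projection h
  · have hs : ∀ x y, form n (T x) y = form n (T x) (T y) := by
      intro x y
      have h1 : T x ∈ V := Submodule.projection_apply_mem h x
      have h2 : y - T y ∈ perp V := Submodule.sub_projection_mem h y
      have h3 := LinearMap.BilinForm.mem_orthogonal_iff.1 h2 _ h1
      rw [map_sub, sub_eq_zero] at h3
      exact h3
    have hc : ∀ x y, form n x y = form n y x := by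
      intro x y
      rw [form_apply, form_apply, dotProduct_comm, ← Matrix.vecMul_transpose,
        formMatrix_transpose, Matrix.dotProduct_mulVec]
    have hT' : ∀ x, LinearMap.toMatrix' T *ᵥ x = T x := fun x => by
      rw [← Matrix.toLin'_apply, Matrix.toLin'_toMatrix']
    apply (Matrix.toBilin').injective
    refine LinearMap.ext₂ fun x y => ?_
    rw [Matrix.toBilin'_apply', Matrix.toBilin'_apply', ← Matrix.mulVec_mulVec,
      ← Matrix.mulVec_mulVec, Matrix.dotProduct_mulVec, Matrix.vecMul_transpose, hT', hT',
      ← form_apply, ← form_apply, hs x y, hc x (T y), hs y x, hc (T y)]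

lemma IsOProjection.isFormProj {P : Mat n ℝ} (hP : IsOProjection P) : IsFormProj P := by
  obtain ⟨V, hV, rfl⟩ := hP
  exact isFormProj_orthProj hV

lemma isUnit_of_form {Mp Mm : Mat n ℝ} (hM : Mmᵀ * formMatrix n * Mp = formMatrix n) :
    IsUnit Mp ∧ IsUnit Mm := by
  constructor
  · refine IsUnit.of_mul_eq_one_right (formMatrix n * Mmᵀ * formMatrix n) ?_
    rw [mul_assoc, mul_assoc, ← mul_assoc (Mmᵀ), hM, formMatrix_mul_self]
  · rw [← Matrix.isUnit_transpose]
    refine IsUnit.of_mul_eq_one (formMatrix n * Mp * formMatrix n) ?_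
    rw [← mul_assoc, ← mul_assoc, hM, formMatrix_mul_self]

/-- The combination of two maps adapted to the decomposition defined by `P`. -/
def splitMap (a b : ℝ) (Mp Mm P : Mat n ℝ) : Mat n ℝ :=
  a • (Mp * P) + b • (Mm * (1 - P))

variable {a b : ℝ} {Mp Mm P : Mat n ℝ}

lemma splitMap_mul (hP : P * P = P) : splitMap a b Mp Mm P * P = a • (Mp * P) := by
  simp only [splitMap, add_mul, Matrix.smul_mul, mul_assoc, hP, sub_mul, one_mul, sub_self,
    mul_zero, smul_zero, add_zero]

lemma splitMap_mul_compl (hP : P * P = P) :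
    splitMap a b Mp Mm P * (1 - P) = b • (Mm * (1 - P)) := by
  have h1 : P * (1 - P) = 0 := by rw [mul_sub, mul_one, hP, sub_self]
  have h2 : (1 - P) * (1 - P) = 1 - P := by rw [sub_mul, one_mul, h1, sub_zero]
  simp only [splitMap, add_mul, Matrix.smul_mul, mul_assoc, h1, h2, mul_zero, smul_zero, zero_add]

/-- `Ψ` is an isometry from the pulled-back form `ΨᵗCΨ` to `C`, and `hK` says that `P` is
self-adjoint for the pulled-back form. -/
lemma isFormProj_conj (hP : IsFormProj P) {Ψ : Mat n ℝ} (hΨ : IsUnit Ψ)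
    (hK : Pᵀ * (Ψᵀ * formMatrix n * Ψ) = Ψᵀ * formMatrix n * Ψ * P) :
    IsFormProj (Ψ * P * Ψ⁻¹) := by
  have hd := (Matrix.isUnit_iff_isUnit_det _).1 hΨ
  have h1 : Ψ⁻¹ * Ψ = 1 := Matrix.nonsing_inv_mul _ hd
  have h2 : Ψ * Ψ⁻¹ = 1 := Matrix.mul_nonsing_inv _ hd
  constructor
  · calc Ψ * P * Ψ⁻¹ * (Ψ * P * Ψ⁻¹) = Ψ * P * (Ψ⁻¹ * Ψ) * P * Ψ⁻¹ := by simp only [mul_assoc]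
      _ = Ψ * P * Ψ⁻¹ := by rw [h1, mul_one, mul_assoc Ψ P P, hP.1]
  · have h3 : (Ψ⁻¹)ᵀ * Ψᵀ = 1 := by rw [← Matrix.transpose_mul, h2, Matrix.transpose_one]
    calc (Ψ * P * Ψ⁻¹)ᵀ * formMatrix n
        = (Ψ⁻¹)ᵀ * (Pᵀ * (Ψᵀ * formMatrix n * Ψ)) * Ψ⁻¹ := by
          simp only [Matrix.transpose_mul, mul_assoc, h2, mul_one]
      _ = ((Ψ⁻¹)ᵀ * Ψᵀ) * formMatrix n * (Ψ * P * Ψ⁻¹) := by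
          rw [hK]; simp only [mul_assoc]
      _ = _ := by rw [h3, one_mul]

/-- The off-diagonal blocks of the Gram matrix with respect to `P` and `1 - P` pair `Mp` with `Mm`,
hence reduce to multiples of `PᵗC(1 - P)` and `(1 - P)ᵗCP`, which vanish. The diagonal blocks do not
matter. -/
lemma splitMap_gram (hP : IsFormProj P) (hM : Mmᵀ * formMatrix n * Mp = formMatrix n) :
    Pᵀ * ((splitMap a b Mp Mm P)ᵀ * formMatrix n * splitMap a b Mp Mm P)
      = (splitMap a b Mp Mm P)ᵀ * formMatrix n * splitMap a b Mp Mm P * P := by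
  set Ψ := splitMap a b Mp Mm P with hΨ
  set C := formMatrix n with hC
  have hM' : Mpᵀ * C * Mm = C := by
    have := congrArg Matrix.transpose hM
    simpa [Matrix.transpose_mul, formMatrix_transpose, mul_assoc, hC] using this
  have e1 : Pᵀ * Ψᵀ = a • (Pᵀ * Mpᵀ) := by
    rw [← Matrix.transpose_mul, splitMap_mul hP.1, Matrix.transpose_smul, Matrix.transpose_mul]
  have e1' : (1 - P)ᵀ * Ψᵀ = b • ((1 - P)ᵀ * Mmᵀ) := by
    rw [← Matrix.transpose_mul, splitMap_mul_compl hP.1, Matrix.transpose_smul,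
      Matrix.transpose_mul]
  have z1 : Pᵀ * (Ψᵀ * C * Ψ) * (1 - P) = 0 := by
    calc Pᵀ * (Ψᵀ * C * Ψ) * (1 - P) = (Pᵀ * Ψᵀ) * C * (Ψ * (1 - P)) := by
          simp only [mul_assoc]
      _ = (a * b) • (Pᵀ * (Mpᵀ * C * Mm) * (1 - P)) := by
          rw [e1, splitMap_mul_compl hP.1]
          simp only [Matrix.smul_mul, Matrix.mul_smul, smul_smul, mul_assoc, mul_comm b a]
      _ = 0 := by
          rw [hM', hP.2, mul_assoc, mul_sub, mul_one, hP.1, sub_self, mul_zero, smul_zero]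
  have z2 : (1 - P)ᵀ * (Ψᵀ * C * Ψ) * P = 0 := by
    calc (1 - P)ᵀ * (Ψᵀ * C * Ψ) * P = ((1 - P)ᵀ * Ψᵀ) * C * (Ψ * P) := by
          simp only [mul_assoc]
      _ = (a * b) • ((1 - P)ᵀ * (Mmᵀ * C * Mp) * P) := by
          rw [e1', splitMap_mul hP.1]
          simp only [Matrix.smul_mul, Matrix.mul_smul, smul_smul, mul_assoc]
      _ = 0 := by
          rw [hM, Matrix.transpose_sub, Matrix.transpose_one, sub_mul, one_mul, hP.2, sub_mul,
            mul_assoc, hP.1, sub_self, smul_zero]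
  rw [mul_sub, mul_one, sub_eq_zero] at z1
  rw [Matrix.transpose_sub, Matrix.transpose_one, sub_mul, one_mul, sub_mul, sub_eq_zero] at z2
  rw [z1, z2]

lemma image_mul_right_isUnit (A : Mat n ℝ) {B : Mat n ℝ} (hB : IsUnit B) :
    image (A * B) = image A := by
  ext x
  simp only [mem_image, ← Matrix.mulVec_mulVec]
  constructor
  · rintro ⟨y, rfl⟩; exact ⟨_, rfl⟩
  · rintro ⟨y, rfl⟩
    obtain ⟨w, rfl⟩ := Matrix.mulVec_surjective_iff_isUnit.2 hB y
    exact ⟨w, rfl⟩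

lemma image_smul (A : Mat n ℝ) (ha : a ≠ 0) : image (a • A) = image A := by
  ext x
  simp only [mem_image]
  constructor
  · rintro ⟨y, rfl⟩; exact ⟨a • y, by rw [Matrix.mulVec_smul, Matrix.smul_mulVec]⟩
  · rintro ⟨y, rfl⟩
    exact ⟨a⁻¹ • y, by rw [Matrix.mulVec_smul, Matrix.smul_mulVec, smul_smul,
      inv_mul_cancel₀ ha, one_smul]⟩

lemma map_image (A B : Mat n ℝ) : (image B).map (Matrix.toLin' A) = image (A * B) := by
  rw [image, image, Matrix.toLin'_mul, LinearMap.range_comp]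

lemma image_splitMap_conj (hP : P * P = P) (ha : a ≠ 0) (hΨ : IsUnit (splitMap a b Mp Mm P)) :
    image (splitMap a b Mp Mm P * P * (splitMap a b Mp Mm P)⁻¹) = image (Mp * P) := by
  rw [image_mul_right_isUnit _ ((Matrix.isUnit_nonsing_inv_iff).2 hΨ), splitMap_mul hP,
    image_smul _ ha]

lemma isFormProj_splitMap_conj (hP : IsFormProj P) (hM : Mmᵀ * formMatrix n * Mp = formMatrix n)
    (hΨ : IsUnit (splitMap a b Mp Mm P)) :
    IsFormProj (splitMap a b Mp Mm P * P * (splitMap a b Mp Mm P)⁻¹) :=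
  isFormProj_conj hP hΨ (splitMap_gram hP hM)

/-- `Mm` is invertible, so every vector has the form `Mm w`. Since `(Mp P)ᵗ C Mm = CP`, it is
orthogonal to `Mp (Im P)` precisely when `Pw = 0`. -/
lemma perp_image_mul (hP : IsFormProj P) (hM : Mmᵀ * formMatrix n * Mp = formMatrix n) :
    perp (image (Mp * P)) = image (Mm * (1 - P)) := by
  have hM' : Mpᵀ * formMatrix n * Mm = formMatrix n := by
    have := congrArg Matrix.transpose hM
    simpa [Matrix.transpose_mul, formMatrix_transpose, mul_assoc] using this
  have hz : (Pᵀ * formMatrix n) * (1 - P) = 0 := by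
    rw [hP.2, mul_assoc, mul_sub, mul_one, hP.1, sub_self, mul_zero]
  ext y
  obtain ⟨w, rfl⟩ := Matrix.mulVec_surjective_iff_isUnit.2 (isUnit_of_form hM).2 y
  rw [mem_perp_image, Matrix.mulVec_mulVec, mem_image]
  have e : (Mp * P)ᵀ * formMatrix n * Mm = formMatrix n * P := by
    rw [Matrix.transpose_mul, mul_assoc, mul_assoc, ← mul_assoc (Mpᵀ), hM', hP.2]
  rw [e]
  constructor
  · intro h
    have h0 : P *ᵥ w = 0 := by
      have := congrArg (fun v => formMatrix n *ᵥ v) h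
      simpa [Matrix.mulVec_mulVec, ← mul_assoc, formMatrix_mul_self] using this
    exact ⟨w, by rw [← Matrix.mulVec_mulVec, Matrix.sub_mulVec, h0, Matrix.one_mulVec, sub_zero]⟩
  · rintro ⟨v, hv⟩
    have hinj := Matrix.mulVec_injective_iff_isUnit.2 (isUnit_of_form hM).2
    rw [← Matrix.mulVec_mulVec] at hv
    rw [← hinj hv, Matrix.mulVec_mulVec, mul_assoc, mul_sub, mul_one, hP.1, sub_self, mul_zero,
      Matrix.zero_mulVec]

/-- The image of `Im P` under `Mp` is nondegenerate iff `splitMap` is invertible. -/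
lemma isCompl_iff_isUnit_splitMap (hP : IsFormProj P)
    (hM : Mmᵀ * formMatrix n * Mp = formMatrix n) (ha : a ≠ 0) (hb : b ≠ 0) :
    IsCompl (image (Mp * P)) (perp (image (Mp * P))) ↔ IsUnit (splitMap a b Mp Mm P) := by
  constructor
  · intro h
    rw [← Matrix.mulVec_surjective_iff_isUnit]
    intro y
    have hy : y ∈ image (Mp * P) ⊔ perp (image (Mp * P)) := by rw [h.sup_eq_top]; trivial
    rw [perp_image_mul hP hM, Submodule.mem_sup] at hy
    obtain ⟨_, hu, _, hv, rfl⟩ := hy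
    obtain ⟨u, rfl⟩ := mem_image.1 hu
    obtain ⟨v, rfl⟩ := mem_image.1 hv
    -- The factors `a⁻¹` and `b⁻¹` undo the weights that `splitMap` puts on `Im P` and `Ker P`.
    refine ⟨P *ᵥ (a⁻¹ • u) + (1 - P) *ᵥ (b⁻¹ • v), ?_⟩
    rw [Matrix.mulVec_add, Matrix.mulVec_mulVec, Matrix.mulVec_mulVec, splitMap_mul hP.1,
      splitMap_mul_compl hP.1, Matrix.smul_mulVec, Matrix.smul_mulVec, Matrix.mulVec_smul,
      Matrix.mulVec_smul, smul_smul, smul_smul, mul_inv_cancel₀ ha, mul_inv_cancel₀ hb, one_smul,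
      one_smul]
  · intro h
    rw [← image_splitMap_conj hP.1 ha h]
    exact (isFormProj_splitMap_conj hP hM h).isCompl

lemma orthProj_image_mul (hP : IsFormProj P)
    (hM : Mmᵀ * formMatrix n * Mp = formMatrix n) (ha : a ≠ 0)
    (h : IsUnit (splitMap a b Mp Mm P)) :
    orthProj (image (Mp * P)) = splitMap a b Mp Mm P * P * (splitMap a b Mp Mm P)⁻¹ := by
  rw [← image_splitMap_conj hP.1 ha h]
  exact (isFormProj_splitMap_conj hP hM h).orthProj_image

end LinearAlgebra

/-! ### Laurent series in `λ⁻¹` -/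

section LaurentSeries

/-- The coefficients of `f` of index smaller than `a` vanish. -/
def VanishBelow (a : ℤ) (f : LaurentSeries ℝ) : Prop := ∀ i < a, f.coeff i = 0

lemma VanishBelow.mono {a b : ℤ} {f : LaurentSeries ℝ} (h : VanishBelow a f) (hab : b ≤ a) :
    VanishBelow b f := fun i hi => h i (hi.trans_le hab)

lemma VanishBelow.add {a : ℤ} {f g : LaurentSeries ℝ} (hf : VanishBelow a f)
    (hg : VanishBelow a g) : VanishBelow a (f + g) := fun i hi => by
  rw [HahnSeries.coeff_add, hf i hi, hg i hi, add_zero]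

lemma VanishBelow.sum {ι : Type*} {a : ℤ} (s : Finset ι) {f : ι → LaurentSeries ℝ}
    (hf : ∀ l ∈ s, VanishBelow a (f l)) : VanishBelow a (∑ l ∈ s, f l) := fun i hi => by
  rw [HahnSeries.coeff_sum]
  exact Finset.sum_eq_zero fun l hl => hf l hl i hi

/-- The range of summation depends only on the bounds and not on the supports. For a family with
uniform bounds the coefficients of products are thus fixed finite sums, which can be differentiated
term by term. -/
lemma coeff_mul_eq_sum {a b : ℤ} {f g : LaurentSeries ℝ} (hf : VanishBelow a f)
    (hg : VanishBelow b g) (k : ℤ) :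
    (f * g).coeff k = ∑ i ∈ Finset.Icc a (k - b), f.coeff i * g.coeff (k - i) := by
  classical
  rw [HahnSeries.coeff_mul]
  have hinj : Function.Injective fun i : ℤ => (i, k - i) := fun i i' h => (Prod.ext_iff.1 h).1
  refine Eq.trans (Finset.sum_subset ?_ ?_) (Finset.sum_map (Finset.Icc a (k - b)) ⟨_, hinj⟩
    (fun ij : ℤ × ℤ => f.coeff ij.1 * g.coeff ij.2))
  · rintro ⟨i, j⟩ hij
    rw [Finset.mem_antidiagonal] at hij
    obtain ⟨hi, hj, hk⟩ := hij
    rw [HahnSeries.mem_support] at hi hj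
    have h1 : a ≤ i := not_lt.1 fun h => hi (hf i h)
    have h2 : b ≤ j := not_lt.1 fun h => hj (hg j h)
    simp only at hk
    rw [Finset.mem_map]
    refine ⟨i, Finset.mem_Icc.2 ⟨h1, by omega⟩, ?_⟩
    simp only [Function.Embedding.coeFn_mk, Prod.mk.injEq, true_and]
    omega
  · rintro ⟨i, j⟩ hij hn
    rw [Finset.mem_map] at hij
    obtain ⟨i', _, h⟩ := hij
    simp only [Function.Embedding.coeFn_mk, Prod.mk.injEq] at h
    obtain ⟨rfl, rfl⟩ := h
    by_contra h0
    apply hn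
    rw [Finset.mem_antidiagonal]
    exact ⟨left_ne_zero_of_mul h0, right_ne_zero_of_mul h0, by simp⟩

lemma VanishBelow.mul {a b : ℤ} {f g : LaurentSeries ℝ} (hf : VanishBelow a f)
    (hg : VanishBelow b g) : VanishBelow (a + b) (f * g) := fun k hk => by
  rw [coeff_mul_eq_sum hf hg, Finset.Icc_eq_empty (by omega), Finset.sum_empty]

lemma exists_vanishBelow (f : LaurentSeries ℝ) : ∃ a : ℤ, VanishBelow a f :=
  ⟨f.order, fun _ hi => HahnSeries.coeff_eq_zero_of_lt_order hi⟩

lemma vanishBelow_C (r : ℝ) : VanishBelow 0 (HahnSeries.C r) := fun i hi => by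
  rw [HahnSeries.C_apply, HahnSeries.coeff_single_of_ne hi.ne]

lemma lam_pow (m : ℕ) : Loop.lam ^ m = HahnSeries.single (-(m : ℤ)) (1 : ℝ) := by
  rw [Loop.lam, HahnSeries.single_pow]; simp

lemma lam_sub_C_ne_zero (r : ℝ) : Loop.lam - HahnSeries.C r ≠ 0 := fun h => by
  have := congrArg (fun f : LaurentSeries ℝ => f.coeff (-1)) h
  simp [Loop.lam, HahnSeries.C_apply] at this

/-- Geometric series: with `u = λ⁻¹`, the inverse of `λ - r` is `u (1 - r u)⁻¹`, and the second
factor is a power series in `u`. -/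
lemma vanishBelow_inv_lam_sub_C (r : ℝ) :
    VanishBelow 1 (Loop.lam - HahnSeries.C r)⁻¹ := by
  set u : LaurentSeries ℝ := HahnSeries.single (1 : ℤ) (1 : ℝ) with hu
  set w : LaurentSeries ℝ :=
    HahnSeries.ofPowerSeries ℤ ℝ (1 - PowerSeries.C r * PowerSeries.X)⁻¹ with hw
  have h1 : Loop.lam * u = 1 := by
    rw [Loop.lam, hu, HahnSeries.single_mul_single]; simp
  have h2 : (1 - HahnSeries.C r * u) * w = 1 := by
    have : (1 - HahnSeries.C r * u : LaurentSeries ℝ)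
        = HahnSeries.ofPowerSeries ℤ ℝ (1 - PowerSeries.C r * PowerSeries.X) := by
      rw [map_sub, map_one, map_mul, HahnSeries.ofPowerSeries_C, HahnSeries.ofPowerSeries_X]
    rw [this, hw, ← map_mul, PowerSeries.mul_inv_cancel _ (by simp), map_one]
  have h3 : (Loop.lam - HahnSeries.C r)⁻¹ = u * w := by
    refine inv_eq_of_mul_eq_one_right ?_
    calc (Loop.lam - HahnSeries.C r) * (u * w) = (Loop.lam * u - HahnSeries.C r * u) * w := by ring
      _ = 1 := by rw [h1, h2]
  rw [h3]
  have hu' : VanishBelow 1 u := fun i hi => by rw [hu, HahnSeries.coeff_single_of_ne hi.ne]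
  have hw' : VanishBelow 0 w := fun i hi => by
    rw [hw, HahnSeries.ofPowerSeries_apply, HahnSeries.embDomain_of_notMem_range]
    rintro ⟨m, hm⟩
    simp at hm
    omega
  simpa using hu'.mul hw'

/-- The automorphism `λ ↦ -λ` of the field of Laurent series. -/
def flip : LaurentSeries ℝ →+* LaurentSeries ℝ where
  toFun f := ⟨fun k => (-1 : ℝ) ^ k * f.coeff k, f.isPWO_support.mono fun k hk h => hk (by
    simp only [h, mul_zero])⟩
  map_one' := by
    ext k
    by_cases hk : k = 0
    · subst hk; simp
    · simp [HahnSeries.coeff_one, hk]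
  map_zero' := by ext k; simp
  map_add' f g := by ext k; simp [mul_add]
  map_mul' f g := by
    obtain ⟨a, ha⟩ := exists_vanishBelow f
    obtain ⟨b, hb⟩ := exists_vanishBelow g
    ext k
    rw [coeff_mul_eq_sum (a := a) (b := b)]
    · simp only
      rw [coeff_mul_eq_sum ha hb, Finset.mul_sum]
      refine Finset.sum_congr rfl fun i _ => ?_
      have : (-1 : ℝ) ^ k = (-1) ^ i * (-1) ^ (k - i) := by
        rw [← zpow_add₀ (by norm_num)]; congr 1; ring
      rw [this]; ring
    · intro i hi; simp only [ha i hi, mul_zero]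
    · intro i hi; simp only [hb i hi, mul_zero]

lemma coeff_flip (f : LaurentSeries ℝ) (k : ℤ) : (flip f).coeff k = (-1 : ℝ) ^ k * f.coeff k := rfl

lemma flip_C (r : ℝ) : flip (HahnSeries.C r) = HahnSeries.C r := by
  ext k
  rw [coeff_flip]
  by_cases hk : k = 0
  · subst hk; simp
  · simp [HahnSeries.C_apply, hk]

lemma flip_lam : flip Loop.lam = -Loop.lam := by
  ext k
  rw [coeff_flip, Loop.lam, HahnSeries.coeff_neg]
  by_cases hk : k = -1
  · subst hk; simp
  · simp [hk]

/-- A family of series with smooth coefficients whose degrees in `λ` are uniformly bounded. -/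
def SmoothFamily (U : Set (ℝ × ℝ)) (f : ℝ × ℝ → LaurentSeries ℝ) : Prop :=
  (∀ i : ℤ, ContDiffOn ℝ ∞ (fun p => (f p).coeff i) U) ∧ ∃ a : ℤ, ∀ p ∈ U, VanishBelow a (f p)

variable {U : Set (ℝ × ℝ)} {f g : ℝ × ℝ → LaurentSeries ℝ}

lemma SmoothFamily.const (s : LaurentSeries ℝ) : SmoothFamily U fun _ => s :=
  ⟨fun _ => contDiffOn_const, (exists_vanishBelow s).imp fun _ h _ _ => h⟩

lemma SmoothFamily.C {r : ℝ × ℝ → ℝ} (hr : ContDiffOn ℝ ∞ r U) :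
    SmoothFamily U fun p => HahnSeries.C (r p) := by
  refine ⟨fun i => ?_, 0, fun p _ => vanishBelow_C _⟩
  by_cases hi : i = 0
  · subst hi; simpa [HahnSeries.C_apply] using hr
  · simpa [HahnSeries.C_apply, HahnSeries.coeff_single, hi] using contDiffOn_const

lemma SmoothFamily.add (hf : SmoothFamily U f) (hg : SmoothFamily U g) :
    SmoothFamily U fun p => f p + g p := by
  obtain ⟨hf, a, ha⟩ := hf
  obtain ⟨hg, b, hb⟩ := hg
  refine ⟨fun i => ?_, min a b, fun p hp =>
    ((ha p hp).mono (min_le_left _ _)).add ((hb p hp).mono (min_le_right _ _))⟩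
  simpa using (hf i).add (hg i)

lemma SmoothFamily.mul (hf : SmoothFamily U f) (hg : SmoothFamily U g) :
    SmoothFamily U fun p => f p * g p := by
  obtain ⟨hf, a, ha⟩ := hf
  obtain ⟨hg, b, hb⟩ := hg
  refine ⟨fun k => ?_, a + b, fun p hp => (ha p hp).mul (hb p hp)⟩
  have : ContDiffOn ℝ ∞
      (fun p => ∑ i ∈ Finset.Icc a (k - b), (f p).coeff i * (g p).coeff (k - i)) U :=
    ContDiffOn.sum fun i _ => (hf i).mul (hg _)
  exact this.congr fun p hp => coeff_mul_eq_sum (ha p hp) (hb p hp) k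

lemma SmoothFamily.sum {ι : Type*} (s : Finset ι) {f : ι → ℝ × ℝ → LaurentSeries ℝ}
    (hf : ∀ l ∈ s, SmoothFamily U (f l)) : SmoothFamily U fun p => ∑ l ∈ s, f l p := by
  classical
  induction s using Finset.induction_on with
  | empty => simpa using SmoothFamily.const 0
  | insert l s hl ih =>
    simp only [Finset.sum_insert hl]
    exact (hf l (Finset.mem_insert_self _ _)).add
      (ih fun l' h => hf l' (Finset.mem_insert_of_mem h))

/-- Coefficientwise derivative of a family of series. -/
def HasCoeffDerivAt (f : ℝ → LaurentSeries ℝ) (f' : LaurentSeries ℝ) (x : ℝ) : Prop :=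
  (∃ a : ℤ, ∀ᶠ y in 𝓝 x, VanishBelow a (f y)) ∧
    ∀ i : ℤ, HasDerivAt (fun y => (f y).coeff i) (f'.coeff i) x

variable {φ ψ : ℝ → LaurentSeries ℝ} {φ' ψ' : LaurentSeries ℝ} {x : ℝ}

lemma HasCoeffDerivAt.const (s : LaurentSeries ℝ) (x : ℝ) : HasCoeffDerivAt (fun _ => s) 0 x :=
  ⟨(exists_vanishBelow s).imp fun _ h => Filter.Eventually.of_forall fun _ => h,
    fun i => by simpa using hasDerivAt_const x (s.coeff i)⟩

lemma HasCoeffDerivAt.C {r : ℝ → ℝ} {r' : ℝ} (hr : HasDerivAt r r' x) :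
    HasCoeffDerivAt (fun y => HahnSeries.C (r y)) (HahnSeries.C r') x := by
  refine ⟨⟨0, Filter.Eventually.of_forall fun _ => vanishBelow_C _⟩, fun i => ?_⟩
  by_cases hi : i = 0
  · subst hi; simpa [HahnSeries.C_apply] using hr
  · simpa [HahnSeries.C_apply, HahnSeries.coeff_single, hi] using hasDerivAt_const x (0 : ℝ)

lemma HasCoeffDerivAt.add (hf : HasCoeffDerivAt φ φ' x) (hg : HasCoeffDerivAt ψ ψ' x) :
    HasCoeffDerivAt (fun y => φ y + ψ y) (φ' + ψ') x := by
  obtain ⟨⟨a, ha⟩, hf⟩ := hf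
  obtain ⟨⟨b, hb⟩, hg⟩ := hg
  refine ⟨⟨min a b, ?_⟩, fun i => by simpa using (hf i).fun_add (hg i)⟩
  filter_upwards [ha, hb] with y h1 h2
  exact (h1.mono (min_le_left _ _)).add (h2.mono (min_le_right _ _))

lemma HasCoeffDerivAt.vanishBelow {a : ℤ} (ha : ∀ᶠ y in 𝓝 x, VanishBelow a (φ y))
    (hf : HasCoeffDerivAt φ φ' x) : VanishBelow a φ' := fun i hi => by
  have h0 : (fun y => (φ y).coeff i) =ᶠ[𝓝 x] fun _ => 0 := by
    filter_upwards [ha] with y hy using hy i hi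
  exact (hf.2 i).unique ((hasDerivAt_const x (0 : ℝ)).congr_of_eventuallyEq h0)

/-- Near `x` each coefficient of the product is one fixed finite sum, so the usual Leibniz rule
applies. The derivatives inherit the lower bounds, which puts both terms of the answer over the same
range. -/
lemma HasCoeffDerivAt.mul (hf : HasCoeffDerivAt φ φ' x) (hg : HasCoeffDerivAt ψ ψ' x) :
    HasCoeffDerivAt (fun y => φ y * ψ y) (φ' * ψ x + φ x * ψ') x := by
  obtain ⟨a, ha⟩ := hf.1
  obtain ⟨b, hb⟩ := hg.1
  refine ⟨⟨a + b, by filter_upwards [ha, hb] with y h1 h2 using h1.mul h2⟩, fun k => ?_⟩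
  have h : (fun y => (φ y * ψ y).coeff k) =ᶠ[𝓝 x]
      fun y => ∑ i ∈ Finset.Icc a (k - b), (φ y).coeff i * (ψ y).coeff (k - i) := by
    filter_upwards [ha, hb] with y h1 h2 using coeff_mul_eq_sum h1 h2 k
  rw [HahnSeries.coeff_add, coeff_mul_eq_sum (hf.vanishBelow ha) hb.self_of_nhds,
    coeff_mul_eq_sum ha.self_of_nhds (hg.vanishBelow hb), ← Finset.sum_add_distrib]
  exact (HasDerivAt.fun_sum fun i _ => (hf.2 i).mul (hg.2 (k - i))).congr_of_eventuallyEq h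

lemma HasCoeffDerivAt.sum {ι : Type*} (s : Finset ι) {f : ι → ℝ → LaurentSeries ℝ}
    {f' : ι → LaurentSeries ℝ} (hf : ∀ l ∈ s, HasCoeffDerivAt (f l) (f' l) x) :
    HasCoeffDerivAt (fun y => ∑ l ∈ s, f l y) (∑ l ∈ s, f' l) x := by
  classical
  induction s using Finset.induction_on with
  | empty => simpa using HasCoeffDerivAt.const 0 x
  | insert l s hl ih =>
    simp only [Finset.sum_insert hl]
    exact (hf l (Finset.mem_insert_self _ _)).add
      (ih fun l' h => hf l' (Finset.mem_insert_of_mem h))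

end LaurentSeries

/-! ### Dressing by simple elements -/

section Dressing

open Polynomial

variable {n : ℕ} {K : Type*} [Field K] {c : ℝ →+* K} {ℓ : K} {α : ℝ} {P P' : Mat n ℝ}

/-- The simple element `I + 2α/(ℓ-α) (I - P)` over a field receiving `ℝ`. -/
def dress (c : ℝ →+* K) (ℓ : K) (α : ℝ) (P : Mat n ℝ) : Mat n K :=
  1 + (2 * c α / (ℓ - c α)) • (1 - P.map c)

/-- Evaluation of a matrix polynomial. -/
def polyEval (c : ℝ →+* K) (ℓ : K) : Mat n ℝ[X] →+* Mat n K :=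
  (Polynomial.eval₂RingHom c ℓ).mapMatrix

lemma map_compl (c : ℝ →+* K) (P : Mat n ℝ) : (1 - P).map c = 1 - P.map c := by
  simpa using map_sub c.mapMatrix 1 P

lemma map_compl_mul_self (hP : P * P = P) :
    (1 - P.map c) * (1 - P.map c) = 1 - P.map c := by
  have : P.map c * P.map c = P.map c := by rw [← Matrix.map_mul, hP]
  rw [sub_mul, one_mul, mul_sub, mul_one, this, sub_self, sub_zero]

/-- `1 - P` is idempotent, so the product is `1 + s (1 - P)` for a scalar `s`, and `s = 0`.
Inverting a simple element therefore amounts to replacing `α` by `-α`. -/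
lemma dress_mul_dress_neg (hP : P * P = P) (h1 : ℓ ≠ c α) (h2 : ℓ ≠ -c α) :
    dress c ℓ α P * dress c ℓ (-α) P = 1 := by
  have hR := map_compl_mul_self (c := c) hP
  rw [dress, dress]
  set R := 1 - P.map c
  simp only [add_mul, mul_add, Matrix.smul_mul, Matrix.mul_smul, one_mul, mul_one, hR, smul_smul]
  have h3 : ℓ - c α ≠ 0 := sub_ne_zero.2 h1
  have h4 : ℓ + c α ≠ 0 := by rwa [← sub_neg_eq_add, sub_ne_zero]
  have : 2 * c α / (ℓ - c α) + (2 * c (-α) / (ℓ - c (-α))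
      + 2 * c (-α) / (ℓ - c (-α)) * (2 * c α / (ℓ - c α))) = 0 := by
    rw [map_neg, sub_neg_eq_add]
    field_simp
    ring
  rw [add_assoc, ← add_smul, ← add_smul, this, zero_smul, add_zero]

lemma dress_neg_mul_dress (hP : P * P = P) (h1 : ℓ ≠ c α) (h2 : ℓ ≠ -c α) :
    dress c ℓ (-α) P * dress c ℓ α P = 1 :=
  mul_eq_one_comm.1 (dress_mul_dress_neg hP h1 h2)

lemma dress_inv (hP : P * P = P) (h1 : ℓ ≠ c α) (h2 : ℓ ≠ -c α) :
    (dress c ℓ α P)⁻¹ = dress c ℓ (-α) P :=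
  Matrix.inv_eq_right_inv (dress_mul_dress_neg hP h1 h2)

/-- Self-adjointness gives `C Pᵗ C = P`, while `λ ↦ -λ` moves the pole from `α` to `-α`. -/
lemma dress_twisted (hP : IsFormProj P) :
    (formMatrix n).map c * (dress c (-ℓ) α P)ᵀ * (formMatrix n).map c = dress c ℓ (-α) P := by
  have hC : (formMatrix n).map c * (formMatrix n).map c = 1 := by
    rw [← Matrix.map_mul, formMatrix_mul_self]; simp
  have hPC : (P.map c)ᵀ * (formMatrix n).map c = (formMatrix n).map c * P.map c := by
    rw [← Matrix.transpose_map, ← Matrix.map_mul, hP.2, Matrix.map_mul]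
  have hs : 2 * c α / (-ℓ - c α) = 2 * c (-α) / (ℓ - c (-α)) := by
    rw [map_neg, sub_neg_eq_add, ← neg_add', mul_neg, neg_div, div_neg]
  rw [dress, dress, Matrix.transpose_add, Matrix.transpose_one, Matrix.transpose_smul,
    Matrix.transpose_sub, Matrix.transpose_one, mul_assoc, add_mul, one_mul, Matrix.smul_mul,
    sub_mul, one_mul, hPC, mul_add, hC, Matrix.mul_smul, mul_sub, ← mul_assoc, hC, one_mul, hs]

lemma map_dress {K' : Type*} [Field K'] (θ : K →+* K') :
    (dress c ℓ α P).map θ = dress (θ.comp c) (θ ℓ) α P := by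
  ext i k
  have h2 : θ 2 = 2 := map_ofNat θ 2
  simp [dress, Matrix.one_apply, apply_ite θ, h2]

lemma dress_conj {Θ : Mat n ℝ} (hΘ : IsUnit Θ) :
    dress c ℓ α (Θ * P * Θ⁻¹) = Θ.map c * dress c ℓ α P * (Θ⁻¹).map c := by
  have h : Θ.map c * (Θ⁻¹).map c = 1 := by
    rw [← Matrix.map_mul, Matrix.mul_nonsing_inv _ ((Matrix.isUnit_iff_isUnit_det _).1 hΘ)]; simp
  rw [dress, dress, Matrix.map_mul, Matrix.map_mul, mul_add, add_mul, mul_one, h, Matrix.mul_smul,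
    Matrix.smul_mul, mul_sub, sub_mul, mul_one, h]

lemma det_dress_conj {Θ : Mat n ℝ} (hΘ : IsUnit Θ) :
    (dress c ℓ α (Θ * P * Θ⁻¹)).det = (dress c ℓ α P).det := by
  have h : Θ.map c * (Θ⁻¹).map c = 1 := by
    rw [← Matrix.map_mul, Matrix.mul_nonsing_inv _ ((Matrix.isUnit_iff_isUnit_det _).1 hΘ)]; simp
  have h2 := congrArg Matrix.det h
  rw [Matrix.det_mul, Matrix.det_one] at h2
  rw [dress_conj hΘ, Matrix.det_mul, Matrix.det_mul, mul_right_comm, h2, one_mul]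

/-- The numerator of `dress`, as a matrix polynomial. -/
def polyDress (α : ℝ) (P : Mat n ℝ) : Mat n ℝ[X] :=
  (X - C α) • 1 + C (2 * α) • (1 - P.map C)

/-- `Q` is the gauge transform of `A` by the numerator of `dress`, when the derivative of the
projection `P` is `P'`. -/
def IsGauge (α : ℝ) (P P' : Mat n ℝ) (A Q : Mat n ℝ[X]) : Prop :=
  Q * polyDress α P = polyDress α P * A + C (2 * α) • P'.map C

lemma polyEval_map_C (B : Mat n ℝ) : polyEval c ℓ (B.map C) = B.map c := by
  ext i k
  simp [polyEval]

lemma polyEval_smul (f : ℝ[X]) (B : Mat n ℝ[X]) :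
    polyEval c ℓ (f • B) = (f.eval₂ c ℓ) • polyEval c ℓ B := by
  ext i k
  simp [polyEval, Polynomial.eval₂_mul]

lemma polyEval_polyDress (h1 : ℓ ≠ c α) :
    polyEval c ℓ (polyDress α P) = (ℓ - c α) • dress c ℓ α P := by
  have h3 : ℓ - c α ≠ 0 := sub_ne_zero.2 h1
  rw [polyDress, map_add, polyEval_smul, polyEval_smul, map_sub, map_one, polyEval_map_C, dress,
    smul_add, smul_smul, mul_div_cancel₀ _ h3]
  have h2 : c 2 = 2 := map_ofNat c 2
  simp [h2]

/-- Division of the polynomial identity by `λ - α`. When `P'` is the derivative of `P`, the last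
term is minus that of the simple element `g`, so the identity is the gauge relation `Q g = g A -
g'`. -/
lemma IsGauge.eval {A Q : Mat n ℝ[X]} (h : IsGauge α P P' A Q) (h1 : ℓ ≠ c α) :
    polyEval c ℓ Q * dress c ℓ α P
      = dress c ℓ α P * polyEval c ℓ A + (2 * c α / (ℓ - c α)) • P'.map c := by
  have h3 : ℓ - c α ≠ 0 := sub_ne_zero.2 h1
  have := congrArg (polyEval c ℓ) h
  rw [map_mul, map_add, map_mul, polyEval_smul, polyEval_map_C, polyEval_polyDress h1,
    Matrix.mul_smul, Matrix.smul_mul, Polynomial.eval₂_C] at this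
  have h4 := congrArg (fun B => (ℓ - c α)⁻¹ • B) this
  simp only [smul_add, smul_smul, inv_mul_cancel₀ h3, one_smul] at h4
  rw [h4]
  congr 2
  rw [map_mul, map_ofNat, div_eq_inv_mul]

/-- The value of a matrix polynomial at a real number. -/
abbrev realEval (r : ℝ) : Mat n ℝ[X] →+* Mat n ℝ := polyEval (RingHom.id ℝ) r

lemma realEval_polyDress (r : ℝ) :
    realEval r (polyDress α P) = (r - α) • (1 : Mat n ℝ) + (2 * α) • (1 - P) := by
  rw [polyDress, map_add, polyEval_smul, polyEval_smul, map_sub, map_one, polyEval_map_C]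
  simp

lemma polyDress_mul_polyDress_neg (hP : P * P = P) :
    polyDress α P * polyDress (-α) P = ((X - C α) * (X + C α)) • 1 := by
  have hR : (1 - P.map C) * (1 - P.map C) = (1 - P.map (C : ℝ →+* ℝ[X])) := by
    have : P.map (C : ℝ →+* ℝ[X]) * P.map C = P.map C := by rw [← Matrix.map_mul, hP]
    rw [sub_mul, one_mul, mul_sub, mul_one, this, sub_self, sub_zero]
  rw [polyDress, polyDress]
  set R : Mat n ℝ[X] := 1 - P.map C
  simp only [add_mul, mul_add, Matrix.smul_mul, Matrix.mul_smul, one_mul, mul_one, hR, smul_smul,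
    map_mul, map_neg]
  have e4 : (C 2 : ℝ[X]) = 2 := rfl
  rw [e4]
  module

/-- Multiplication by the numerator for `-α` reduces the claim to the divisibility of `Y` by `(X -
α)(X + α)`. At `α` the right factor of `Y` becomes a multiple of `P`, at `-α` a multiple of `1 - P`;
the two terms of `P'` are the ones that make these values vanish. -/
lemma exists_isGauge (hP : P * P = P) (hα : α ≠ 0) {A : Mat n ℝ[X]}
    (hP' : P' = P * realEval (-α) A * (1 - P) - (1 - P) * realEval α A * P) :
    ∃ Q, IsGauge α P P' A Q := by
  have hR1 : P * (1 - P) = 0 := by rw [mul_sub, mul_one, hP, sub_self]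
  have hR2 : (1 - P) * P = 0 := by rw [sub_mul, one_mul, hP, sub_self]
  have hR : (1 - P) * (1 - P) = 1 - P := by rw [sub_mul, one_mul, hR1, sub_zero]
  set Y : Mat n ℝ[X] := (polyDress α P * A + C (2 * α) • P'.map C) * polyDress (-α) P with hY
  have hev : ∀ r : ℝ, realEval r Y = (((r - α) • (1 : Mat n ℝ) + (2 * α) • (1 - P)) * realEval r A
      + (2 * α) • P') * ((r + α) • 1 - (2 * α) • (1 - P)) := by
    intro r
    rw [hY, map_mul, map_add, map_mul, realEval_polyDress, realEval_polyDress, polyEval_smul,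
      polyEval_map_C]
    simp only [Polynomial.eval₂_C, RingHom.id_apply, sub_neg_eq_add, mul_neg, neg_smul,
      ← sub_eq_add_neg]
    rfl
  have h1 : realEval α Y = 0 := by
    have e : (α + α) • (1 : Mat n ℝ) - (2 * α) • (1 - P) = (2 * α) • P := by module
    rw [hev, sub_self, zero_smul, zero_add, hP', e]
    have z : ((1 - P) * realEval α A + (P * realEval (-α) A * (1 - P)
        - (1 - P) * realEval α A * P)) * P = 0 := by
      rw [add_mul, sub_mul _ _ P, mul_assoc (P * _), hR2, mul_zero, mul_assoc (_ * _) P P, hP,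
        zero_sub, add_neg_cancel]
    rw [Matrix.smul_mul, ← smul_add, Matrix.mul_smul, Matrix.smul_mul, z, smul_zero, smul_zero]
  have h2 : realEval (-α) Y = 0 := by
    have e : (-α + α) • (1 : Mat n ℝ) - (2 * α) • (1 - P) = -((2 * α) • (1 - P)) := by module
    have e' : (-α - α) • (1 : Mat n ℝ) + (2 * α) • (1 - P) = -((2 * α) • P) := by module
    rw [hev, e, e', hP']
    have z : (-(P * realEval (-α) A) + (P * realEval (-α) A * (1 - P)
        - (1 - P) * realEval α A * P)) * (1 - P) = 0 := by
      rw [add_mul, sub_mul _ _ (1 - P), mul_assoc (P * _), hR, mul_assoc (_ * _) P, hR1,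
        mul_zero, sub_zero, neg_mul, neg_add_cancel]
    rw [neg_mul, Matrix.smul_mul, ← smul_neg, ← smul_add, mul_neg, Matrix.mul_smul,
      Matrix.smul_mul, z, smul_zero, smul_zero, neg_zero]
  have hdvd : ∀ i k, (X - C α) * (X + C α) ∣ Y i k := by
    intro i k
    -- The roots `α` and `-α` differ by `2α`, a unit because `α ≠ 0`.
    have hcop : IsCoprime (X - C α) (X + C α) := by
      have := Polynomial.isCoprime_X_sub_C_of_isUnit_sub (a := α) (b := -α)
        (by rw [sub_neg_eq_add]; exact (isUnit_iff_ne_zero.2 (by simpa using hα)))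
      simpa using this
    refine hcop.mul_dvd ?_ ?_
    · rw [Polynomial.dvd_iff_isRoot]
      simpa [polyEval] using congrFun (congrFun h1 i) k
    · have : X + C α = X - C (-α) := by simp
      rw [this, Polynomial.dvd_iff_isRoot]
      simpa [polyEval] using congrFun (congrFun h2 i) k
  choose Q hQ using hdvd
  refine ⟨Matrix.of Q, ?_⟩
  have hYQ : Y = ((X - C α) * (X + C α)) • Matrix.of Q := by
    ext1 i k
    rw [hQ i k]; rfl
  have hne : (X - C α) * (X + C α) ≠ (0 : ℝ[X]) :=
    mul_ne_zero (Polynomial.X_sub_C_ne_zero _) (Polynomial.X_add_C_ne_zero _)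
  have hcomm : polyDress (-α) P * polyDress α P = ((X - C α) * (X + C α)) • 1 := by
    have := polyDress_mul_polyDress_neg (α := -α) hP
    rw [neg_neg] at this
    rw [this]
    congr 1
    simp only [map_neg]; ring
  have hfin : ((X - C α) * (X + C α)) • (Matrix.of Q * polyDress α P)
      = ((X - C α) * (X + C α)) • (polyDress α P * A + C (2 * α) • P'.map C) := by
    rw [← Matrix.smul_mul, ← hYQ, hY, mul_assoc, hcomm, Matrix.mul_smul, mul_one]
  ext1 i k
  have := congrFun (congrFun hfin i) k
  exact mul_left_cancel₀ hne (by simpa only [Matrix.smul_apply, smul_eq_mul] using this)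

/-- The matrix polynomial `J + q`. -/
def potential (q : Mat n ℝ) : Mat n ℝ[X] :=
  (shiftMatrix n + q).map C + (X : ℝ[X]) • (cornerMatrix n).map C

lemma realEval_potential (q : Mat n ℝ) (r : ℝ) :
    realEval r (potential q) = shiftMatrix n + q + r • cornerMatrix n := by
  rw [potential, map_add, polyEval_smul, polyEval_map_C, polyEval_map_C]
  simp

/-- For the linear polynomial `J + q` the transform is explicit: it has the same leading term `λe`,
and the constant term changes by `2α[e,P]`. The proof compares coefficients after reducing words in
`P`. -/
lemma isGauge_potential (hP : P * P = P) {q : Mat n ℝ}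
    (hP' : P' = P * realEval (-α) (potential q) * (1 - P)
      - (1 - P) * realEval α (potential q) * P) :
    IsGauge α P P' (potential q) (potential (q + (2 * α) • ⁅cornerMatrix n, P⁆)) := by
  rw [realEval_potential, realEval_potential] at hP'
  set M := shiftMatrix n + q with hM
  set e := cornerMatrix n with he
  set c : Mat n ℝ →+* Mat n ℝ[X] := (C : ℝ →+* ℝ[X]).mapMatrix with hc
  have hcs : ∀ (r : ℝ) (B : Mat n ℝ), c (r • B) = C r • c B := by
    intro r B; ext1 i k; simp [hc]
  have hP'c : c P' = c P * (c M + C (-α) • c e) * (1 - c P)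
      - (1 - c P) * (c M + C α • c e) * c P := by
    rw [hP']
    simp only [map_sub, map_mul, map_add, map_one, hcs]
  have hPc : c P * c P = c P := by rw [← map_mul, hP]
  have hPc' : ∀ B, c P * (c P * B) = c P * B := fun B => by rw [← mul_assoc, hPc]
  have e1 : potential q = c M + (X : ℝ[X]) • c e := rfl
  have e2 : potential (q + (2 * α) • ⁅e, P⁆)
      = c M + C (2 * α) • (c e * c P - c P * c e) + (X : ℝ[X]) • c e := by
    have : potential (q + (2 * α) • ⁅e, P⁆) = c (M + (2 * α) • ⁅e, P⁆) + (X : ℝ[X]) • c e := by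
      rw [hM, add_assoc]; rfl
    rw [this, map_add, hcs, Ring.lie_def, map_sub, map_mul c, map_mul c]
  rw [IsGauge, e1, e2]
  change _ = _ + C (2 * α) • c P'
  have e3 : polyDress α P = (X - C α) • 1 + C (2 * α) • (1 - c P) := rfl
  rw [e3, hP'c]
  simp only [mul_add, add_mul, mul_sub, sub_mul, Matrix.smul_mul, Matrix.mul_smul, mul_one, one_mul,
    mul_assoc, hPc, smul_add, smul_sub, smul_smul, map_mul, map_neg]
  have e4 : (C 2 : ℝ[X]) = 2 := rfl
  rw [e4]
  module

end Dressing

/-! ### Loops -/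

section Loops

open Polynomial

variable {n : ℕ} {U : Set (ℝ × ℝ)}

/-- Real numbers, as constant series. -/
abbrev loopC : ℝ →+* LaurentSeries ℝ := HahnSeries.C

lemma loop_smul_mul (s : LaurentSeries ℝ) (A B : Loop n) : (s • A) * B = s • (A * B) := by
  ext1 i k
  simp only [Matrix.mul_apply, Matrix.smul_apply, smul_eq_mul, Finset.mul_sum, mul_assoc]

lemma loop_mul_smul (s : LaurentSeries ℝ) (A B : Loop n) : A * (s • B) = s • (A * B) := by
  ext1 i k
  simp only [Matrix.mul_apply, Matrix.smul_apply, smul_eq_mul, Finset.mul_sum, mul_left_comm]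

/-- The coefficients of `λ^k` with `k > -a` vanish. -/
def LoopVanishBelow (a : ℤ) (A : Loop n) : Prop := ∀ i k, VanishBelow a (A i k)

lemma LoopVanishBelow.add {a : ℤ} {A B : Loop n} (hA : LoopVanishBelow a A)
    (hB : LoopVanishBelow a B) : LoopVanishBelow a (A + B) :=
  fun i k => (hA i k).add (hB i k)

lemma LoopVanishBelow.sub {a : ℤ} {A B : Loop n} (hA : LoopVanishBelow a A)
    (hB : LoopVanishBelow a B) : LoopVanishBelow a (A - B) := fun i k m hm => by
  rw [Matrix.sub_apply, HahnSeries.coeff_sub, hA i k m hm, hB i k m hm, sub_zero]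

lemma LoopVanishBelow.mul {a b : ℤ} {A B : Loop n} (hA : LoopVanishBelow a A)
    (hB : LoopVanishBelow b B) : LoopVanishBelow (a + b) (A * B) := fun i k => by
  rw [Matrix.mul_apply]
  exact VanishBelow.sum _ fun l _ => (hA i l).mul (hB l k)

lemma LoopVanishBelow.smul {a b : ℤ} {s : LaurentSeries ℝ} {A : Loop n} (hs : VanishBelow a s)
    (hA : LoopVanishBelow b A) : LoopVanishBelow (a + b) (s • A) := fun i k =>
  hs.mul (hA i k)

lemma loopVanishBelow_const (A : Mat n ℝ) : LoopVanishBelow 0 (Loop.const A) :=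
  fun _ _ => vanishBelow_C _

lemma vanishBelow_dress_factor (α : ℝ) :
    VanishBelow 1 (2 * loopC α / (Loop.lam - loopC α) : LaurentSeries ℝ) := by
  have h2 : (2 * loopC α : LaurentSeries ℝ) = loopC (2 * α) := by
    rw [map_mul, map_ofNat]
  rw [div_eq_mul_inv, h2]
  simpa using (vanishBelow_C (2 * α)).mul (vanishBelow_inv_lam_sub_C α)

lemma loopVanishBelow_dress (α : ℝ) (P : Mat n ℝ) :
    LoopVanishBelow 0 (dress loopC Loop.lam α P) := by
  have h1 : LoopVanishBelow 0 (1 : Loop n) := by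
    simpa [Loop.const] using loopVanishBelow_const (1 : Mat n ℝ)
  rw [dress, ← map_compl]
  refine h1.add fun i k => ?_
  exact (((vanishBelow_dress_factor α).mono zero_le_one).mul
    (loopVanishBelow_const (1 - P) i k)).mono (by simp)

lemma lam_ne_C (α : ℝ) : Loop.lam ≠ loopC α := sub_ne_zero.1 (lam_sub_C_ne_zero α)

lemma lam_ne_neg_C (α : ℝ) : Loop.lam ≠ -loopC α := by
  rw [← map_neg]; exact lam_ne_C _

/-- `Q` collects the nonnegative powers of `λ` in `A`. -/
def IsPlusPart (Q : Mat n ℝ[X]) (A : Loop n) : Prop :=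
  ∀ i k, ∀ m : ℕ, (Q i k).coeff m = A.coeff (m : ℤ) i k

lemma coeff_eval₂_lam (f : ℝ[X]) (i : ℤ) :
    (f.eval₂ loopC Loop.lam).coeff (-i) =
      if 0 ≤ i then f.coeff i.toNat else 0 := by
  induction f using Polynomial.induction_on' with
  | add f g hf hg =>
    rw [Polynomial.eval₂_add, HahnSeries.coeff_add, hf, hg]
    split_ifs <;> simp
  | monomial m r =>
    rw [Polynomial.eval₂_monomial, lam_pow, HahnSeries.C_apply, HahnSeries.single_mul_single,
      HahnSeries.coeff_single, Polynomial.coeff_monomial]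
    by_cases hi : 0 ≤ i
    · rw [if_pos hi]
      by_cases h : m = i.toNat
      · rw [if_pos h, if_pos (by omega), mul_one]
      · rw [if_neg h, if_neg (by omega)]
    · rw [if_neg hi, if_neg (by omega)]

/-- The series variable is `λ⁻¹`, so vanishing below index `1` means that only negative powers of
`λ` remain. In this form the property is stable under multiplication by loops without positive
powers. -/
lemma isPlusPart_iff {Q : Mat n ℝ[X]} {A : Loop n} :
    IsPlusPart Q A ↔ LoopVanishBelow 1 (A - polyEval loopC Loop.lam Q) := by
  constructor
  · intro h i k m hm
    obtain ⟨m, rfl⟩ : ∃ m' : ℕ, m = -(m' : ℤ) := ⟨m.natAbs, by omega⟩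
    rw [Matrix.sub_apply, HahnSeries.coeff_sub]
    have := coeff_eval₂_lam (Q i k) (m : ℤ)
    rw [if_pos (by omega), Int.toNat_natCast, h i k m] at this
    exact sub_eq_zero.2 this.symm
  · intro h i k m
    have h1 := h i k (-(m : ℤ)) (by omega)
    rw [Matrix.sub_apply, HahnSeries.coeff_sub] at h1
    have h2 := coeff_eval₂_lam (Q i k) (m : ℤ)
    rw [if_pos (by omega), Int.toNat_natCast] at h2
    exact h2.symm.trans (sub_eq_zero.1 h1).symm

lemma exists_isPlusPart (A : Loop n) : ∃ Q, IsPlusPart Q A := by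
  have : ∀ i k, ∃ f : ℝ[X], ∀ m : ℕ, f.coeff m = A.coeff (m : ℤ) i k := by
    intro i k
    obtain ⟨a, ha⟩ := exists_vanishBelow (A i k)
    -- No power of `λ` above `-a` occurs, so cutting off at `|a|` loses nothing.
    refine ⟨∑ m ∈ Finset.range (a.natAbs + 1), Polynomial.monomial m (A.coeff (m : ℤ) i k),
      fun m => ?_⟩
    rw [Polynomial.finsetSum_coeff]
    simp only [Polynomial.coeff_monomial]
    rw [Finset.sum_ite_eq' (Finset.range (a.natAbs + 1)) m]
    split_ifs with h
    · rfl
    · rw [Finset.mem_range] at h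
      exact (ha (-(m : ℤ)) (by omega)).symm
  choose Q hQ using this
  exact ⟨Matrix.of Q, hQ⟩

lemma IsPlusPart.plusEval {Q : Mat n ℝ[X]} {A : Loop n} (h : IsPlusPart Q A) (z : ℂ) :
    A.plusEval z = polyEval Complex.ofRealHom z Q := by
  classical
  set d := (Finset.univ.sup fun ik : Fin (2 * n + 1) × Fin (2 * n + 1) =>
    (Q ik.1 ik.2).natDegree) + 1
  have hd : ∀ i k, (Q i k).natDegree < d := fun i k =>
    Nat.lt_succ_of_le (Finset.le_sup
      (f := fun ik : Fin (2 * n + 1) × Fin (2 * n + 1) => (Q ik.1 ik.2).natDegree)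
      (Finset.mem_univ (i, k)))
  rw [Loop.plusEval, finsum_eq_sum_of_support_subset (s := Finset.range d)]
  · ext i k
    rw [Matrix.sum_apply]
    simp only [polyEval, RingHom.mapMatrix_apply, Matrix.map_apply, Polynomial.coe_eval₂RingHom,
      Polynomial.eval₂_eq_sum_range' _ (hd i k)]
    refine Finset.sum_congr rfl fun m _ => ?_
    rw [h i k m, Matrix.smul_apply, Matrix.map_apply, smul_eq_mul, mul_comm]
    rfl
  · intro m hm
    by_contra hlt
    apply hm
    rw [Finset.coe_range, Set.mem_Iio, not_lt] at hlt
    have : A.coeff (m : ℤ) = 0 := by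
      ext i k
      rw [← h i k m]
      exact Polynomial.coeff_eq_zero_of_natDegree_lt ((hd i k).trans_le hlt)
    ext i k
    simp [this]

lemma IsPlusPart.realEval_zero {Q : Mat n ℝ[X]} {A : Loop n} (h : IsPlusPart Q A) :
    realEval 0 Q = A.coeff 0 := by
  ext i k
  have := h i k 0
  rw [Nat.cast_zero] at this
  rw [← this, Polynomial.coeff_zero_eq_eval_zero]
  rfl

/-- Conjugation of a loop by a simple element. -/
def dressConj (α : ℝ) (P : Mat n ℝ) (A : Loop n) : Loop n :=
  dress loopC Loop.lam α P * A * dress loopC Loop.lam (-α) P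

/-- The gauge transform of the polynomial part is the polynomial part of the conjugate. -/
lemma IsPlusPart.dressConj {α : ℝ} {P P' : Mat n ℝ} {A : Loop n} {Q Q' : Mat n ℝ[X]}
    (h : IsPlusPart Q A) (hP : P * P = P) (hg : IsGauge α P P' Q Q') :
    IsPlusPart Q' (dressConj α P A) := by
  rw [isPlusPart_iff] at h ⊢
  have hGG := dress_mul_dress_neg (c := loopC) hP (lam_ne_C α) (lam_ne_neg_C α)
  rw [IsotropicKdV.dressConj]
  set G := dress loopC Loop.lam α P with hG
  set G' := dress loopC Loop.lam (-α) P with hG'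
  set B := polyEval loopC Loop.lam Q with hB
  set B' := polyEval loopC Loop.lam Q' with hB'
  have hev : B' * G = G * B
      + (2 * loopC α / (Loop.lam - loopC α)) • Loop.const P' := hg.eval (lam_ne_C α)
  set s : LaurentSeries ℝ := 2 * loopC α / (Loop.lam - loopC α)
  have e1 : B' = G * B * G' + s • (Loop.const P' * G') := by
    calc B' = B' * (G * G') := by rw [hGG, mul_one]
      _ = _ := by rw [← mul_assoc, hev, add_mul, loop_smul_mul]
  -- Both terms have only negative powers: the first because `A - B` has and `G`, `G'` contain no
  -- positive powers, the second because of the factor `s = 2α/(λ - α)`.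
  have e2 : G * A * G' - B' = G * (A - B) * G' - s • (Loop.const P' * G') := by
    rw [e1, mul_sub, sub_mul, sub_sub]
  rw [e2]
  have h1 : LoopVanishBelow 0 G := loopVanishBelow_dress α P
  have h2 : LoopVanishBelow 0 G' := loopVanishBelow_dress (-α) P
  refine LoopVanishBelow.sub ?_ ?_
  · simpa using (h1.mul h).mul h2
  · exact LoopVanishBelow.smul (vanishBelow_dress_factor α)
      ((loopVanishBelow_const P').mul h2)

/-! ### Powers of the resolvent -/

lemma J_apply (i k : Fin (2 * n + 1)) :
    Loop.J n i k = (if (i : ℕ) = k + 1 then 1 else 0)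
      + (if (i : ℕ) = 0 ∧ (k : ℕ) = 2 * n then Loop.lam else 0) := by
  rw [Loop.J, Matrix.add_apply, Matrix.smul_apply, Loop.const, Loop.const, Matrix.map_apply,
    Matrix.map_apply, shiftMatrix, cornerMatrix, Matrix.of_apply, Matrix.single_apply]
  congr 1
  · split_ifs <;> simp
  · have : (0 = i ∧ Fin.last (2 * n) = k) ↔ ((i : ℕ) = 0 ∧ (k : ℕ) = 2 * n) := by
      simp only [Fin.ext_iff, Fin.val_last]
      exact and_congr eq_comm eq_comm
    simp only [this]
    split_ifs <;> simp

lemma J_mul_apply_zero (A : Loop n) (k : Fin (2 * n + 1)) :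
    (Loop.J n * A) 0 k = Loop.lam * A (Fin.last (2 * n)) k := by
  rw [Matrix.mul_apply, Finset.sum_eq_single (Fin.last (2 * n))]
  · simp [J_apply]
  · intro l _ hl
    have : ¬ (l : ℕ) = 2 * n := fun h => hl (Fin.ext h)
    simp [J_apply, this]
  · simp

lemma J_mul_apply_succ (A : Loop n) (i k m : Fin (2 * n + 1)) (him : (i : ℕ) = m + 1) :
    (Loop.J n * A) i k = A m k := by
  rw [Matrix.mul_apply, Finset.sum_eq_single m]
  · simp [J_apply, him]
  · intro l _ hl
    have : ¬ (m : ℕ) = l := fun h => hl (Fin.ext h.symm)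
    simp [J_apply, him, this]
  · simp

/-- `J` is a cyclic shift in which passing from the last basis vector to the first costs a factor
`λ`. Up to the power `2n+1` at most one such passage occurs, hence only two nonzero cases. -/
lemma J_pow_apply (m : ℕ) (hm : m ≤ 2 * n + 1) (i k : Fin (2 * n + 1)) :
    (Loop.J n ^ m) i k = if (i : ℕ) = k + m then 1
      else if (i : ℕ) + (2 * n + 1) = k + m then Loop.lam else 0 := by
  induction m generalizing i k with
  | zero =>
    have := k.2
    rw [pow_zero, Matrix.one_apply]
    by_cases h : i = k
    · simp [h]
    · have h' : ¬ (i : ℕ) = k := fun h'' => h (Fin.ext h'')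
      rw [if_neg h, if_neg (by omega), if_neg (by omega)]
  | succ m ih =>
    have hi := i.2
    have hk := k.2
    rw [pow_succ']
    by_cases h0 : i = 0
    · subst h0
      rw [J_mul_apply_zero, ih (by omega), Fin.val_last]
      have hz : ((0 : Fin (2 * n + 1)) : ℕ) = 0 := rfl
      by_cases h : 2 * n = k + m
      · rw [if_pos h, if_neg (by omega), if_pos (by omega), mul_one]
      · rw [if_neg h, if_neg (by omega), if_neg (by omega), if_neg (by omega), mul_zero]
    · have hi0 : (i : ℕ) ≠ 0 := fun h => h0 (Fin.ext h)
      rw [J_mul_apply_succ _ i k ⟨i - 1, by omega⟩ (by simp; omega), ih (by omega)]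
      simp only
      by_cases h : (i : ℕ) = k + (m + 1)
      · rw [if_pos h, if_pos (by omega)]
      · rw [if_neg h, if_neg (by omega)]
        by_cases h' : (i : ℕ) + (2 * n + 1) = k + (m + 1)
        · rw [if_pos h', if_pos (by omega)]
        · rw [if_neg h', if_neg (by omega)]

lemma J_pow : Loop.J n ^ (2 * n + 1) = Loop.lam • (1 : Loop n) := by
  ext1 i k
  have hi := i.2
  have hk := k.2
  rw [J_pow_apply _ le_rfl, Matrix.smul_apply, Matrix.one_apply, if_neg (by omega)]
  by_cases h : i = k
  · subst h; simp
  · have h' : ¬ (i : ℕ) = k := fun h'' => h (Fin.ext h'')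
    rw [if_neg h, if_neg (by omega), smul_eq_mul, mul_zero]

/-- The scalar matrix `J^(2n+1) = λ` is central, so conjugation leaves it unchanged. This expresses
`S⁻¹` through the power `S^(2n)`. -/
lemma pow_eq_of_isConj {S : Loop n} (h : IsConj (Loop.J n) S) :
    S ^ (2 * n + 1) = Loop.lam • (1 : Loop n) := by
  obtain ⟨u, hu⟩ := h
  have h1 : SemiconjBy (u : Loop n) (Loop.J n ^ (2 * n + 1)) (S ^ (2 * n + 1)) :=
    SemiconjBy.pow_right hu _
  rw [J_pow] at h1
  have h2 : S ^ (2 * n + 1) * u = (Loop.lam • (1 : Loop n)) * u := by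
    rw [← h1.eq, loop_mul_smul, loop_smul_mul, mul_one, one_mul]
  exact u.isUnit.mul_right_cancel h2

lemma lam_ne_zero : Loop.lam ≠ 0 := by simpa using lam_ne_C 0

lemma inv_eq_of_isConj {S : Loop n} (h : IsConj (Loop.J n) S) :
    S⁻¹ = Loop.lam⁻¹ • S ^ (2 * n) := by
  refine Matrix.inv_eq_right_inv ?_
  rw [loop_mul_smul, ← pow_succ', pow_eq_of_isConj h]
  ext1 i k
  rw [Matrix.smul_apply, Matrix.smul_apply, smul_eq_mul, smul_eq_mul,
    inv_mul_cancel_left₀ lam_ne_zero]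

/-- `j = 0` is allowed, so the exponent may be `-1`; this is the only case that involves an inverse.
-/
lemma zpow_odd_cases (j : ℕ) : (2 * (j : ℤ) - 1 = -1) ∨ ∃ m : ℕ, 2 * (j : ℤ) - 1 = m := by
  rcases j with _ | j
  · left; simp
  · right; exact ⟨2 * j + 1, by push_cast; ring⟩

lemma dressConj_zpow {α : ℝ} {P : Mat n ℝ} (hP : P * P = P) (S : Loop n) (j : ℕ) :
    dressConj α P S ^ (2 * (j : ℤ) - 1) = dressConj α P (S ^ (2 * (j : ℤ) - 1)) := by
  have h1 := dress_mul_dress_neg (c := loopC) hP (lam_ne_C α) (lam_ne_neg_C α)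
  have h2 := dress_neg_mul_dress (c := loopC) hP (lam_ne_C α) (lam_ne_neg_C α)
  rcases zpow_odd_cases j with h | ⟨m, h⟩
  · rw [h, Matrix.zpow_neg_one, Matrix.zpow_neg_one, dressConj, dressConj, Matrix.mul_inv_rev,
      Matrix.mul_inv_rev, Matrix.inv_eq_right_inv h1, Matrix.inv_eq_right_inv h2, mul_assoc]
  · rw [h, zpow_natCast, zpow_natCast]
    clear h
    induction m with
    | zero => rw [pow_zero, pow_zero, dressConj, mul_one, h1]
    | succ m ih =>
      rw [pow_succ, pow_succ, ih, dressConj, dressConj, dressConj]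
      calc _ = dress loopC Loop.lam α P * S ^ m
            * (dress loopC Loop.lam (-α) P * dress loopC Loop.lam α P) * S
            * dress loopC Loop.lam (-α) P := by simp only [mul_assoc]
        _ = _ := by rw [h2, mul_one]; simp only [mul_assoc]

/-- A family of loops with smooth coefficients and uniformly bounded degrees. -/
def SmoothLoop (U : Set (ℝ × ℝ)) (A : ℝ × ℝ → Loop n) : Prop :=
  ∀ i k, SmoothFamily U fun p => A p i k

lemma SmoothLoop.mul {A B : ℝ × ℝ → Loop n} (hA : SmoothLoop U A) (hB : SmoothLoop U B) :
    SmoothLoop U fun p => A p * B p := fun i k => by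
  simp only [Matrix.mul_apply]
  exact SmoothFamily.sum _ fun l _ => (hA i l).mul (hB l k)

lemma SmoothLoop.const (A : Loop n) : SmoothLoop U fun _ => A :=
  fun _ _ => SmoothFamily.const _

lemma SmoothLoop.pow {A : ℝ × ℝ → Loop n} (hA : SmoothLoop U A) (m : ℕ) :
    SmoothLoop U fun p => A p ^ m := by
  induction m with
  | zero => simpa using SmoothLoop.const 1
  | succ m ih => simpa only [pow_succ] using ih.mul hA

lemma SmoothLoop.congr {A B : ℝ × ℝ → Loop n} (hA : SmoothLoop U A) (h : ∀ p ∈ U, B p = A p) :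
    SmoothLoop U B := fun i k => by
  obtain ⟨h1, a, h2⟩ := hA i k
  have h' : ∀ p ∈ U, B p i k = A p i k := fun p hp => congrFun (congrFun (h p hp) i) k
  exact ⟨fun m => (h1 m).congr fun p hp =>
      congrArg (fun f : LaurentSeries ℝ => f.coeff m) (h' p hp),
    a, fun p hp m hm => by simpa only [h' p hp] using h2 p hp m hm⟩

lemma SmoothLoop.exists_bound {A : ℝ × ℝ → Loop n} (hA : SmoothLoop U A) :
    ∃ a : ℤ, ∀ p ∈ U, LoopVanishBelow a (A p) := by
  choose a ha using fun i k => (hA i k).2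
  obtain ⟨b, hb⟩ := (Set.finite_range fun ik : Fin (2 * n + 1) × Fin (2 * n + 1) =>
    a ik.1 ik.2).bddBelow
  exact ⟨b, fun p hp i k => (ha i k p hp).mono (hb ⟨(i, k), rfl⟩)⟩

lemma SmoothLoop.dress {α : ℝ} {P : ℝ × ℝ → Mat n ℝ} (hP : SmoothOn U P) :
    SmoothLoop U fun p => dress loopC Loop.lam α (P p) := fun i k => by
  have h1 : SmoothFamily U fun p => HahnSeries.C ((1 - P p) i k) :=
    SmoothFamily.C (contDiffOn_const.sub (hP i k))
  simp only [IsotropicKdV.dress, ← map_compl]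
  exact (SmoothFamily.const _).add ((SmoothFamily.const _).mul h1)

lemma IsResolvent.smoothLoop {q : ℝ × ℝ → Mat n ℝ} {S : ℝ × ℝ → Loop n} (h : IsResolvent U q S) :
    SmoothLoop U S := fun i k => by
  obtain ⟨m, hm⟩ := h.bounded
  refine ⟨fun a => by simpa [Loop.coeff] using h.smooth (-a) i k, -m, fun p hp a ha => ?_⟩
  have := congrFun (congrFun (hm p hp (-a) (by omega)) i) k
  simpa [Loop.coeff] using this

/-- For the exponent `-1`, smoothness of the inverse and a uniform degree bound come from `S⁻¹ = λ⁻¹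
S^(2n)`, which involves only products. -/
lemma IsResolvent.smoothLoop_zpow {q : ℝ × ℝ → Mat n ℝ} {S : ℝ × ℝ → Loop n}
    (h : IsResolvent U q S) (j : ℕ) : SmoothLoop U fun p => S p ^ (2 * (j : ℤ) - 1) := by
  rcases zpow_odd_cases j with hj | ⟨m, hj⟩
  · have h1 : SmoothLoop U fun p => (Loop.lam⁻¹ • (1 : Loop n)) * S p ^ (2 * n) :=
      (SmoothLoop.const _).mul (h.smoothLoop.pow _)
    refine h1.congr fun p hp => ?_
    rw [hj, Matrix.zpow_neg_one, inv_eq_of_isConj (h.conj p hp), loop_smul_mul, one_mul]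
  · simpa only [hj, zpow_natCast] using h.smoothLoop.pow m

end Loops

section ResolventTransform

open Polynomial

variable {n : ℕ} {U : Set (ℝ × ℝ)}

/-! ### The transformed resolvent -/

lemma loop_mul_neg (A B : Loop n) : A * -B = -(A * B) := mul_neg A B

lemma loop_neg_mul (A B : Loop n) : -A * B = -(A * B) := neg_mul A B

/-- Product rule for the inverse `G'` of a gauge factor `G`. The ring is arbitrary because the
identity serves both for loops and for complex matrices. -/
lemma gauge_inv_deriv {R : Type*} [Ring R] {G G' A B dG dG' : R} (h1 : G * G' = 1)
    (h2 : G' * G = 1) (hd : dG' * G + G' * dG = 0) (e1 : dG = G * A - B * G) :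
    dG' = G' * B - A * G' := by
  have : dG' * G = -(G' * dG) := eq_neg_of_add_eq_zero_left hd
  calc dG' = dG' * G * G' := by rw [mul_assoc, h1, mul_one]
    _ = G' * B * (G * G') - (G' * G) * A * G' := by rw [this, e1]; noncomm_ring
    _ = _ := by rw [h1, h2, mul_one, one_mul]

/-- The algebra behind the invariance of `[∂ + A, S] = 0` under a gauge transformation. -/
lemma lax_gauge {R : Type*} [Ring R] {G G' S A B dG dG' : R} (h1 : G * G' = 1) (h2 : G' * G = 1)
    (hd : dG' * G + G' * dG = 0) (hg : B * G = G * A - dG) :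
    (dG * S + G * (S * A - A * S)) * G' + G * S * dG'
      + (B * (G * S * G') - G * S * G' * B) = 0 := by
  have e1 : dG = G * A - B * G := by rw [hg]; abel
  have e2 := gauge_inv_deriv h1 h2 hd e1
  rw [e1, e2]
  noncomm_ring

/-- Coefficientwise derivative of a family of loops. -/
def HasLoopDerivAt (A : ℝ → Loop n) (A' : Loop n) (x : ℝ) : Prop :=
  ∀ i k, HasCoeffDerivAt (fun y => A y i k) (A' i k) x

lemma HasLoopDerivAt.mul {A B : ℝ → Loop n} {A' B' : Loop n} {x : ℝ} (hA : HasLoopDerivAt A A' x)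
    (hB : HasLoopDerivAt B B' x) :
    HasLoopDerivAt (fun y => A y * B y) (A' * B x + A x * B') x := fun i k => by
  simp only [Matrix.mul_apply, Matrix.add_apply, ← Finset.sum_add_distrib]
  exact HasCoeffDerivAt.sum _ fun l _ => (hA i l).mul (hB l k)

lemma HasLoopDerivAt.unique {A : ℝ → Loop n} {A' B' : Loop n} {x : ℝ} (hA : HasLoopDerivAt A A' x)
    (hB : HasLoopDerivAt A B' x) : A' = B' := by
  ext i k m
  exact ((hA i k).2 m).unique ((hB i k).2 m)

lemma HasLoopDerivAt.congr {A B : ℝ → Loop n} {A' : Loop n} {x : ℝ} (hA : HasLoopDerivAt A A' x)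
    (h : ∀ᶠ y in 𝓝 x, B y = A y) : HasLoopDerivAt B A' x := by
  intro i k
  obtain ⟨⟨a, ha⟩, hd⟩ := hA i k
  have h' : ∀ᶠ y in 𝓝 x, B y i k = A y i k := h.mono fun y hy => congrFun (congrFun hy i) k
  refine ⟨⟨a, ?_⟩, fun m => (hd m).congr_of_eventuallyEq ?_⟩
  · filter_upwards [ha, h'] with y h1 h2 m hm
    rw [h2]; exact h1 m hm
  · filter_upwards [h'] with y h2
    rw [h2]

lemma HasLoopDerivAt.partialX_coeff {A : ℝ × ℝ → Loop n} {A' : Loop n} {p : ℝ × ℝ}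
    (hA : HasLoopDerivAt (fun x => A (x, p.2)) A' p.1) (k : ℤ) :
    partialX (fun p' => (A p').coeff k) p = A'.coeff k := by
  ext i l
  exact ((hA i l).2 (-k)).deriv

lemma HasLoopDerivAt.const (A : Loop n) (x : ℝ) : HasLoopDerivAt (fun _ => A) 0 x :=
  fun _ _ => HasCoeffDerivAt.const _ x

section Partial

variable {K : Type*} [NormedAddCommGroup K] [NormedSpace ℝ K]

lemma differentiableAt_slice_x {f : ℝ × ℝ → K} (hf : ContDiffOn ℝ ∞ f U) (hU : IsOpen U)
    {p : ℝ × ℝ} (hp : p ∈ U) : DifferentiableAt ℝ (fun x => f (x, p.2)) p.1 := by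
  have h1 : DifferentiableAt ℝ f p :=
    ((hf.contDiffAt (hU.mem_nhds hp)).differentiableAt (by simp))
  exact DifferentiableAt.comp (f := fun x : ℝ => (x, p.2)) p.1 h1 (by fun_prop)

lemma differentiableAt_slice_t {f : ℝ × ℝ → K} (hf : ContDiffOn ℝ ∞ f U) (hU : IsOpen U)
    {p : ℝ × ℝ} (hp : p ∈ U) : DifferentiableAt ℝ (fun t => f (p.1, t)) p.2 := by
  have h1 : DifferentiableAt ℝ f p :=
    ((hf.contDiffAt (hU.mem_nhds hp)).differentiableAt (by simp))
  exact DifferentiableAt.comp (f := fun t : ℝ => (p.1, t)) p.2 h1 (by fun_prop)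

lemma SmoothOn.hasDerivAt_x {A : ℝ × ℝ → Mat n K} (hA : SmoothOn U A) (hU : IsOpen U)
    {p : ℝ × ℝ} (hp : p ∈ U) (i k : Fin (2 * n + 1)) :
    HasDerivAt (fun x => A (x, p.2) i k) (partialX A p i k) p.1 :=
  (differentiableAt_slice_x (hA i k) hU hp).hasDerivAt

lemma SmoothOn.hasDerivAt_t {A : ℝ × ℝ → Mat n K} (hA : SmoothOn U A) (hU : IsOpen U)
    {p : ℝ × ℝ} (hp : p ∈ U) (i k : Fin (2 * n + 1)) :
    HasDerivAt (fun t => A (p.1, t) i k) (partialT A p i k) p.2 :=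
  (differentiableAt_slice_t (hA i k) hU hp).hasDerivAt

end Partial

lemma hasLoopDerivAt_dress {P : ℝ → Mat n ℝ} {P' : Mat n ℝ} {x : ℝ} (α : ℝ)
    (hP : ∀ i k, HasDerivAt (fun y => P y i k) (P' i k) x) :
    HasLoopDerivAt (fun y => dress loopC Loop.lam α (P y))
      (-((2 * loopC α / (Loop.lam - loopC α)) • Loop.const P')) x := by
  intro i k
  have h1 : HasCoeffDerivAt (fun y => loopC ((1 - P y) i k)) (loopC (-(P' i k))) x :=
    HasCoeffDerivAt.C ((hP i k).const_sub ((1 : Mat n ℝ) i k))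
  have h2 := (HasCoeffDerivAt.const ((1 : Loop n) i k) x).add
    ((HasCoeffDerivAt.const (2 * loopC α / (Loop.lam - loopC α)) x).mul h1)
  have e : (-((2 * loopC α / (Loop.lam - loopC α)) • Loop.const P')) i k
      = 0 + (0 * loopC ((1 - P x) i k)
        + 2 * loopC α / (Loop.lam - loopC α) * loopC (-(P' i k))) := by
    rw [map_neg, Matrix.neg_apply, Matrix.smul_apply, smul_eq_mul, zero_mul, zero_add, zero_add]
    exact (mul_neg (2 * loopC α / (Loop.lam - loopC α)) (loopC (P' i k))).symm
  rw [e]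
  simp only [dress, ← map_compl]
  exact h2

lemma polyEval_potential_loop (q : Mat n ℝ) :
    polyEval loopC Loop.lam (potential q) = Loop.J n + Loop.const q := by
  rw [potential, map_add, polyEval_smul, polyEval_map_C, polyEval_map_C, Polynomial.eval₂_X,
    Loop.J]
  ext1 i k
  simp only [Matrix.add_apply, Matrix.smul_apply, Matrix.map_apply, Loop.const, map_add]
  ring

lemma coeff_add (A B : Loop n) (k : ℤ) : (A + B).coeff k = A.coeff k + B.coeff k := by
  ext i l; simp [Loop.coeff]

lemma coeff_neg (A : Loop n) (k : ℤ) : (-A).coeff k = -A.coeff k := by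
  ext i l; simp [Loop.coeff]

lemma IsResolvent.hasLoopDerivAt {q : ℝ × ℝ → Mat n ℝ} {S : ℝ × ℝ → Loop n}
    (h : IsResolvent U q S) (hU : IsOpen U) {p : ℝ × ℝ} (hp : p ∈ U) :
    HasLoopDerivAt (fun x => S (x, p.2))
      (S p * (Loop.J n + Loop.const (q p)) - (Loop.J n + Loop.const (q p)) * S p) p.1 := by
  intro i k
  obtain ⟨m, hm⟩ := h.bounded
  constructor
  · refine ⟨-m, ?_⟩
    have hc : Filter.Tendsto (fun x : ℝ => (x, p.2)) (𝓝 p.1) (𝓝 p) := by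
      have : Continuous fun x : ℝ => (x, p.2) := by fun_prop
      exact this.tendsto' _ _ rfl
    filter_upwards [hc.eventually (hU.mem_nhds hp)] with x hx a ha
    have := congrFun (congrFun (hm _ hx (-a) (by omega)) i) k
    simpa [Loop.coeff] using this
  · intro a
    have h1 := (h.smooth (-a)).hasDerivAt_x hU hp i k
    have h2 := congrFun (congrFun (h.commutes p hp (-a)) i) k
    rw [Matrix.add_apply, Matrix.zero_apply, add_eq_zero_iff_eq_neg] at h2
    rw [h2, ← Matrix.neg_apply, ← coeff_neg, neg_sub] at h1
    simpa only [Loop.coeff, Matrix.map_apply, neg_neg] using h1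

lemma coeff_flip_loop (A : Loop n) (k : ℤ) :
    Loop.coeff (A.map flip) k = (-1 : ℝ) ^ k • A.coeff k := by
  ext i l
  simp only [Loop.coeff, Matrix.map_apply, Matrix.smul_apply, coeff_flip, smul_eq_mul]
  rw [_root_.zpow_neg, ← _root_.inv_zpow, inv_neg_one]

lemma coeff_const_mul (B : Mat n ℝ) (A : Loop n) (k : ℤ) :
    Loop.coeff (Loop.const B * A) k = B * A.coeff k := by
  ext i l
  simp only [Loop.coeff, Loop.const, Matrix.map_apply, Matrix.mul_apply, HahnSeries.coeff_sum,
    HahnSeries.C_apply, HahnSeries.coeff_single_zero_mul]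

lemma coeff_mul_const (B : Mat n ℝ) (A : Loop n) (k : ℤ) :
    Loop.coeff (A * Loop.const B) k = A.coeff k * B := by
  ext i l
  simp only [Loop.coeff, Loop.const, Matrix.map_apply, Matrix.mul_apply, HahnSeries.coeff_sum,
    HahnSeries.C_apply, HahnSeries.coeff_mul_single_zero]

lemma loop_ext {A B : Loop n} (h : ∀ k, A.coeff k = B.coeff k) : A = B := by
  ext i l k
  simpa [Loop.coeff] using congrFun (congrFun (h (-k)) i) l

/-- Written with the substitution `λ ↦ -λ`, the coefficientwise reality condition becomes a single
identity of matrices over Laurent series, which can be conjugated by simple elements. -/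
lemma twisted_iff (A : Loop n) :
    (∀ k : ℤ, (-1 : ℝ) ^ k • (formMatrix n * (A.coeff k)ᵀ * formMatrix n) + A.coeff k = 0) ↔
      Loop.const (formMatrix n) * (A.map flip)ᵀ * Loop.const (formMatrix n) = -A := by
  have e : ∀ k : ℤ, Loop.coeff
      (Loop.const (formMatrix n) * (A.map flip)ᵀ * Loop.const (formMatrix n)) k
      = (-1 : ℝ) ^ k • (formMatrix n * (A.coeff k)ᵀ * formMatrix n) := by
    intro k
    rw [coeff_mul_const, coeff_const_mul]
    have : Loop.coeff (A.map flip)ᵀ k = (Loop.coeff (A.map flip) k)ᵀ := rfl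
    rw [this, coeff_flip_loop, Matrix.transpose_smul, Matrix.mul_smul, Matrix.smul_mul]
  constructor
  · intro h
    refine loop_ext fun k => ?_
    rw [e, coeff_neg]
    exact eq_neg_of_add_eq_zero_left (h k)
  · intro h k
    rw [← e, h, coeff_neg, neg_add_cancel]

lemma dress_flip {P : Mat n ℝ} (hP : IsFormProj P) (α : ℝ) :
    Loop.const (formMatrix n) * ((dress loopC Loop.lam α P).map flip)ᵀ * Loop.const (formMatrix n)
      = dress loopC Loop.lam (-α) P := by
  have h1 : flip.comp loopC = loopC := RingHom.ext flip_C
  rw [map_dress, h1, flip_lam]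
  exact dress_twisted hP

lemma const_formMatrix_mul_self :
    Loop.const (formMatrix n) * Loop.const (formMatrix n) = 1 := by
  have := congrArg Loop.const (formMatrix_mul_self (n := n))
  rw [Loop.const, Loop.const, Matrix.map_mul] at this
  rw [Loop.const, this]
  simp

/-- Conjugation by the simple element transforms the resolvent of `q` into that of `q'`. -/
lemma IsResolvent.dressConj {q q' : ℝ × ℝ → Mat n ℝ} {S : ℝ × ℝ → Loop n}
    (h : IsResolvent U q S) (hU : IsOpen U) {α : ℝ} {P : ℝ × ℝ → Mat n ℝ}
    (hP : ∀ p ∈ U, IsFormProj (P p)) (hPs : SmoothOn U P)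
    (hg : ∀ p ∈ U, IsGauge α (P p) (partialX P p) (potential (q p)) (potential (q' p))) :
    IsResolvent U q' fun p => dressConj α (P p) (S p) := by
  have hsm : SmoothLoop U fun p => IsotropicKdV.dressConj α (P p) (S p) :=
    ((SmoothLoop.dress hPs).mul h.smoothLoop).mul (SmoothLoop.dress hPs)
  refine ⟨fun k i l => (hsm i l).1 (-k), ?_, fun p hp => ?_, fun p hp k => ?_, fun p hp => ?_⟩
  · obtain ⟨a, ha⟩ := hsm.exists_bound
    refine ⟨-a, fun p hp k hk => ?_⟩
    ext i l
    exact ha p hp i l (-k) (by omega)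
  · rw [twisted_iff]
    have h1 := (twisted_iff (S p)).1 (h.twisted p hp)
    have hg1 := dress_flip (hP p hp) α
    have hg2 := dress_flip (hP p hp) (-α)
    rw [neg_neg] at hg2
    rw [IsotropicKdV.dressConj, Matrix.map_mul, Matrix.map_mul, Matrix.transpose_mul,
      Matrix.transpose_mul]
    set G := dress loopC Loop.lam α (P p)
    set G' := dress loopC Loop.lam (-α) (P p)
    set C := Loop.const (formMatrix n)
    have hC : C * C = 1 := const_formMatrix_mul_self
    calc C * ((G'.map flip)ᵀ * (((S p).map flip)ᵀ * (G.map flip)ᵀ)) * C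
        = C * (G'.map flip)ᵀ * (C * C) * ((S p).map flip)ᵀ * (C * C) * (G.map flip)ᵀ * C := by
          rw [hC, mul_one, mul_one]; simp only [mul_assoc]
      _ = (C * (G'.map flip)ᵀ * C) * (C * ((S p).map flip)ᵀ * C) * (C * (G.map flip)ᵀ * C) := by
          simp only [mul_assoc]
      _ = -(G * S p * G') := by rw [hg2, h1, hg1, loop_mul_neg, loop_neg_mul]
  · have hx := fun i k => hPs.hasDerivAt_x hU hp i k
    have hGG := dress_mul_dress_neg (c := loopC) (hP p hp).1 (lam_ne_C α) (lam_ne_neg_C α)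
    have hGG' := dress_neg_mul_dress (c := loopC) (hP p hp).1 (lam_ne_C α) (lam_ne_neg_C α)
    have d1 := hasLoopDerivAt_dress α hx
    have d2 := hasLoopDerivAt_dress (-α) hx
    have dS := h.hasLoopDerivAt hU hp
    -- The product of the two simple elements is the constant `1` on the slice near `p`; this is the
    -- hypothesis `hd` of `lax_gauge`.
    have dd := (d2.mul d1).unique (B' := 0) (by
      have hc : ∀ᶠ x in 𝓝 p.1, dress loopC Loop.lam (-α) (P (x, p.2))
          * dress loopC Loop.lam α (P (x, p.2)) = 1 := by
        have hc : Filter.Tendsto (fun x : ℝ => (x, p.2)) (𝓝 p.1) (𝓝 p) := by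
          have : Continuous fun x : ℝ => (x, p.2) := by fun_prop
          exact this.tendsto' _ _ rfl
        filter_upwards [hc.eventually (hU.mem_nhds hp)] with x hx
        exact dress_neg_mul_dress (c := loopC) (hP _ hx).1 (lam_ne_C α) (lam_ne_neg_C α)
      exact (HasLoopDerivAt.const 1 p.1).congr hc)
    have hev : (Loop.J n + Loop.const (q' p)) * dress loopC Loop.lam α (P p)
      = dress loopC Loop.lam α (P p) * (Loop.J n + Loop.const (q p))
      + (2 * loopC α / (Loop.lam - loopC α)) • Loop.const (partialX P p) := by
      have := (hg p hp).eval (lam_ne_C α)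
      rw [polyEval_potential_loop, polyEval_potential_loop] at this
      exact this
    have dtot := (d1.mul dS).mul d2
    set G := dress loopC Loop.lam α (P p)
    set G' := dress loopC Loop.lam (-α) (P p)
    set dG := -((2 * loopC α / (Loop.lam - loopC α)) • Loop.const (partialX P p)) with hdG
    have hg' : (Loop.J n + Loop.const (q' p)) * G
        = G * (Loop.J n + Loop.const (q p)) - dG := by
      rw [hev, hdG]
      exact (sub_neg_eq_add _ _).symm
    have hfin := lax_gauge (S := S p) hGG hGG' dd hg'
    have hX := HasLoopDerivAt.partialX_coeff
      (A := fun p' => IsotropicKdV.dressConj α (P p') (S p')) dtot k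
    rw [hX, ← coeff_add]
    refine (congrArg (fun A : Loop n => A.coeff k) hfin).trans ?_
    ext i l
    simp [Loop.coeff]
  · have hGG := dress_mul_dress_neg (c := loopC) (hP p hp).1 (lam_ne_C α) (lam_ne_neg_C α)
    have hGG' := dress_neg_mul_dress (c := loopC) (hP p hp).1 (lam_ne_C α) (lam_ne_neg_C α)
    refine (h.conj p hp).trans ⟨⟨_, _, hGG, hGG'⟩, ?_⟩
    change dress loopC Loop.lam α (P p) * S p = IsotropicKdV.dressConj α (P p) (S p) * _
    rw [IsotropicKdV.dressConj, mul_assoc, hGG', mul_one]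

end ResolventTransform

/-! ### Calculus of matrix functions -/

section Calculus

variable {n : ℕ} {U : Set (ℝ × ℝ)} {𝕜 : Type*} [NormedField 𝕜] [NormedAlgebra ℝ 𝕜]

/-- Entrywise derivative of a matrix function. -/
def HasMatDerivAt (A : ℝ → Mat n 𝕜) (A' : Mat n 𝕜) (x : ℝ) : Prop :=
  ∀ i k, HasDerivAt (fun y => A y i k) (A' i k) x

lemma HasMatDerivAt.mul {A B : ℝ → Mat n 𝕜} {A' B' : Mat n 𝕜} {x : ℝ} (hA : HasMatDerivAt A A' x)
    (hB : HasMatDerivAt B B' x) :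
    HasMatDerivAt (fun y => A y * B y) (A' * B x + A x * B') x := fun i k => by
  simp only [Matrix.mul_apply, Matrix.add_apply, ← Finset.sum_add_distrib]
  exact HasDerivAt.fun_sum fun l _ => (hA i l).mul (hB l k)

lemma hasMatDerivAt_const (A : Mat n 𝕜) (x : ℝ) : HasMatDerivAt (fun _ => A) 0 x :=
  fun _ _ => hasDerivAt_const x _

lemma HasMatDerivAt.const_sub {B : ℝ → Mat n 𝕜} {B' : Mat n 𝕜} {x : ℝ} (A : Mat n 𝕜)
    (hB : HasMatDerivAt B B' x) : HasMatDerivAt (fun y => A - B y) (-B') x :=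
  fun i k => (hB i k).const_sub (A i k)

lemma HasMatDerivAt.const_smul {B : ℝ → Mat n 𝕜} {B' : Mat n 𝕜} {x : ℝ} (s : 𝕜)
    (hB : HasMatDerivAt B B' x) : HasMatDerivAt (fun y => s • B y) (s • B') x :=
  fun i k => (hB i k).const_mul s

lemma HasMatDerivAt.const_add {B : ℝ → Mat n 𝕜} {B' : Mat n 𝕜} {x : ℝ} (A : Mat n 𝕜)
    (hB : HasMatDerivAt B B' x) : HasMatDerivAt (fun y => A + B y) B' x :=
  fun i k => (hB i k).const_add (A i k)

lemma HasMatDerivAt.unique {A : ℝ → Mat n 𝕜} {A' B' : Mat n 𝕜} {x : ℝ}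
    (hA : HasMatDerivAt A A' x) (hB : HasMatDerivAt A B' x) : A' = B' := by
  ext i k; exact (hA i k).unique (hB i k)

lemma HasMatDerivAt.congr {A B : ℝ → Mat n 𝕜} {A' : Mat n 𝕜} {x : ℝ}
    (hA : HasMatDerivAt A A' x) (h : ∀ᶠ y in 𝓝 x, B y = A y) : HasMatDerivAt B A' x :=
  fun i k => (hA i k).congr_of_eventuallyEq (h.mono fun _ hy => congrFun (congrFun hy i) k)

lemma HasMatDerivAt.ofReal {A : ℝ → Mat n ℝ} {A' : Mat n ℝ} {x : ℝ}
    (hA : HasMatDerivAt A A' x) :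
    HasMatDerivAt (fun y => (A y).map Complex.ofRealHom) (A'.map Complex.ofRealHom) x :=
  fun i k => (hA i k).ofReal_comp

lemma SmoothOn.const (A : Mat n 𝕜) : SmoothOn U fun _ => A := fun _ _ => contDiffOn_const

lemma SmoothOn.mul {A B : ℝ × ℝ → Mat n 𝕜} (hA : SmoothOn U A) (hB : SmoothOn U B) :
    SmoothOn U fun p => A p * B p := fun i k => by
  simp only [Matrix.mul_apply]
  exact ContDiffOn.sum fun l _ => (hA i l).mul (hB l k)

lemma SmoothOn.add {A B : ℝ × ℝ → Mat n 𝕜} (hA : SmoothOn U A) (hB : SmoothOn U B) :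
    SmoothOn U fun p => A p + B p := fun i k => (hA i k).add (hB i k)

lemma SmoothOn.sub {A B : ℝ × ℝ → Mat n 𝕜} (hA : SmoothOn U A) (hB : SmoothOn U B) :
    SmoothOn U fun p => A p - B p := fun i k => (hA i k).sub (hB i k)

lemma SmoothOn.const_smul {A : ℝ × ℝ → Mat n 𝕜} (s : 𝕜) (hA : SmoothOn U A) :
    SmoothOn U fun p => s • A p := fun i k => contDiffOn_const.mul (hA i k)

lemma SmoothOn.mono {A : ℝ × ℝ → Mat n 𝕜} {V : Set (ℝ × ℝ)} (hA : SmoothOn U A) (h : V ⊆ U) :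
    SmoothOn V A := fun i k => (hA i k).mono h

lemma SmoothOn.congr {A B : ℝ × ℝ → Mat n 𝕜} (hA : SmoothOn U A) (h : ∀ p ∈ U, B p = A p) :
    SmoothOn U B := fun i k => (hA i k).congr fun p hp => congrFun (congrFun (h p hp) i) k

lemma SmoothOn.det {A : ℝ × ℝ → Mat n 𝕜} (hA : SmoothOn U A) :
    ContDiffOn ℝ ∞ (fun p => (A p).det) U := by
  simp only [Matrix.det_apply']
  exact ContDiffOn.sum fun σ _ => contDiffOn_const.mul (contDiffOn_prod fun i _ => hA _ _)

lemma SmoothOn.adjugate {A : ℝ × ℝ → Mat n 𝕜} (hA : SmoothOn U A) :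
    SmoothOn U fun p => (A p).adjugate := fun i k => by
  simp only [Matrix.adjugate_apply]
  refine SmoothOn.det fun a b => ?_
  by_cases h : a = k
  · subst h; simpa using contDiffOn_const
  · simpa [Matrix.updateRow_ne h] using hA a b

lemma SmoothOn.inv {A : ℝ × ℝ → Mat n 𝕜} (hA : SmoothOn U A) (h : ∀ p ∈ U, IsUnit (A p)) :
    SmoothOn U fun p => (A p)⁻¹ := fun i k => by
  simp only [Matrix.inv_def, Matrix.smul_apply, Ring.inverse_eq_inv', smul_eq_mul]
  refine (hA.det.inv fun p hp => ?_).mul (hA.adjugate i k)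
  exact ((Matrix.isUnit_iff_isUnit_det _).1 (h p hp)).ne_zero

lemma SmoothOn.ofReal {A : ℝ × ℝ → Mat n ℝ} (hA : SmoothOn U A) :
    SmoothOn U fun p => (A p).map Complex.ofRealHom := fun i k =>
  Complex.ofRealCLM.contDiff.comp_contDiffOn (hA i k)

lemma SmoothOn.re {A : ℝ × ℝ → Mat n ℂ} (hA : SmoothOn U A) :
    SmoothOn U fun p => (A p).map Complex.re := fun i k =>
  Complex.reCLM.contDiff.comp_contDiffOn (hA i k)

lemma SmoothOn.dress {P : ℝ × ℝ → Mat n ℝ} (hP : SmoothOn U P) (z : ℂ) (α : ℝ) :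
    SmoothOn U fun p => dress Complex.ofRealHom z α (P p) :=
  (SmoothOn.const 1).add (((SmoothOn.const 1).sub hP.ofReal).const_smul _)

lemma hasMatDerivAt_dress {P : ℝ → Mat n ℝ} {P' : Mat n ℝ} {x : ℝ} (α : ℝ) (z : ℂ)
    (hP : HasMatDerivAt P P' x) :
    HasMatDerivAt (fun y => dress Complex.ofRealHom z α (P y))
      ((2 * Complex.ofRealHom α / (z - Complex.ofRealHom α)) • -(P'.map Complex.ofRealHom)) x :=
  ((hP.ofReal.const_sub 1).const_smul _).const_add 1

/-- The linear map `(a, b) ↦ a X + b Y`. -/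
def linComb (X Y : ℂ) : ℝ × ℝ →L[ℝ] ℂ :=
  (ContinuousLinearMap.fst ℝ ℝ ℝ).smulRight X + (ContinuousLinearMap.snd ℝ ℝ ℝ).smulRight Y

lemma linComb_apply (X Y : ℂ) (v : ℝ × ℝ) : linComb X Y v = v.1 * X + v.2 * Y := by
  simp [linComb]

lemma continuous_linComb : Continuous fun w : ℂ × ℂ => linComb w.1 w.2 := by
  have h1 : Continuous fun w : ℂ × ℂ =>
      ContinuousLinearMap.smulRightL ℝ (ℝ × ℝ) ℂ (ContinuousLinearMap.fst ℝ ℝ ℝ) w.1 := by fun_prop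
  have h2 : Continuous fun w : ℂ × ℂ =>
      ContinuousLinearMap.smulRightL ℝ (ℝ × ℝ) ℂ (ContinuousLinearMap.snd ℝ ℝ ℝ) w.2 := by fun_prop
  exact h1.add h2

lemma contDiffOn_linComb {X Y : ℝ × ℝ → ℂ} {m : WithTop ℕ∞} (hX : ContDiffOn ℝ m X U)
    (hY : ContDiffOn ℝ m Y U) : ContDiffOn ℝ m (fun p => linComb (X p) (Y p)) U := by
  have h1 := (ContinuousLinearMap.smulRightL ℝ (ℝ × ℝ) ℂ
    (ContinuousLinearMap.fst ℝ ℝ ℝ)).contDiff.comp_contDiffOn hX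
  have h2 := (ContinuousLinearMap.smulRightL ℝ (ℝ × ℝ) ℂ
    (ContinuousLinearMap.snd ℝ ℝ ℝ)).contDiff.comp_contDiffOn hY
  exact h1.add h2

/-- Smoothness already provides a total derivative, so its values on the two coordinate vectors
determine it. -/
lemma hasFDerivAt_of_slices {f : ℝ × ℝ → ℂ} (hf : ContDiffOn ℝ ∞ f U) (hU : IsOpen U)
    {p : ℝ × ℝ} (hp : p ∈ U) {X Y : ℂ} (hX : HasDerivAt (fun x => f (x, p.2)) X p.1)
    (hY : HasDerivAt (fun t => f (p.1, t)) Y p.2) : HasFDerivAt f (linComb X Y) p := by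
  have h1 : HasFDerivAt f (fderiv ℝ f p) p :=
    ((hf.contDiffAt (hU.mem_nhds hp)).differentiableAt (by simp)).hasFDerivAt
  have hx : HasDerivAt (fun x : ℝ => (x, p.2)) ((1 : ℝ), (0 : ℝ)) p.1 :=
    (hasDerivAt_id p.1).prodMk (hasDerivAt_const p.1 p.2)
  have ht : HasDerivAt (fun t : ℝ => (p.1, t)) ((0 : ℝ), (1 : ℝ)) p.2 :=
    (hasDerivAt_const p.2 p.1).prodMk (hasDerivAt_id p.2)
  have e1 := hX.unique (HasFDerivAt.comp_hasDerivAt (f := fun x : ℝ => (x, p.2)) p.1 h1 hx)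
  have e2 := hY.unique (HasFDerivAt.comp_hasDerivAt (f := fun t : ℝ => (p.1, t)) p.2 h1 ht)
  have : fderiv ℝ f p = linComb X Y := by
    refine ContinuousLinearMap.ext fun v => ?_
    have hv : v = v.1 • ((1 : ℝ), (0 : ℝ)) + v.2 • ((0 : ℝ), (1 : ℝ)) := by ext <;> simp
    conv_lhs => rw [hv]
    rw [map_add, map_smul, map_smul, linComb_apply, e1, e2]
    simp
  rwa [this] at h1

lemma hasDerivAt_slice_x {f : ℝ × ℝ → ℂ} {p : ℝ × ℝ} {X Y : ℂ}
    (hf : HasFDerivAt f (linComb X Y) p) : HasDerivAt (fun x => f (x, p.2)) X p.1 := by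
  have hx : HasDerivAt (fun x : ℝ => (x, p.2)) ((1 : ℝ), (0 : ℝ)) p.1 :=
    (hasDerivAt_id p.1).prodMk (hasDerivAt_const p.1 p.2)
  have := HasFDerivAt.comp_hasDerivAt (f := fun x : ℝ => (x, p.2)) p.1 hf hx
  have e : linComb X Y (1, 0) = X := by simp [linComb_apply]
  rwa [e] at this

lemma hasDerivAt_slice_t {f : ℝ × ℝ → ℂ} {p : ℝ × ℝ} {X Y : ℂ}
    (hf : HasFDerivAt f (linComb X Y) p) : HasDerivAt (fun t => f (p.1, t)) Y p.2 := by
  have ht : HasDerivAt (fun t : ℝ => (p.1, t)) ((0 : ℝ), (1 : ℝ)) p.2 :=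
    (hasDerivAt_const p.2 p.1).prodMk (hasDerivAt_id p.2)
  have := HasFDerivAt.comp_hasDerivAt (f := fun t : ℝ => (p.1, t)) p.2 hf ht
  have e : linComb X Y (0, 1) = Y := by simp [linComb_apply]
  rwa [e] at this

/-- A solution of a linear system with smooth coefficients is smooth. -/
lemma smoothOn_of_lax (hU : IsOpen U) {F A B : ℝ × ℝ → Mat n ℂ} (hA : SmoothOn U A)
    (hB : SmoothOn U B)
    (hF : ∀ p ∈ U, ∀ i k, HasFDerivAt (fun p => F p i k)
      (linComb ((F p * A p) i k) ((F p * B p) i k)) p) : SmoothOn U F := by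
  -- Bootstrapping: the derivative of `F` is linear in `FA` and `FB`, so it is of class `C^m`
  -- whenever `F` is.
  have key : ∀ m : ℕ, ∀ i k, ContDiffOn ℝ m (fun p => F p i k) U := by
    intro m
    induction m with
    | zero =>
      intro i k
      rw [Nat.cast_zero, contDiffOn_zero]
      exact fun p hp => (hF p hp i k).continuousAt.continuousWithinAt
    | succ m ih =>
      intro i k
      rw [Nat.cast_add, Nat.cast_one, contDiffOn_succ_iff_fderiv_of_isOpen hU]
      refine ⟨fun p hp => (hF p hp i k).differentiableAt.differentiableWithinAt, by simp, ?_⟩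
      have hmul : ∀ {D : ℝ × ℝ → Mat n ℂ}, SmoothOn U D →
          ContDiffOn ℝ m (fun p => (F p * D p) i k) U := by
        intro D hD
        simp only [Matrix.mul_apply]
        exact ContDiffOn.sum fun l _ => (ih i l).mul ((hD l k).of_le (by exact_mod_cast le_top))
      exact (contDiffOn_linComb (hmul hA) (hmul hB)).congr fun p hp => (hF p hp i k).fderiv
  intro i k
  exact contDiffOn_infty.2 fun m => key m i k

end Calculus

/-! ### Cauchy integrals depending on parameters -/

section Circle

open MeasureTheory Metric

variable {U : Set (ℝ × ℝ)}

/-- The Cauchy kernel, including the factor `(2πi)⁻¹`. -/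
def cauchyKernel (R : ℝ) (z : ℂ) (θ : ℝ) : ℂ :=
  (2 * (Real.pi : ℂ) * Complex.I)⁻¹ * (deriv (circleMap 0 R) θ * (circleMap 0 R θ - z)⁻¹)

lemma circleMap_sub_ne_zero {R : ℝ} (hR : 0 < R) {z : ℂ} (hz : z ∈ ball (0 : ℂ) R) (θ : ℝ) :
    circleMap 0 R θ - z ≠ 0 := by
  intro h
  have h1 := circleMap_mem_sphere (0 : ℂ) hR.le θ
  rw [sub_eq_zero.1 h, mem_sphere] at h1
  rw [mem_ball] at hz
  linarith

lemma continuous_cauchyKernel {R : ℝ} (hR : 0 < R) :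
    Continuous fun w : ball (0 : ℂ) R × ℝ => cauchyKernel R w.1 w.2 := by
  unfold cauchyKernel
  refine continuous_const.mul (Continuous.mul ?_ (Continuous.inv₀ ?_ ?_))
  · simp only [deriv_circleMap]
    exact ((continuous_circleMap 0 R).comp continuous_snd).mul continuous_const
  · exact ((continuous_circleMap 0 R).comp continuous_snd).sub
      (continuous_subtype_val.comp continuous_fst)
  · exact fun w => circleMap_sub_ne_zero hR w.1.2 w.2

lemma eq_integral_cauchyKernel {R : ℝ} {f : ℂ → ℂ} (hf : Differentiable ℂ f) {z : ℂ}
    (hz : z ∈ ball (0 : ℂ) R) :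
    f z = ∫ θ in (0 : ℝ)..2 * Real.pi, cauchyKernel R z θ * f (circleMap 0 R θ) := by
  have h := (hf.differentiableOn (s := closedBall 0 R)).circleIntegral_sub_inv_smul hz
  have h2 : (2 * (Real.pi : ℂ) * Complex.I) ≠ 0 := Complex.two_pi_I_ne_zero
  have h3 : f z = (2 * (Real.pi : ℂ) * Complex.I)⁻¹ * ∮ w in C(0, R), (w - z)⁻¹ • f w := by
    rw [h, smul_eq_mul, inv_mul_cancel_left₀ h2]
  rw [h3, circleIntegral, ← intervalIntegral.integral_const_mul]
  congr 1
  ext θ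
  simp only [cauchyKernel, smul_eq_mul, mul_assoc]

/-- Joint continuity on a circle implies joint continuity inside, for functions that are
holomorphic in the second variable. -/
lemma continuousOn_of_circle {R : ℝ} (hR : 0 < R) {f : ℝ × ℝ → ℂ → ℂ}
    (hf : ∀ p ∈ U, Differentiable ℂ (f p))
    (hc : ContinuousOn (fun w : (ℝ × ℝ) × ℂ => f w.1 w.2) (U ×ˢ sphere 0 R)) :
    ContinuousOn (fun w : (ℝ × ℝ) × ℂ => f w.1 w.2) (U ×ˢ ball 0 R) := by
  rw [continuousOn_iff_continuous_domRestrict]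
  have h1 : Continuous (Function.uncurry fun (w : ↥(U ×ˢ ball (0 : ℂ) R)) (θ : ℝ) =>
      cauchyKernel R w.1.2 θ * f w.1.1 (circleMap 0 R θ)) := by
    refine Continuous.mul ?_ ?_
    · exact (continuous_cauchyKernel hR).comp (f := fun w : ↥(U ×ˢ ball (0 : ℂ) R) × ℝ =>
        ((⟨w.1.1.2, w.1.2.2⟩ : ball (0 : ℂ) R), w.2)) (by fun_prop)
    · refine hc.comp_continuous (f := fun w : ↥(U ×ˢ ball (0 : ℂ) R) × ℝ =>
        (w.1.1.1, circleMap 0 R w.2)) ?_ fun w => ⟨w.1.2.1, circleMap_mem_sphere _ hR.le _⟩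
      exact (continuous_fst.comp (continuous_subtype_val.comp continuous_fst)).prodMk
        ((continuous_circleMap 0 R).comp continuous_snd)
  have h2 := intervalIntegral.continuous_parametric_intervalIntegral_of_continuous'
    (μ := volume) h1 0 (2 * Real.pi)
  refine h2.congr fun w => ?_
  exact (eq_integral_cauchyKernel (hf _ w.2.1) w.2.2).symm

/-- Differentiation under the Cauchy integral. -/
lemma hasFDerivAt_of_circle (hU : IsOpen U) {R : ℝ} (hR : 0 < R) {f : ℝ × ℝ → ℂ → ℂ}
    {f' : ℝ × ℝ → ℂ → (ℝ × ℝ →L[ℝ] ℂ)} (hf : ∀ p ∈ U, Differentiable ℂ (f p))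
    (hf' : ∀ p ∈ U, ∀ v, Differentiable ℂ fun z => f' p z v)
    (hc : ContinuousOn (fun w : (ℝ × ℝ) × ℂ => f w.1 w.2) (U ×ˢ sphere 0 R))
    (hc' : ContinuousOn (fun w : (ℝ × ℝ) × ℂ => f' w.1 w.2) (U ×ˢ sphere 0 R))
    (hd : ∀ p ∈ U, ∀ w ∈ sphere (0 : ℂ) R, HasFDerivAt (fun p' => f p' w) (f' p w) p)
    {p : ℝ × ℝ} (hp : p ∈ U) {z : ℂ} (hz : z ∈ ball (0 : ℂ) R) :
    HasFDerivAt (fun p' => f p' z) (f' p z) p := by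
  have hk : Continuous fun θ : ℝ => cauchyKernel R z θ :=
    (continuous_cauchyKernel hR).comp (f := fun θ : ℝ => ((⟨z, hz⟩ : ball (0 : ℂ) R), θ))
      (by fun_prop)
  have hsph : ∀ θ, circleMap 0 R θ ∈ sphere (0 : ℂ) R := circleMap_mem_sphere _ hR.le
  have hcF : ∀ p' ∈ U, Continuous fun θ : ℝ => cauchyKernel R z θ * f p' (circleMap 0 R θ) := by
    intro p' hp'
    refine hk.mul (hc.comp_continuous (f := fun θ : ℝ => (p', circleMap 0 R θ)) ?_ fun θ =>
      ⟨hp', hsph θ⟩)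
    exact continuous_const.prodMk (continuous_circleMap 0 R)
  have hcF' : ContinuousOn (fun w : (ℝ × ℝ) × ℝ =>
      cauchyKernel R z w.2 • f' w.1 (circleMap 0 R w.2)) (U ×ˢ Set.univ) := by
    refine (hk.comp continuous_snd).continuousOn.smul (hc'.comp (f := fun w : (ℝ × ℝ) × ℝ =>
      (w.1, circleMap 0 R w.2)) ?_ fun w hw => ⟨hw.1, hsph _⟩)
    exact (continuous_fst.prodMk ((continuous_circleMap 0 R).comp continuous_snd)).continuousOn
  -- A closed ball is chosen because its product with the parameter interval of the circle is
  -- compact; continuity of the differentiated integrand then yields a constant dominating function.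
  obtain ⟨ε, hε, hεU⟩ := Metric.nhds_basis_closedBall.mem_iff.1 (hU.mem_nhds hp)
  have hcomp : IsCompact (closedBall p ε ×ˢ Set.Icc (0 : ℝ) (2 * Real.pi)) :=
    (isCompact_closedBall p ε).prod isCompact_Icc
  obtain ⟨M, hM⟩ := hcomp.exists_bound_of_continuousOn
    (hcF'.mono fun w hw => ⟨hεU hw.1, trivial⟩)
  have hpi : (0 : ℝ) ≤ 2 * Real.pi := by positivity
  have hcFp' : Continuous fun θ : ℝ => cauchyKernel R z θ • f' p (circleMap 0 R θ) :=
    hcF'.comp_continuous (f := fun θ : ℝ => (p, θ)) (by fun_prop) fun θ => ⟨hp, trivial⟩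
  have hmain := intervalIntegral.hasFDerivAt_integral_of_dominated_of_fderiv_le
    (𝕜 := ℝ) (μ := volume) (a := 0) (b := 2 * Real.pi)
    (F := fun p' θ => cauchyKernel R z θ * f p' (circleMap 0 R θ))
    (F' := fun p' θ => cauchyKernel R z θ • f' p' (circleMap 0 R θ)) (x₀ := p)
    (s := closedBall p ε) (bound := fun _ => M) (closedBall_mem_nhds p hε)
    (by
      filter_upwards [hU.mem_nhds hp] with p' hp'
      exact (hcF p' hp').aestronglyMeasurable)
    ((hcF p hp).intervalIntegrable _ _)
    hcFp'.aestronglyMeasurable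
    (Filter.Eventually.of_forall fun θ hθ p' hp' => by
      rw [Set.uIoc_of_le hpi] at hθ
      exact hM (p', θ) ⟨hp', Set.Ioc_subset_Icc_self hθ⟩)
    intervalIntegrable_const
    (Filter.Eventually.of_forall fun θ _ p' hp' => by
      exact (hd p' (hεU hp') _ (hsph θ)).const_mul (cauchyKernel R z θ))
  have e1 : (∫ θ in (0 : ℝ)..2 * Real.pi, cauchyKernel R z θ • f' p (circleMap 0 R θ))
      = f' p z := by
    -- In a fixed direction `v` the candidate derivative is a scalar entire function of `z`, to
    -- which Cauchy's formula applies.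
    refine ContinuousLinearMap.ext fun v => ?_
    rw [ContinuousLinearMap.intervalIntegral_apply (hcFp'.intervalIntegrable _ _)]
    exact (eq_integral_cauchyKernel (hf' p hp v) hz).symm
  rw [e1] at hmain
  refine hmain.congr_of_eventuallyEq ?_
  filter_upwards [hU.mem_nhds hp] with p' hp'
  exact eq_integral_cauchyKernel (hf p' hp') hz

end Circle

/-! ### The transformed projection -/

section TildeProjection

open Polynomial

variable {n j : ℕ} {U : Set (ℝ × ℝ)} {q : ℝ × ℝ → Mat n ℝ} {F : ℝ × ℝ → ℂ → Mat n ℂ}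
  {α : ℝ} {P : Mat n ℝ} {p : ℝ × ℝ}

lemma eventually_slice_x (hU : IsOpen U) (hp : p ∈ U) : ∀ᶠ x in 𝓝 p.1, (x, p.2) ∈ U := by
  have hc : Filter.Tendsto (fun x : ℝ => (x, p.2)) (𝓝 p.1) (𝓝 p) := by
    have : Continuous fun x : ℝ => (x, p.2) := by fun_prop
    exact this.tendsto' _ _ rfl
  exact hc.eventually (hU.mem_nhds hp)

lemma eventually_slice_t (hU : IsOpen U) (hp : p ∈ U) : ∀ᶠ t in 𝓝 p.2, (p.1, t) ∈ U := by
  have hc : Filter.Tendsto (fun t : ℝ => (p.1, t)) (𝓝 p.2) (𝓝 p) := by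
    have : Continuous fun t : ℝ => (p.1, t) := by fun_prop
    exact this.tendsto' _ _ rfl
  exact hc.eventually (hU.mem_nhds hp)

lemma map_ofReal_injective : Function.Injective fun A : Mat n ℝ => A.map Complex.ofRealHom := by
  intro A B h
  ext i k
  exact Complex.ofReal_injective (congrFun (congrFun h i) k)

/-- The real matrix `F(x,t,r)` for real `r`. -/
def frameRe (F : ℝ × ℝ → ℂ → Mat n ℂ) (r : ℝ) (p : ℝ × ℝ) : Mat n ℝ :=
  (F p (r : ℂ)).map Complex.re

lemma IsFrame.map_frameRe (hF : IsFrame n j U q F) (hp : p ∈ U) (r : ℝ) :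
    (frameRe F r p).map Complex.ofRealHom = F p r := by
  ext i k
  have h := congrFun (congrFun (hF.real p hp r) i) k
  rw [Complex.conj_ofReal, Matrix.map_apply] at h
  exact Complex.conj_eq_iff_re.1 h.symm

lemma IsFrame.frameRe_twisted (hF : IsFrame n j U q F) (hp : p ∈ U) (r : ℝ) :
    (frameRe F (-r) p)ᵀ * formMatrix n * frameRe F r p = formMatrix n := by
  apply map_ofReal_injective
  have h := hF.twisted p hp r
  have h1 := hF.map_frameRe hp r
  have h2 := hF.map_frameRe hp (-r)
  rw [Complex.ofReal_neg] at h2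
  rw [← h1, ← h2] at h
  simp only [Matrix.map_mul, ← Matrix.transpose_map] at h ⊢
  exact h

lemma IsFrame.frameRe_inv_twisted (hF : IsFrame n j U q F) (hp : p ∈ U) (r : ℝ) :
    ((frameRe F (-r) p)⁻¹)ᵀ * formMatrix n * (frameRe F r p)⁻¹ = formMatrix n := by
  have h := hF.frameRe_twisted hp r
  obtain ⟨h1, h2⟩ := isUnit_of_form h
  have e1 := Matrix.mul_nonsing_inv _ ((Matrix.isUnit_iff_isUnit_det _).1 h1)
  have e2 : ((frameRe F (-r) p)⁻¹)ᵀ * (frameRe F (-r) p)ᵀ = 1 := by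
    rw [← Matrix.transpose_mul, Matrix.mul_nonsing_inv _ ((Matrix.isUnit_iff_isUnit_det _).1 h2),
      Matrix.transpose_one]
  calc ((frameRe F (-r) p)⁻¹)ᵀ * formMatrix n * (frameRe F r p)⁻¹
      = ((frameRe F (-r) p)⁻¹)ᵀ * ((frameRe F (-r) p)ᵀ * formMatrix n * frameRe F r p)
        * (frameRe F r p)⁻¹ := by rw [h]
    _ = (((frameRe F (-r) p)⁻¹)ᵀ * (frameRe F (-r) p)ᵀ) * formMatrix n
        * (frameRe F r p * (frameRe F r p)⁻¹) := by simp only [mul_assoc]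
    _ = formMatrix n := by rw [e1, e2, one_mul, mul_one]

lemma IsFrame.isUnit_frameRe (hF : IsFrame n j U q F) (hp : p ∈ U) (r : ℝ) :
    IsUnit (frameRe F r p) := (isUnit_of_form (hF.frameRe_twisted hp r)).1

/-- The map carrying the decomposition of `P` to that of the transformed projection. -/
def frameSplit (α : ℝ) (P : Mat n ℝ) (F : ℝ × ℝ → ℂ → Mat n ℂ) (p : ℝ × ℝ) : Mat n ℝ :=
  splitMap 1 1 (frameRe F α p)⁻¹ (frameRe F (-α) p)⁻¹ P

lemma tildeSpace_eq : tildeSpace α P F p = image ((frameRe F α p)⁻¹ * P) := map_image _ _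

/-- The twisting condition pairs `F(-α)` with `F(α)`, which makes their inverses admissible as `Mm`
and `Mp`. The domain thereby becomes the nonvanishing locus of the determinant of a smooth matrix.
-/
lemma mem_regularSet_iff (hF : IsFrame n j U q F) (hP : IsFormProj P) :
    p ∈ regularSet U α P F ↔ p ∈ U ∧ IsUnit (frameSplit α P F p) := by
  rw [regularSet, Set.mem_ofPred_eq, tildeSpace_eq]
  exact and_congr_right fun hp =>
    isCompl_iff_isUnit_splitMap hP (hF.frameRe_inv_twisted hp α) one_ne_zero one_ne_zero

lemma tildeProj_eq (hF : IsFrame n j U q F) (hP : IsFormProj P) (hp : p ∈ regularSet U α P F) :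
    tildeProj α P F p = frameSplit α P F p * P * (frameSplit α P F p)⁻¹ := by
  obtain ⟨hpU, hu⟩ := (mem_regularSet_iff hF hP).1 hp
  rw [tildeProj, tildeSpace_eq]
  exact orthProj_image_mul hP (hF.frameRe_inv_twisted hpU α) one_ne_zero hu

lemma isFormProj_tildeProj (hp : p ∈ regularSet U α P F) : IsFormProj (tildeProj α P F p) :=
  isFormProj_orthProj hp.2

lemma IsFrame.smoothOn_frameRe (hF : IsFrame n j U q F) (r : ℝ) : SmoothOn U (frameRe F r) :=
  (hF.smooth r).re

lemma smoothOn_frameSplit (hF : IsFrame n j U q F) : SmoothOn U (frameSplit α P F) := by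
  have h : ∀ r, SmoothOn U fun p => (frameRe F r p)⁻¹ := fun r =>
    (hF.smoothOn_frameRe r).inv fun p hp => hF.isUnit_frameRe hp r
  exact (((h α).mul (SmoothOn.const P)).const_smul 1).add
    (((h (-α)).mul (SmoothOn.const (1 - P))).const_smul 1)

lemma isOpen_regularSet (hU : IsOpen U) (hF : IsFrame n j U q F) (hP : IsFormProj P) :
    IsOpen (regularSet U α P F) := by
  have h : regularSet U α P F = U ∩ (fun p => (frameSplit α P F p).det) ⁻¹' {0}ᶜ := by
    ext p
    rw [mem_regularSet_iff hF hP, Matrix.isUnit_iff_isUnit_det, isUnit_iff_ne_zero]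
    rfl
  rw [h]
  exact (smoothOn_frameSplit hF).det.continuousOn.isOpen_inter_preimage hU isOpen_compl_singleton

lemma smoothOn_tildeProj (hF : IsFrame n j U q F) (hP : IsFormProj P) :
    SmoothOn (regularSet U α P F) (tildeProj α P F) := by
  have h := (smoothOn_frameSplit (α := α) (P := P) hF).mono
    (fun p hp => hp.1 : regularSet U α P F ⊆ U)
  exact ((h.mul (SmoothOn.const P)).mul
    (h.inv fun p hp => ((mem_regularSet_iff hF hP).1 hp).2)).congr fun p hp => tildeProj_eq hF hP hp

/-- The algebraic relations between `P` and the transformed projection. -/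
lemma tildeProj_relations (hF : IsFrame n j U q F) (hP : IsFormProj P)
    (hp : p ∈ regularSet U α P F) :
    (1 - P) * frameRe F α p * tildeProj α P F p = 0 ∧
    P * frameRe F (-α) p * (1 - tildeProj α P F p) = 0 ∧
    (∃ K, 1 - tildeProj α P F p = K * ((1 - P) * frameRe F α p)) ∧
    ∃ K, tildeProj α P F p = K * (P * frameRe F (-α) p) := by
  obtain ⟨hpU, hu⟩ := (mem_regularSet_iff hF hP).1 hp
  rw [tildeProj_eq hF hP hp]
  have hPP : (1 - P) * P = 0 := by rw [sub_mul, one_mul, hP.1, sub_self]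
  have hPP' : P * (1 - P) = 0 := by rw [mul_sub, mul_one, hP.1, sub_self]
  have s1 : frameSplit α P F p * P = (frameRe F α p)⁻¹ * P := by
    rw [frameSplit, splitMap_mul hP.1, one_smul]
  have s2 : frameSplit α P F p * (1 - P) = (frameRe F (-α) p)⁻¹ * (1 - P) := by
    rw [frameSplit, splitMap_mul_compl hP.1, one_smul]
  have d1 := (Matrix.isUnit_iff_isUnit_det _).1 (hF.isUnit_frameRe hpU α)
  have d2 := (Matrix.isUnit_iff_isUnit_det _).1 (hF.isUnit_frameRe hpU (-α))
  have d3 := (Matrix.isUnit_iff_isUnit_det _).1 hu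
  set Θ := frameSplit α P F p
  set M := frameRe F α p
  set M' := frameRe F (-α) p
  have hΘ := Matrix.mul_nonsing_inv _ d3
  have hΘ' := Matrix.nonsing_inv_mul _ d3
  have hM := Matrix.mul_nonsing_inv _ d1
  have hM' := Matrix.mul_nonsing_inv _ d2
  have hN := Matrix.nonsing_inv_mul _ d1
  have hN' := Matrix.nonsing_inv_mul _ d2
  have hc : 1 - Θ * P * Θ⁻¹ = Θ * (1 - P) * Θ⁻¹ := by
    rw [mul_sub, mul_one, sub_mul, hΘ]
  refine ⟨?_, ?_, ⟨(1 - Θ * P * Θ⁻¹) * M⁻¹, ?_⟩, ⟨Θ * P * Θ⁻¹ * M'⁻¹, ?_⟩⟩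
  · rw [s1]
    calc (1 - P) * M * (M⁻¹ * P * Θ⁻¹) = (1 - P) * (M * M⁻¹) * P * Θ⁻¹ := by simp only [mul_assoc]
      _ = 0 := by rw [hM, mul_one, hPP, zero_mul]
  · rw [hc, s2]
    calc P * M' * (M'⁻¹ * (1 - P) * Θ⁻¹) = P * (M' * M'⁻¹) * (1 - P) * Θ⁻¹ := by
          simp only [mul_assoc]
      _ = 0 := by rw [hM', mul_one, hPP', zero_mul]
  -- `1 - π̃` annihilates `Im (M⁻¹P) = Im π̃`. Inserting `M⁻¹ M` and splitting `1 = P + (1 - P)` in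
  -- between, only the part through `(1 - P) M` survives. The second factorization is dual.
  · have e : (1 - Θ * P * Θ⁻¹) * (M⁻¹ * P) = 0 := by
      rw [hc, ← s1]
      calc Θ * (1 - P) * Θ⁻¹ * (Θ * P) = Θ * (1 - P) * (Θ⁻¹ * Θ) * P := by simp only [mul_assoc]
        _ = 0 := by rw [hΘ', mul_one, mul_assoc, hPP, mul_zero]
    calc 1 - Θ * P * Θ⁻¹ = (1 - Θ * P * Θ⁻¹) * (M⁻¹ * M) := by rw [hN, mul_one]
      _ = (1 - Θ * P * Θ⁻¹) * M⁻¹ * ((1 - P) * M) + (1 - Θ * P * Θ⁻¹) * (M⁻¹ * P) * M := by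
          noncomm_ring
      _ = _ := by rw [e, zero_mul, add_zero]
  · have e : Θ * P * Θ⁻¹ * (M'⁻¹ * (1 - P)) = 0 := by
      rw [← s2]
      calc Θ * P * Θ⁻¹ * (Θ * (1 - P)) = Θ * P * (Θ⁻¹ * Θ) * (1 - P) := by simp only [mul_assoc]
        _ = 0 := by rw [hΘ', mul_one, mul_assoc, hPP', mul_zero]
    calc Θ * P * Θ⁻¹ = Θ * P * Θ⁻¹ * (M'⁻¹ * M') := by rw [hN', mul_one]
      _ = Θ * P * Θ⁻¹ * M'⁻¹ * (P * M') + Θ * P * Θ⁻¹ * (M'⁻¹ * (1 - P)) * M' := by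
          noncomm_ring
      _ = _ := by rw [e, zero_mul, add_zero]

/-- The differential equation of the transformed projection. -/
lemma projection_ode {Mp Mm Pt : ℝ → Mat n ℝ} {Pt' Ap Am : Mat n ℝ} {x : ℝ}
    (dMp : HasMatDerivAt Mp (Mp x * Ap) x) (dMm : HasMatDerivAt Mm (Mm x * Am) x)
    (dPt : HasMatDerivAt Pt Pt' x)
    (h1 : ∀ᶠ y in 𝓝 x, (1 - P) * Mp y * Pt y = 0)
    (h2 : ∀ᶠ y in 𝓝 x, P * Mm y * (1 - Pt y) = 0)
    (hK1 : ∃ K, 1 - Pt x = K * ((1 - P) * Mp x)) (hK2 : ∃ K, Pt x = K * (P * Mm x)) :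
    Pt' = Pt x * Am * (1 - Pt x) - (1 - Pt x) * Ap * Pt x := by
  obtain ⟨K1, hK1⟩ := hK1
  obtain ⟨K2, hK2⟩ := hK2
  -- The derivatives of the two vanishing products vanish. Multiplied on the left by `K1` and `K2`,
  -- they give `(1 - π̃)π̃'` and `π̃π̃'` separately; the sum of these is `π̃'`.
  have e1 := (((hasMatDerivAt_const (1 - P) x).mul dMp).mul dPt).unique
    ((hasMatDerivAt_const 0 x).congr h1)
  have e2 := (((hasMatDerivAt_const P x).mul dMm).mul (dPt.const_sub 1)).unique
    ((hasMatDerivAt_const 0 x).congr h2)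
  have f1 : (1 - Pt x) * (Ap * Pt x + Pt') = 0 := by
    calc (1 - Pt x) * (Ap * Pt x + Pt')
        = K1 * ((0 * Mp x + (1 - P) * (Mp x * Ap)) * Pt x + (1 - P) * Mp x * Pt') := by
          rw [hK1]; noncomm_ring
      _ = 0 := by rw [e1, mul_zero]
  have f2 : Pt x * (Am * (1 - Pt x) - Pt') = 0 := by
    calc Pt x * (Am * (1 - Pt x) - Pt')
        = K2 * (P * Mm x) * (Am * (1 - Pt x) - Pt') := by rw [← hK2]
      _ = K2 * ((0 * Mm x + P * (Mm x * Am)) * (1 - Pt x) + P * Mm x * -Pt') := by noncomm_ring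
      _ = 0 := by rw [e2, mul_zero]
  rw [mul_add, ← mul_assoc] at f1
  rw [mul_sub, ← mul_assoc, sub_eq_zero] at f2
  rw [f2, eq_neg_of_add_eq_zero_left f1, sub_neg_eq_add, sub_mul, one_mul, add_sub_cancel]

lemma polyEval_ofReal (r : ℝ) (A : Mat n ℝ[X]) :
    polyEval Complex.ofRealHom (r : ℂ) A = (realEval r A).map Complex.ofRealHom := by
  ext i k
  have := Polynomial.hom_eval₂ (A i k) (RingHom.id ℝ) Complex.ofRealHom r
  simpa [polyEval] using this.symm

lemma frameRe_deriv {Φ : ℝ → Mat n ℂ} {A : Mat n ℝ[X]} {x r : ℝ} {M : Mat n ℝ}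
    (hM : M.map Complex.ofRealHom = Φ x)
    (h : HasMatDerivAt Φ (Φ x * polyEval Complex.ofRealHom (r : ℂ) A) x) :
    HasMatDerivAt (fun y => (Φ y).map Complex.re) (M * realEval r A) x := by
  intro i k
  have h1 := (Complex.reCLM.hasFDerivAt (x := Φ x i k)).comp_hasDerivAt x (h i k)
  have h2 : Complex.reCLM ((Φ x * polyEval Complex.ofRealHom (r : ℂ) A) i k)
      = (M * realEval r A) i k := by
    rw [← hM, polyEval_ofReal, ← Matrix.map_mul]
    exact Complex.ofReal_re _
  rw [h2] at h1
  exact h1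

lemma polyEval_potential (q : Mat n ℝ) (z : ℂ) :
    polyEval Complex.ofRealHom z (potential q) = evalJ n z + q.map Complex.ofReal := by
  rw [potential, map_add, polyEval_smul, polyEval_map_C, polyEval_map_C, Polynomial.eval₂_X, evalJ]
  ext i k
  simp only [Matrix.add_apply, Matrix.smul_apply, Matrix.map_apply, Complex.ofRealHom_eq_coe,
    Complex.ofReal_add]
  ring

lemma deriv_of_inv_mul {Φ D B : Mat n ℂ} (hdet : Φ.det = 1) (h : Φ⁻¹ * D = B) : D = Φ * B := by
  rw [← h, ← mul_assoc, Matrix.mul_nonsing_inv _ (by rw [hdet]; exact isUnit_one), one_mul]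

lemma simpleElement_eq (z : ℂ) : simpleElement α P z = dress Complex.ofRealHom z α P := rfl

/-- Differentiation of the transformed frame along a line. -/
lemma hasMatDerivAt_dressed {Φ : ℝ → Mat n ℂ} {Pt : ℝ → Mat n ℝ} {Pt' : Mat n ℝ}
    {A Q : Mat n ℝ[X]} {x : ℝ} {z : ℂ} (hz : z ≠ α) (hz' : z ≠ -α) (g : Mat n ℂ)
    (dΦ : HasMatDerivAt Φ (Φ x * polyEval Complex.ofRealHom z A) x)
    (dPt : HasMatDerivAt Pt Pt' x) (hPt : ∀ᶠ y in 𝓝 x, Pt y * Pt y = Pt y)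
    (hg : IsGauge α (Pt x) Pt' A Q) :
    HasMatDerivAt (fun y => g * Φ y * dress Complex.ofRealHom z (-α) (Pt y))
      (g * Φ x * dress Complex.ofRealHom z (-α) (Pt x) * polyEval Complex.ofRealHom z Q) x := by
  have d1 := hasMatDerivAt_dress α z dPt
  have d2 := hasMatDerivAt_dress (-α) z dPt
  have hGG := dress_mul_dress_neg (c := Complex.ofRealHom) hPt.self_of_nhds hz hz'
  have dd := (d2.mul d1).unique ((hasMatDerivAt_const 1 x).congr
    (hPt.mono fun y hy => dress_neg_mul_dress (c := Complex.ofRealHom) hy hz hz'))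
  have hev := hg.eval (c := Complex.ofRealHom) hz
  have dtot := ((hasMatDerivAt_const g x).mul dΦ).mul d2
  set G := dress Complex.ofRealHom z α (Pt x)
  set G' := dress Complex.ofRealHom z (-α) (Pt x)
  set dG := (2 * Complex.ofRealHom α / (z - Complex.ofRealHom α)) • -(Pt'.map Complex.ofRealHom)
    with hdG
  set dG' := (2 * Complex.ofRealHom (-α) / (z - Complex.ofRealHom (-α)))
    • -(Pt'.map Complex.ofRealHom)
  have e1 : dG = G * polyEval Complex.ofRealHom z A - polyEval Complex.ofRealHom z Q * G := by
    rw [hev, hdG, smul_neg]; abel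
  have e2 := gauge_inv_deriv hGG (mul_eq_one_comm.1 hGG) dd e1
  convert dtot using 1
  rw [e2]
  noncomm_ring

end TildeProjection

/-! ### The transformed frame -/

section TransformedFrame

open Polynomial

variable {n j : ℕ} {U : Set (ℝ × ℝ)} {q : ℝ × ℝ → Mat n ℝ} {F : ℝ × ℝ → ℂ → Mat n ℂ}
  {α : ℝ} {P : Mat n ℝ} {p : ℝ × ℝ}

/-- One divided slope for each zero: slopes of entire functions are entire, and `a ≠ -a` ensures
that the zero at `-a` survives the first division. -/
lemma exists_entire_quotient {h : ℂ → ℂ} (hh : Differentiable ℂ h) {a : ℂ} (ha : a ≠ 0)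
    (h1 : h a = 0) (h2 : h (-a) = 0) :
    ∃ k : ℂ → ℂ, Differentiable ℂ k ∧ ∀ z, h z = (z - a) * (z + a) * k z := by
  have hd : ∀ {f : ℂ → ℂ} (c : ℂ), Differentiable ℂ f → Differentiable ℂ (dslope f c) := by
    intro f c hf
    rw [← differentiableOn_univ] at hf ⊢
    exact (Complex.differentiableOn_dslope Filter.univ_mem).2 hf
  refine ⟨dslope (dslope h a) (-a), hd _ (hd _ hh), fun z => ?_⟩
  have e1 : ∀ w, h w = (w - a) * dslope h a w := fun w => by
    have := sub_smul_dslope h a w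
    rw [h1, sub_zero, smul_eq_mul] at this
    exact this.symm
  have e2 : dslope h a (-a) = 0 := by
    have := e1 (-a)
    rw [h2] at this
    rcases mul_eq_zero.1 this.symm with h0 | h0
    · exfalso
      apply ha
      have : (2 : ℂ) * a = 0 := by linear_combination -h0
      simpa using this
    · exact h0
  have e3 := sub_smul_dslope (dslope h a) (-a) z
  rw [e2, sub_zero, smul_eq_mul, sub_neg_eq_add] at e3
  rw [e1, ← e3, mul_assoc]

lemma matDifferentiable_mul {A B : ℂ → Mat n ℂ} (hA : ∀ i k, Differentiable ℂ fun z => A z i k)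
    (hB : ∀ i k, Differentiable ℂ fun z => B z i k) (i k : Fin (2 * n + 1)) :
    Differentiable ℂ fun z => (A z * B z) i k := by
  simp only [Matrix.mul_apply]
  exact Differentiable.fun_sum fun l _ => (hA i l).mul (hB l k)

/-- The simple factors applied to an entire matrix function with the right values at `±α` leave
it entire. -/
lemma exists_entire_dressed (hα : α ≠ 0) {Φ : ℂ → Mat n ℂ}
    (hΦ : ∀ i k, Differentiable ℂ fun z => Φ z i k) {Pt : Mat n ℝ}
    (h1 : (1 - P.map Complex.ofRealHom) * Φ α * Pt.map Complex.ofRealHom = 0)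
    (h2 : P.map Complex.ofRealHom * Φ (-α) * (1 - Pt.map Complex.ofRealHom) = 0) :
    ∃ K : ℂ → Mat n ℂ, (∀ i k, Differentiable ℂ fun z => K z i k) ∧
      ∀ z : ℂ, z ≠ α → z ≠ -α →
        dress Complex.ofRealHom z α P * Φ z * dress Complex.ofRealHom z (-α) Pt = K z := by
  set R := 1 - P.map Complex.ofRealHom with hR
  set R' := 1 - Pt.map Complex.ofRealHom with hR'
  -- `H` is the dressed function with denominators cleared. The factor on the right is the numerator
  -- of the simple element for `-α`, and `h1`, `h2` are the vanishing of `H` at `α` and `-α` up to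
  -- scalars.
  set H : ℂ → Mat n ℂ := fun z =>
    ((z - α) • (1 : Mat n ℂ) + (2 * (α : ℂ)) • R) * Φ z * ((z + α) • 1 - (2 * (α : ℂ)) • R')
    with hH
  have hHd : ∀ i k, Differentiable ℂ fun z => H z i k := by
    refine matDifferentiable_mul (matDifferentiable_mul (fun i k => ?_) hΦ) fun i k => ?_
    · simp only [Matrix.add_apply, Matrix.smul_apply, smul_eq_mul]; fun_prop
    · simp only [Matrix.sub_apply, Matrix.smul_apply, smul_eq_mul]; fun_prop
  have hP1 : P.map Complex.ofRealHom = 1 - R := by rw [hR, sub_sub_cancel]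
  have hP2 : Pt.map Complex.ofRealHom = 1 - R' := by rw [hR', sub_sub_cancel]
  rw [hP2] at h1
  rw [hP1] at h2
  have z1 : H α = 0 := by
    have e1 : ((α : ℂ) - α) • (1 : Mat n ℂ) + (2 * (α : ℂ)) • R = (2 * (α : ℂ)) • R := by module
    have e2 : ((α : ℂ) + α) • (1 : Mat n ℂ) - (2 * (α : ℂ)) • R' = (2 * (α : ℂ)) • (1 - R') := by
      module
    simp only [hH]
    rw [e1, e2, Matrix.smul_mul, Matrix.smul_mul, Matrix.mul_smul, h1, smul_zero, smul_zero]
  have z2 : H (-α) = 0 := by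
    have e1 : (-(α : ℂ) - α) • (1 : Mat n ℂ) + (2 * (α : ℂ)) • R = (-2 * (α : ℂ)) • (1 - R) := by
      module
    have e2 : (-(α : ℂ) + α) • (1 : Mat n ℂ) - (2 * (α : ℂ)) • R' = (-2 * (α : ℂ)) • R' := by
      module
    simp only [hH]
    rw [e1, e2, Matrix.smul_mul, Matrix.smul_mul, Matrix.mul_smul, h2, smul_zero, smul_zero]
  have hα' : (α : ℂ) ≠ 0 := Complex.ofReal_ne_zero.2 hα
  choose K hK1 hK2 using fun i k => exists_entire_quotient (hHd i k) hα'
    (congrFun (congrFun z1 i) k) (congrFun (congrFun z2 i) k)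
  refine ⟨fun z => Matrix.of fun i k => K i k z, hK1, fun z hz hz' => ?_⟩
  have n1 : z - α ≠ 0 := sub_ne_zero.2 hz
  have n2 : z + α ≠ 0 := by rwa [← sub_neg_eq_add, sub_ne_zero]
  have e1 : (z - α) • dress Complex.ofRealHom z α P
      = (z - α) • (1 : Mat n ℂ) + (2 * (α : ℂ)) • R := by
    rw [dress, smul_add, smul_smul, Complex.ofRealHom_eq_coe, mul_div_cancel₀ _ n1]
  have e2 : (z + α) • dress Complex.ofRealHom z (-α) Pt
      = (z + α) • (1 : Mat n ℂ) - (2 * (α : ℂ)) • R' := by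
    rw [dress, smul_add, smul_smul, map_neg, Complex.ofRealHom_eq_coe, sub_neg_eq_add,
      mul_div_cancel₀ _ n2, mul_neg, neg_smul, ← sub_eq_add_neg]
  have e3 : H z = ((z - α) * (z + α)) •
      (dress Complex.ofRealHom z α P * Φ z * dress Complex.ofRealHom z (-α) Pt) := by
    simp only [hH]
    rw [← e1, ← e2, Matrix.smul_mul, Matrix.smul_mul, Matrix.mul_smul, smul_smul]
  ext i k
  have e4 := congrFun (congrFun e3 i) k
  rw [hK2 i k z, Matrix.smul_apply, smul_eq_mul] at e4
  exact (mul_left_cancel₀ (mul_ne_zero n1 n2) e4).symm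

lemma eq_of_eq_off_pair {f g : ℂ → ℂ} (hf : Continuous f) (hg : Continuous g) (a b : ℂ)
    (h : ∀ z, z ≠ a → z ≠ b → f z = g z) (z : ℂ) : f z = g z := by
  have hd : Dense ({a, b}ᶜ : Set ℂ) :=
    (Set.Finite.countable (Set.toFinite {a, b})).dense_compl ℝ
  refine congrFun (hf.ext_on hd hg fun w hw => ?_) z
  simp only [Set.mem_compl_iff, Set.mem_insert_iff, Set.mem_singleton_iff, not_or] at hw
  exact h w hw.1 hw.2

lemma mat_eq_of_eq_off_pair {f g : ℂ → Mat n ℂ} (hf : ∀ i k, Continuous fun z => f z i k)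
    (hg : ∀ i k, Continuous fun z => g z i k) (a b : ℂ)
    (h : ∀ z, z ≠ a → z ≠ b → f z = g z) (z : ℂ) : f z = g z := by
  ext i k
  exact eq_of_eq_off_pair (hf i k) (hg i k) a b
    (fun w h1 h2 => congrFun (congrFun (h w h1 h2) i) k) z

/-- The punctured limit is the value of the entire extension at every point, including `±α`. Later
proofs use only this description: an explicit product away from `±α`, entire everywhere. -/
lemma backlundFrame_spec (hα : α ≠ 0) (hF : IsFrame n j U q F) (hP : IsFormProj P)
    (hp : p ∈ regularSet U α P F) :
    (∀ i k, Differentiable ℂ fun z => backlundFrame α P F p z i k) ∧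
    ∀ z : ℂ, z ≠ α → z ≠ -α → backlundFrame α P F p z =
      dress Complex.ofRealHom z α P * F p z
        * dress Complex.ofRealHom z (-α) (tildeProj α P F p) := by
  have hpU : p ∈ U := hp.1
  have hPt := isFormProj_tildeProj hp
  obtain ⟨r1, r2, -, -⟩ := tildeProj_relations hF hP hp
  obtain ⟨K, hK, hK'⟩ := exists_entire_dressed (P := P) (Pt := tildeProj α P F p) hα
    (hF.holomorphic p hpU)
    (by
      have := congrArg (fun A : Mat n ℝ => A.map Complex.ofRealHom) r1
      simp only [Matrix.map_mul, map_compl, hF.map_frameRe hpU] at this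
      simpa using this)
    (by
      have := congrArg (fun A : Mat n ℝ => A.map Complex.ofRealHom) r2
      simp only [Matrix.map_mul, map_compl, hF.map_frameRe hpU] at this
      simpa using this)
  have hKc : ∀ z, backlundFrame α P F p z = K z := by
    intro z
    apply Filter.Tendsto.limUnder_eq
    have hcont : Continuous K := continuous_matrix fun i k => (hK i k).continuous
    refine (hcont.continuousAt.continuousWithinAt (s := {z}ᶜ)).tendsto.congr' ?_
    have e1 : ∀ a : ℂ, ∀ᶠ w in 𝓝[≠] z, w ≠ a := by
      intro a
      by_cases h : z = a
      · subst h; exact self_mem_nhdsWithin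
      · exact (isOpen_ne.mem_nhds h : {w | w ≠ a} ∈ 𝓝 z) |> fun h => mem_nhdsWithin_of_mem_nhds h
    filter_upwards [e1 α, e1 (-α)] with w h1 h2
    rw [simpleElement_eq, simpleElement_eq, dress_inv hPt.1 h1 h2, hK' w h1 h2]
  refine ⟨fun i k => by simpa only [hKc] using hK i k, fun z h1 h2 => ?_⟩
  rw [hKc, hK' z h1 h2]

/-- Entrywise continuity of a matrix function on a set. -/
def MatContinuousOn {X : Type*} [TopologicalSpace X] (A : X → Mat n ℂ) (s : Set X) : Prop :=
  ∀ i k, ContinuousOn (fun w => A w i k) s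

lemma MatContinuousOn.mul {X : Type*} [TopologicalSpace X] {A B : X → Mat n ℂ} {s : Set X}
    (hA : MatContinuousOn A s) (hB : MatContinuousOn B s) :
    MatContinuousOn (fun w => A w * B w) s := fun i k => by
  simp only [Matrix.mul_apply]
  exact continuousOn_finsetSum _ fun l _ => (hA i l).mul (hB l k)

lemma matContinuousOn_dress {X : Type*} [TopologicalSpace X] {s : Set X} {ζ : X → ℂ}
    {Q : X → Mat n ℝ} (hζ : ContinuousOn ζ s) (hQ : ∀ i k, ContinuousOn (fun w => Q w i k) s)
    (hne : ∀ w ∈ s, ζ w ≠ α) :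
    MatContinuousOn (fun w => dress Complex.ofRealHom (ζ w) α (Q w)) s := by
  intro i k
  have e : ∀ w, dress Complex.ofRealHom (ζ w) α (Q w) i k = (1 : Mat n ℂ) i k
      + 2 * (α : ℂ) / (ζ w - α) * ((1 : Mat n ℂ) i k - (Q w i k : ℂ)) := fun w => rfl
  simp only [e]
  refine continuousOn_const.add (ContinuousOn.mul ?_ ?_)
  · exact continuousOn_const.div (hζ.sub continuousOn_const) fun w hw => sub_ne_zero.2 (hne w hw)
  · exact continuousOn_const.sub (Complex.continuous_ofReal.comp_continuousOn (hQ i k))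

lemma SmoothLoop.plusEval_eq_sum {T : ℝ × ℝ → Loop n} (hT : SmoothLoop U T) :
    ∃ d : ℕ, ∀ p ∈ U, ∀ z : ℂ, (T p).plusEval z =
      ∑ m ∈ Finset.range d, z ^ m • ((T p).coeff (m : ℤ)).map Complex.ofReal := by
  obtain ⟨a, ha⟩ := hT.exists_bound
  refine ⟨a.natAbs + 1, fun p hp z => ?_⟩
  rw [Loop.plusEval, finsum_eq_sum_of_support_subset]
  intro m hm
  by_contra hlt
  apply hm
  rw [Finset.coe_range, Set.mem_Iio, not_lt] at hlt
  have : (T p).coeff (m : ℤ) = 0 := by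
    ext i k
    exact ha p hp i k (-(m : ℤ)) (by omega)
  ext i k
  simp [this]

lemma SmoothLoop.smoothOn_coeff {T : ℝ × ℝ → Loop n} (hT : SmoothLoop U T) (m : ℤ) :
    SmoothOn U fun p => (T p).coeff m := fun i k => (hT i k).1 (-m)

lemma SmoothLoop.smoothOn_plusEval {T : ℝ × ℝ → Loop n} (hT : SmoothLoop U T) (z : ℂ) :
    SmoothOn U fun p => (T p).plusEval z := by
  obtain ⟨d, hd⟩ := hT.plusEval_eq_sum
  refine SmoothOn.congr (fun i k => ?_) fun p hp => hd p hp z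
  simp only [Matrix.sum_apply, Matrix.smul_apply, smul_eq_mul]
  exact ContDiffOn.sum fun m _ => contDiffOn_const.mul ((hT.smoothOn_coeff m).ofReal i k)

lemma SmoothLoop.continuousOn_plusEval {T : ℝ × ℝ → Loop n} (hT : SmoothLoop U T) :
    MatContinuousOn (fun w : (ℝ × ℝ) × ℂ => (T w.1).plusEval w.2) (U ×ˢ Set.univ) := by
  obtain ⟨d, hd⟩ := hT.plusEval_eq_sum
  intro i k
  have h : ContinuousOn (fun w : (ℝ × ℝ) × ℂ => ∑ m ∈ Finset.range d,
      w.2 ^ m * (((T w.1).coeff (m : ℤ) i k : ℝ) : ℂ)) (U ×ˢ Set.univ) := by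
    refine continuousOn_finsetSum _ fun m _ => ((continuous_snd.pow m).continuousOn).mul ?_
    exact Complex.continuous_ofReal.comp_continuousOn
      ((hT.smoothOn_coeff m i k).continuousOn.comp continuousOn_fst fun w hw => hw.1)
  refine h.congr fun w hw => ?_
  simp only [hd w.1 hw.1 w.2, Matrix.sum_apply, Matrix.smul_apply, smul_eq_mul]
  rfl

/-- Linear systems with jointly continuous coefficients, entire in the spectral parameter: if they
hold away from `±a`, they hold everywhere, and the solution is jointly continuous and smooth. -/
lemma frame_extension (hU : IsOpen U) {Φ A B : ℝ × ℝ → ℂ → Mat n ℂ} (a : ℂ)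
    (hΦ : ∀ p ∈ U, ∀ i k, Differentiable ℂ fun z => Φ p z i k)
    (hA : ∀ p ∈ U, ∀ i k, Differentiable ℂ fun z => A p z i k)
    (hB : ∀ p ∈ U, ∀ i k, Differentiable ℂ fun z => B p z i k)
    (hΦc : MatContinuousOn (fun w : (ℝ × ℝ) × ℂ => Φ w.1 w.2) (U ×ˢ {z | z ≠ a ∧ z ≠ -a}))
    (hAc : MatContinuousOn (fun w : (ℝ × ℝ) × ℂ => A w.1 w.2) (U ×ˢ Set.univ))
    (hBc : MatContinuousOn (fun w : (ℝ × ℝ) × ℂ => B w.1 w.2) (U ×ˢ Set.univ))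
    (hd : ∀ p ∈ U, ∀ z, z ≠ a → z ≠ -a → ∀ i k, HasFDerivAt (fun p => Φ p z i k)
      (linComb ((Φ p z * A p z) i k) ((Φ p z * B p z) i k)) p) :
    MatContinuousOn (fun w : (ℝ × ℝ) × ℂ => Φ w.1 w.2) (U ×ˢ Set.univ) ∧
    ∀ p ∈ U, ∀ z i k, HasFDerivAt (fun p => Φ p z i k)
      (linComb ((Φ p z * A p z) i k) ((Φ p z * B p z) i k)) p := by
  have hsub : ∀ R : ℝ, ‖a‖ < R → U ×ˢ Metric.sphere (0 : ℂ) R ⊆ U ×ˢ {z | z ≠ a ∧ z ≠ -a} := by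
    rintro R hR w ⟨h1, h2⟩
    rw [mem_sphere_zero_iff_norm] at h2
    refine ⟨h1, ?_, ?_⟩ <;> intro h <;> rw [h] at h2
    · exact hR.ne h2
    · rw [norm_neg] at h2; exact hR.ne h2
  have huniv : ∀ R : ℝ, U ×ˢ Metric.sphere (0 : ℂ) R ⊆ U ×ˢ Set.univ :=
    fun R w hw => ⟨hw.1, trivial⟩
  constructor
  · intro i k w hw
    -- The circle of radius `R` encloses the given point and avoids `±a`, so the hypotheses away
    -- from `±a` apply on it.
    obtain ⟨R, hR⟩ := exists_gt (max ‖a‖ ‖w.2‖)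
    have hR1 := (le_max_left _ _).trans_lt hR
    have hR2 := (le_max_right _ _).trans_lt hR
    have hR0 : 0 < R := (norm_nonneg _).trans_lt hR1
    have h1 := continuousOn_of_circle (U := U) hR0 (f := fun p z => Φ p z i k)
      (fun p hp => hΦ p hp i k) ((hΦc i k).mono (hsub R hR1))
    have hwb : w ∈ U ×ˢ Metric.ball (0 : ℂ) R := ⟨hw.1, by simpa using hR2⟩
    exact (h1.continuousAt ((hU.prod Metric.isOpen_ball).mem_nhds hwb)).continuousWithinAt
  · intro p hp z i k
    obtain ⟨R, hR⟩ := exists_gt (max ‖a‖ ‖z‖)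
    have hR1 := (le_max_left _ _).trans_lt hR
    have hR2 := (le_max_right _ _).trans_lt hR
    have hR0 : 0 < R := (norm_nonneg _).trans_lt hR1
    have hX : ∀ D : ℝ × ℝ → ℂ → Mat n ℂ,
        MatContinuousOn (fun w : (ℝ × ℝ) × ℂ => D w.1 w.2) (U ×ˢ Set.univ) →
        MatContinuousOn (fun w : (ℝ × ℝ) × ℂ => Φ w.1 w.2 * D w.1 w.2)
          (U ×ˢ Metric.sphere (0 : ℂ) R) := fun D hD =>
      MatContinuousOn.mul (fun i k => (hΦc i k).mono (hsub R hR1))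
        (fun i k => (hD i k).mono (huniv R))
    refine hasFDerivAt_of_circle hU hR0 (f := fun p z => Φ p z i k)
      (f' := fun p z => linComb ((Φ p z * A p z) i k) ((Φ p z * B p z) i k))
      (fun p hp => hΦ p hp i k) ?_ ((hΦc i k).mono (hsub R hR1)) ?_ ?_ hp
      (by simpa using hR2)
    · intro p hp v
      simp only [linComb_apply]
      exact ((matDifferentiable_mul (hΦ p hp) (hA p hp) i k).const_mul _).add
        ((matDifferentiable_mul (hΦ p hp) (hB p hp) i k).const_mul _)
    · have h1 := hX A hAc i k
      have h2 := hX B hBc i k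
      exact Continuous.comp_continuousOn (g := fun w : ℂ × ℂ => linComb w.1 w.2)
        (f := fun w : (ℝ × ℝ) × ℂ => ((Φ w.1 w.2 * A w.1 w.2) i k, (Φ w.1 w.2 * B w.1 w.2) i k))
        continuous_linComb (h1.prodMk h2)
    · intro p hp w hw
      have := hsub R hR1 (⟨hp, hw⟩ : (p, w) ∈ U ×ˢ Metric.sphere (0 : ℂ) R)
      exact hd p hp w this.2.1 this.2.2 i k

end TransformedFrame

/-! ### One Bäcklund transformation: the new potential and its frame -/

section BacklundStep

open Polynomial

variable {n j : ℕ} {U : Set (ℝ × ℝ)} {q : ℝ × ℝ → Mat n ℝ} {F : ℝ × ℝ → ℂ → Mat n ℂ}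
  {α : ℝ} {P : Mat n ℝ} {p : ℝ × ℝ}

lemma IsResolvent.mono {S : ℝ × ℝ → Loop n} {V : Set (ℝ × ℝ)} (h : IsResolvent U q S)
    (hV : V ⊆ U) : IsResolvent V q S where
  smooth k := (h.smooth k).mono hV
  bounded := h.bounded.imp fun _ hm p hp => hm p (hV hp)
  twisted p hp := h.twisted p (hV hp)
  commutes p hp := h.commutes p (hV hp)
  conj p hp := h.conj p (hV hp)

lemma IsFrame.hasMatDerivAt_x (hU : IsOpen U) (hF : IsFrame n j U q F) (hp : p ∈ U) (z : ℂ) :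
    HasMatDerivAt (fun x => F (x, p.2) z)
      (F p z * polyEval Complex.ofRealHom z (potential (q p))) p.1 := by
  obtain ⟨S, -, hS⟩ := hF.lax
  rw [polyEval_potential, ← deriv_of_inv_mul (hF.det_eq_one p hp z) (hS p hp z).1]
  exact (hF.smooth z).hasDerivAt_x hU hp

/-- `eπ̃` lives in the first row and `π̃e` in the last column, so nothing appears below the
diagonal. Both `e` and `π̃` are self-adjoint for the form, so their commutator is skew. -/
lemma IsBPlus.backlund (hq : IsBPlus (q p)) (hp : p ∈ regularSet U α P F) :
    IsBPlus (backlund α P F q p) := by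
  have hPt := isFormProj_tildeProj hp
  set Pt := tildeProj α P F p with hPtd
  have hb : IsotropicKdV.backlund α P F q p = q p + (2 * α) • ⁅cornerMatrix n, Pt⁆ := rfl
  rw [hb]
  constructor
  · intro i k hik
    have h1 : (cornerMatrix n * Pt) i k = 0 := by
      rw [cornerMatrix, Matrix.single_mul_apply_of_ne]
      rintro rfl
      exact absurd hik (by simp)
    have h2 : (Pt * cornerMatrix n) i k = 0 := by
      rw [cornerMatrix, Matrix.mul_single_apply_of_ne]
      rintro rfl
      exact absurd (Fin.le_last i) (not_le.2 hik)
    rw [Matrix.add_apply, Matrix.smul_apply, Ring.lie_def, Matrix.sub_apply, h1, h2,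
      hq.1 i k hik]
    simp
  · have e1 : ⁅cornerMatrix n, Pt⁆ᵀ * formMatrix n + formMatrix n * ⁅cornerMatrix n, Pt⁆ = 0 := by
      have hc := cornerMatrix_form (n := n)
      rw [Ring.lie_def, Matrix.transpose_sub, Matrix.transpose_mul, Matrix.transpose_mul, sub_mul,
        mul_sub, mul_assoc, mul_assoc, hc, hPt.2, ← mul_assoc, hPt.2, ← mul_assoc, hc]
      noncomm_ring
    rw [Matrix.transpose_add, Matrix.transpose_smul, add_mul, mul_add, Matrix.smul_mul,
      Matrix.mul_smul]
    have := hq.2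
    calc _ = ((q p)ᵀ * formMatrix n + formMatrix n * q p) + (2 * α) •
          (⁅cornerMatrix n, Pt⁆ᵀ * formMatrix n + formMatrix n * ⁅cornerMatrix n, Pt⁆) := by
            rw [smul_add]; abel
      _ = 0 := by rw [this, e1, smul_zero, add_zero]

lemma smoothOn_backlund (hq : SmoothOn U q) (hF : IsFrame n j U q F) (hP : IsFormProj P) :
    SmoothOn (regularSet U α P F) (backlund α P F q) := by
  have h := smoothOn_tildeProj (α := α) hF hP
  exact (hq.mono fun p hp => hp.1).add
    ((((SmoothOn.const (cornerMatrix n)).mul h).sub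
      (h.mul (SmoothOn.const (cornerMatrix n)))).const_smul (2 * α))

lemma differentiable_polyEval (Q : Mat n ℝ[X]) (i k : Fin (2 * n + 1)) :
    Differentiable ℂ fun z => polyEval Complex.ofRealHom z Q i k := by
  simp only [polyEval, RingHom.mapMatrix_apply, Matrix.map_apply, Polynomial.coe_eval₂RingHom,
    Polynomial.eval₂_eq_eval_map]
  exact Polynomial.differentiable _

lemma dress_form {K : Type*} [Field K] {c : ℝ →+* K} {ℓ : K} (hP : IsFormProj P) (h1 : ℓ ≠ c α)
    (h2 : ℓ ≠ -c α) :
    (dress c (-ℓ) α P)ᵀ * (formMatrix n).map c * dress c ℓ α P = (formMatrix n).map c := by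
  have hC : (formMatrix n).map c * (formMatrix n).map c = 1 := by
    rw [← Matrix.map_mul, formMatrix_mul_self]; simp
  have h := dress_twisted (c := c) (ℓ := ℓ) (α := α) hP
  set C := (formMatrix n).map c
  calc (dress c (-ℓ) α P)ᵀ * C * dress c ℓ α P
      = C * C * ((dress c (-ℓ) α P)ᵀ * C * dress c ℓ α P) := by rw [hC, one_mul]
    _ = C * (C * (dress c (-ℓ) α P)ᵀ * C) * dress c ℓ α P := by simp only [mul_assoc]
    _ = C := by rw [h, mul_assoc, dress_neg_mul_dress (c := c) hP.1 h1 h2, mul_one]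

/-- The derivative of the transformed projection in a direction along which the frame satisfies
`F' = F A`. -/
lemma tildeProj_ode (hF : IsFrame n j U q F) (hP : IsFormProj P) {γ : ℝ → ℝ × ℝ} {s : ℝ}
    (hγ : ∀ᶠ y in 𝓝 s, γ y ∈ regularSet U α P F) {A : Mat n ℝ[X]} {Pt' : Mat n ℝ}
    (hA : ∀ z, HasMatDerivAt (fun y => F (γ y) z)
      (F (γ s) z * polyEval Complex.ofRealHom z A) s)
    (hPt : HasMatDerivAt (fun y => tildeProj α P F (γ y)) Pt' s) :
    Pt' = tildeProj α P F (γ s) * realEval (-α) A * (1 - tildeProj α P F (γ s))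
      - (1 - tildeProj α P F (γ s)) * realEval α A * tildeProj α P F (γ s) := by
  have hs := hγ.self_of_nhds
  obtain ⟨-, -, h3, h4⟩ := tildeProj_relations hF hP hs
  have d : ∀ r : ℝ, HasMatDerivAt (fun y => frameRe F r (γ y))
      (frameRe F r (γ s) * realEval r A) s :=
    fun r => frameRe_deriv (Φ := fun y => F (γ y) (r : ℂ)) (hF.map_frameRe hs.1 r) (hA r)
  have h1 : ∀ᶠ y in 𝓝 s, (1 - P) * frameRe F α (γ y) * tildeProj α P F (γ y) = 0 :=
    hγ.mono fun y hy => (tildeProj_relations hF hP hy).1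
  have h2 : ∀ᶠ y in 𝓝 s, P * frameRe F (-α) (γ y) * (1 - tildeProj α P F (γ y)) = 0 :=
    hγ.mono fun y hy => (tildeProj_relations hF hP hy).2.1
  exact projection_ode (P := P) (Mp := fun y => frameRe F α (γ y))
    (Mm := fun y => frameRe F (-α) (γ y)) (Pt := fun y => tildeProj α P F (γ y)) (x := s)
    (d α) (d (-α)) hPt h1 h2 h3 h4

/-- Differentiation of the transformed frame along a line. -/
lemma backlundFrame_deriv (hα : α ≠ 0) (hF : IsFrame n j U q F) (hP : IsFormProj P)
    {γ : ℝ → ℝ × ℝ} {s : ℝ} (hγ : ∀ᶠ y in 𝓝 s, γ y ∈ regularSet U α P F) {A Q : Mat n ℝ[X]}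
    {Pt' : Mat n ℝ}
    (hA : ∀ z, HasMatDerivAt (fun y => F (γ y) z)
      (F (γ s) z * polyEval Complex.ofRealHom z A) s)
    (hPt : HasMatDerivAt (fun y => tildeProj α P F (γ y)) Pt' s)
    (hg : IsGauge α (tildeProj α P F (γ s)) Pt' A Q) {z : ℂ} (hz : z ≠ α) (hz' : z ≠ -α) :
    HasMatDerivAt (fun y => backlundFrame α P F (γ y) z)
      (backlundFrame α P F (γ s) z * polyEval Complex.ofRealHom z Q) s := by
  have h := hasMatDerivAt_dressed hz hz' (dress Complex.ofRealHom z α P) (hA z) hPt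
    (hγ.mono fun y hy => (isFormProj_tildeProj hy).1) hg
  rw [(backlundFrame_spec hα hF hP hγ.self_of_nhds).2 z hz hz']
  exact h.congr (hγ.mono fun y hy => (backlundFrame_spec hα hF hP hy).2 z hz hz')

lemma continuous_backlundFrame (hα : α ≠ 0) (hF : IsFrame n j U q F) (hP : IsFormProj P)
    (hp : p ∈ regularSet U α P F) (i k : Fin (2 * n + 1)) :
    Continuous fun z => backlundFrame α P F p z i k :=
  ((backlundFrame_spec hα hF hP hp).1 i k).continuous

/-- `π̃` is conjugate to `π`, so the outer factors have reciprocal determinants away from `±α`;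
continuity in `λ` covers `±α`. -/
lemma det_backlundFrame (hα : α ≠ 0) (hF : IsFrame n j U q F) (hP : IsFormProj P)
    (hp : p ∈ regularSet U α P F) (z : ℂ) : (backlundFrame α P F p z).det = 1 := by
  refine eq_of_eq_off_pair (f := fun z => (backlundFrame α P F p z).det) (g := fun _ => 1)
    (Continuous.matrix_det (continuous_matrix (continuous_backlundFrame hα hF hP hp)))
    continuous_const (α : ℂ) (-α) (fun z hz hz' => ?_) z
  have hu := ((mem_regularSet_iff hF hP).1 hp).2
  rw [(backlundFrame_spec hα hF hP hp).2 z hz hz', tildeProj_eq hF hP hp, Matrix.det_mul,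
    Matrix.det_mul, hF.det_eq_one p hp.1 z, mul_one, det_dress_conj hu, ← Matrix.det_mul,
    dress_mul_dress_neg (c := Complex.ofRealHom) hP.1 hz hz', Matrix.det_one]

lemma conj_backlundFrame (hα : α ≠ 0) (hF : IsFrame n j U q F) (hP : IsFormProj P)
    (hp : p ∈ regularSet U α P F) (z : ℂ) :
    backlundFrame α P F p (starRingEnd ℂ z) = (backlundFrame α P F p z).map (starRingEnd ℂ) := by
  have hcz := continuous_backlundFrame hα hF hP hp
  have hspec := (backlundFrame_spec hα hF hP hp).2
  refine mat_eq_of_eq_off_pair (f := fun z => backlundFrame α P F p (starRingEnd ℂ z))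
    (g := fun z => (backlundFrame α P F p z).map (starRingEnd ℂ))
    (fun i k => (hcz i k).comp Complex.continuous_conj)
    (fun i k => Complex.continuous_conj.comp (hcz i k)) (α : ℂ) (-α) (fun z hz hz' => ?_) z
  have h1 : starRingEnd ℂ z ≠ α := fun h => hz (by
    rw [← Complex.conj_conj z, h, Complex.conj_ofReal])
  have h2 : starRingEnd ℂ z ≠ -α := fun h => hz' (by
    rw [← Complex.conj_conj z, h, map_neg, Complex.conj_ofReal])
  have hc : (starRingEnd ℂ).comp Complex.ofRealHom = Complex.ofRealHom :=
    RingHom.ext fun r => Complex.conj_ofReal r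
  rw [hspec z hz hz', hspec _ h1 h2, hF.real p hp.1, Matrix.map_mul,
    Matrix.map_mul, map_dress, map_dress, hc]

lemma twisted_mul {C G₁ G₂ H₁ H₂ F₁ F₂ : Mat n ℂ} (hG : G₂ᵀ * C * G₁ = C) (hF : F₂ᵀ * C * F₁ = C)
    (hH : H₂ᵀ * C * H₁ = C) : (G₂ * F₂ * H₂)ᵀ * C * (G₁ * F₁ * H₁) = C := by
  calc (G₂ * F₂ * H₂)ᵀ * C * (G₁ * F₁ * H₁)
      = H₂ᵀ * (F₂ᵀ * (G₂ᵀ * C * G₁) * F₁) * H₁ := by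
        simp only [Matrix.transpose_mul, mul_assoc]
    _ = C := by rw [hG, hF, hH]

lemma twisted_backlundFrame (hα : α ≠ 0) (hF : IsFrame n j U q F) (hP : IsFormProj P)
    (hp : p ∈ regularSet U α P F) (z : ℂ) :
    (backlundFrame α P F p (-z))ᵀ * (formMatrix n).map Complex.ofReal * backlundFrame α P F p z
      = (formMatrix n).map Complex.ofReal := by
  have hspec := backlundFrame_spec hα hF hP hp
  have hd : ∀ i k, Differentiable ℂ fun z => ((backlundFrame α P F p (-z))ᵀ
      * (formMatrix n).map Complex.ofReal * backlundFrame α P F p z) i k := by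
    refine matDifferentiable_mul (matDifferentiable_mul (fun i k => ?_) fun i k =>
      differentiable_const _) hspec.1
    exact (hspec.1 k i).comp differentiable_neg
  refine mat_eq_of_eq_off_pair (f := fun z => (backlundFrame α P F p (-z))ᵀ
      * (formMatrix n).map Complex.ofReal * backlundFrame α P F p z)
    (g := fun _ => (formMatrix n).map Complex.ofReal) (fun i k => (hd i k).continuous)
    (fun i k => continuous_const) (α : ℂ) (-α) (fun z hz hz' => ?_) z
  have h1 : -z ≠ α := fun h => hz' (by rw [← h, neg_neg])
  have h2 : -z ≠ -α := fun h => hz (neg_injective h)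
  have e1 := dress_form (c := Complex.ofRealHom) hP hz hz'
  have e2 := dress_form (c := Complex.ofRealHom) (α := -α) (isFormProj_tildeProj hp) (ℓ := z)
    (by rwa [map_neg]) (by rwa [map_neg, neg_neg])
  have e3 := hF.twisted p hp.1 z
  rw [hspec.2 z hz hz', hspec.2 _ h1 h2]
  exact twisted_mul e1 e3 e2

lemma continuousOn_backlundFrame (hα : α ≠ 0) (hF : IsFrame n j U q F) (hP : IsFormProj P) :
    MatContinuousOn (fun w : (ℝ × ℝ) × ℂ => backlundFrame α P F w.1 w.2)
      (regularSet U α P F ×ˢ {z : ℂ | z ≠ α ∧ z ≠ -α}) := by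
  have hPs := smoothOn_tildeProj (α := α) hF hP
  have h0 : MatContinuousOn (fun w : (ℝ × ℝ) × ℂ => dress Complex.ofRealHom w.2 α P)
      (regularSet U α P F ×ˢ {z : ℂ | z ≠ α ∧ z ≠ -α}) :=
    matContinuousOn_dress (ζ := fun w : (ℝ × ℝ) × ℂ => w.2) (Q := fun _ => P)
      continuousOn_snd (fun _ _ => continuousOn_const) fun w hw => hw.2.1
  have h1 : MatContinuousOn (fun w : (ℝ × ℝ) × ℂ => F w.1 w.2)
      (regularSet U α P F ×ˢ {z : ℂ | z ≠ α ∧ z ≠ -α}) := fun i k =>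
    (hF.continuous i k).mono fun w hw => ⟨hw.1.1, trivial⟩
  have h2 : MatContinuousOn
      (fun w : (ℝ × ℝ) × ℂ => dress Complex.ofRealHom w.2 (-α) (tildeProj α P F w.1))
      (regularSet U α P F ×ˢ {z : ℂ | z ≠ α ∧ z ≠ -α}) := by
    refine matContinuousOn_dress (ζ := fun w : (ℝ × ℝ) × ℂ => w.2)
      (Q := fun w => tildeProj α P F w.1) continuousOn_snd (fun i k => ?_) fun w hw => ?_
    · exact ContinuousOn.comp (g := fun p => tildeProj α P F p i k) (t := regularSet U α P F)
        (hPs i k).continuousOn continuousOn_fst fun w hw => hw.1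
    · rw [Complex.ofReal_neg]; exact hw.2.2
  intro i k
  refine ((h0.mul h1).mul h2 i k).congr fun w hw => ?_
  exact congrFun (congrFun ((backlundFrame_spec hα hF hP hw.1).2 w.2 hw.2.1 hw.2.2) i) k

lemma continuousOn_potential {V : Set (ℝ × ℝ)} (hq : SmoothOn V q) :
    MatContinuousOn (fun w : (ℝ × ℝ) × ℂ => evalJ n w.2 + (q w.1).map Complex.ofReal)
      (V ×ˢ Set.univ) := by
  intro i k
  have h1 : ContinuousOn (fun w : (ℝ × ℝ) × ℂ => q w.1 i k) (V ×ˢ Set.univ) :=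
    ContinuousOn.comp (g := fun p => q p i k) (t := V) (hq i k).continuousOn continuousOn_fst
      fun w hw => hw.1
  have h2 : Continuous fun w : (ℝ × ℝ) × ℂ => evalJ n w.2 i k := by
    simp only [evalJ, Matrix.add_apply, Matrix.smul_apply, smul_eq_mul]
    fun_prop
  exact h2.continuousOn.add (Complex.continuous_ofReal.comp_continuousOn h1)

lemma smoothOn_backlundFrame_of_ne (hα : α ≠ 0) (hF : IsFrame n j U q F) (hP : IsFormProj P)
    {z : ℂ} (hz : z ≠ α) (hz' : z ≠ -α) :
    SmoothOn (regularSet U α P F) fun p => backlundFrame α P F p z :=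
  (((SmoothOn.const (dress Complex.ofRealHom z α P)).mul
    ((hF.smooth z).mono fun _ hp => hp.1)).mul
      ((smoothOn_tildeProj (α := α) hF hP).dress z (-α))).congr
    fun _ hp => (backlundFrame_spec hα hF hP hp).2 z hz hz'

/-- The gauge relations for the transformed frame. -/
lemma exists_backlund_gauge (hU : IsOpen U) (hF : IsFrame n j U q F) (hα : α ≠ 0)
    (hP : IsFormProj P) : ∃ S : ℝ × ℝ → Loop n,
      IsResolvent (regularSet U α P F) (backlund α P F q) S ∧
      ∀ p ∈ regularSet U α P F, ∀ z : ℂ,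
        (∀ i k, Differentiable ℂ
          fun z : ℂ => Loop.plusEval (S p ^ (2 * (j : ℤ) - 1)) z i k) ∧
        (z ≠ α → z ≠ -α →
          HasMatDerivAt (fun x => backlundFrame α P F (x, p.2) z) (backlundFrame α P F p z
            * (evalJ n z + (backlund α P F q p).map Complex.ofReal)) p.1 ∧
          HasMatDerivAt (fun t => backlundFrame α P F (p.1, t) z) (backlundFrame α P F p z
            * Loop.plusEval (S p ^ (2 * (j : ℤ) - 1)) z) p.2) := by
  have hV : IsOpen (regularSet U α P F) := isOpen_regularSet hU hF hP
  have hVU : regularSet U α P F ⊆ U := fun p hp => hp.1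
  have hPs : SmoothOn (regularSet U α P F) (tildeProj α P F) := smoothOn_tildeProj hF hP
  have hPf : ∀ p ∈ regularSet U α P F, IsFormProj (tildeProj α P F p) :=
    fun p hp => isFormProj_tildeProj hp
  obtain ⟨S, hS, hlax⟩ := hF.lax
  have hgx : ∀ p ∈ regularSet U α P F, IsGauge α (tildeProj α P F p)
      (partialX (tildeProj α P F) p) (potential (q p))
      (potential (IsotropicKdV.backlund α P F q p)) := by
    intro p hp
    refine isGauge_potential (hPf p hp).1 ?_
    exact tildeProj_ode hF hP (γ := fun x => (x, p.2)) (s := p.1) (eventually_slice_x hV hp)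
      (fun z => hF.hasMatDerivAt_x hU (hVU hp) z) (hPs.hasDerivAt_x hV hp)
  refine ⟨fun p => dressConj α (tildeProj α P F p) (S p),
    (hS.mono hVU).dressConj hV hPf hPs hgx, fun p hp => ?_⟩
  obtain ⟨A, hA⟩ := exists_isPlusPart (S p ^ (2 * (j : ℤ) - 1))
  have hFt : ∀ z, HasMatDerivAt (fun t => F (p.1, t) z)
      (F p z * polyEval Complex.ofRealHom z A) p.2 := by
    intro z
    rw [← hA.plusEval, ← deriv_of_inv_mul (hF.det_eq_one p hp.1 z) (hlax p hp.1 z).2]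
    exact (hF.smooth z).hasDerivAt_t hU hp.1
  -- In the `t` direction the transformed coefficient is not explicit; it is only known to be a
  -- polynomial `Q`. It is then identified with the polynomial part of the power of the transformed
  -- resolvent.
  obtain ⟨Q, hQ⟩ := exists_isGauge (hPf p hp).1 hα (tildeProj_ode hF hP
    (γ := fun t => (p.1, t)) (s := p.2) (eventually_slice_t hV hp) hFt (hPs.hasDerivAt_t hV hp))
  have hplus : ∀ z, Loop.plusEval ((dressConj α (tildeProj α P F p) (S p)) ^ (2 * (j : ℤ) - 1)) z
      = polyEval Complex.ofRealHom z Q := by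
    intro z
    rw [dressConj_zpow (hPf p hp).1]
    exact (hA.dressConj (hPf p hp).1 hQ).plusEval z
  refine fun z => ⟨?_, fun hz hz' => ⟨?_, ?_⟩⟩
  · intro i k
    simp only [hplus]
    exact differentiable_polyEval Q i k
  · rw [← polyEval_potential]
    exact backlundFrame_deriv hα hF hP (γ := fun x => (x, p.2)) (s := p.1)
      (eventually_slice_x hV hp) (fun z => hF.hasMatDerivAt_x hU (hVU hp) z)
      (hPs.hasDerivAt_x hV hp) (hgx p hp) hz hz'
  · rw [hplus]
    exact backlundFrame_deriv hα hF hP (γ := fun t => (p.1, t)) (s := p.2)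
      (eventually_slice_t hV hp) hFt (hPs.hasDerivAt_t hV hp) hQ hz hz'

/-- The transformed frame is a frame of the transformed potential. -/
theorem IsFrame.backlund (hU : IsOpen U) (hq : SmoothOn U q) (hF : IsFrame n j U q F)
    (hα : α ≠ 0) (hP : IsFormProj P) :
    IsFrame n j (regularSet U α P F) (backlund α P F q) (backlundFrame α P F) := by
  have hV : IsOpen (regularSet U α P F) := isOpen_regularSet hU hF hP
  have hqs : SmoothOn (regularSet U α P F) (IsotropicKdV.backlund α P F q) :=
    smoothOn_backlund hq hF hP
  obtain ⟨S, hS, hSd⟩ := exists_backlund_gauge hU hF hα hP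
  have hT := hS.smoothLoop_zpow j
  have hAd : ∀ p ∈ regularSet U α P F, ∀ i k, Differentiable ℂ fun z : ℂ =>
      (evalJ n z + (IsotropicKdV.backlund α P F q p).map Complex.ofReal) i k := by
    intro p _ i k
    simp only [← polyEval_potential]
    exact differentiable_polyEval _ i k
  have hd : ∀ p ∈ regularSet U α P F, ∀ z : ℂ, z ≠ α → z ≠ -α → ∀ i k,
      HasFDerivAt (fun p => backlundFrame α P F p z i k)
        (linComb ((backlundFrame α P F p z
            * (evalJ n z + (IsotropicKdV.backlund α P F q p).map Complex.ofReal)) i k)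
          ((backlundFrame α P F p z * Loop.plusEval (S p ^ (2 * (j : ℤ) - 1)) z) i k)) p := by
    intro p hp z hz hz' i k
    obtain ⟨h1, h2⟩ := (hSd p hp z).2 hz hz'
    exact hasFDerivAt_of_slices (smoothOn_backlundFrame_of_ne hα hF hP hz hz' i k) hV hp
      (h1 i k) (h2 i k)
  obtain ⟨hcont, hder⟩ := frame_extension hV (Φ := backlundFrame α P F)
    (A := fun p z => evalJ n z + (IsotropicKdV.backlund α P F q p).map Complex.ofReal)
    (B := fun p z => Loop.plusEval (S p ^ (2 * (j : ℤ) - 1)) z) (α : ℂ)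
    (fun p hp => (backlundFrame_spec hα hF hP hp).1) hAd (fun p hp => (hSd p hp 0).1)
    (continuousOn_backlundFrame hα hF hP) (continuousOn_potential hqs)
    hT.continuousOn_plusEval hd
  refine ⟨fun p hp => (backlundFrame_spec hα hF hP hp).1, fun z => ?_, hcont,
    fun p hp => conj_backlundFrame hα hF hP hp, fun p hp => det_backlundFrame hα hF hP hp,
    fun p hp => twisted_backlundFrame hα hF hP hp, S, hS, fun p hp z => ?_⟩
  -- The product formula is not available at `λ = ±α`, so smoothness is deduced from the linear
  -- system, uniformly for all `λ`.
  · refine smoothOn_of_lax hV ?_ (hT.smoothOn_plusEval z) fun p hp => hder p hp z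
    exact (SmoothOn.const (evalJ n z)).add hqs.ofReal
  · have hinv : IsUnit (backlundFrame α P F p z).det := by
      rw [det_backlundFrame hα hF hP hp z]; exact isUnit_one
    have hx : partialX (fun p' => backlundFrame α P F p' z) p = backlundFrame α P F p z
        * (evalJ n z + (IsotropicKdV.backlund α P F q p).map Complex.ofReal) := by
      ext i k
      exact (hasDerivAt_slice_x (hder p hp z i k)).deriv
    have ht : partialT (fun p' => backlundFrame α P F p' z) p = backlundFrame α P F p z
        * Loop.plusEval (S p ^ (2 * (j : ℤ) - 1)) z := by
      ext i k
      exact (hasDerivAt_slice_t (hder p hp z i k)).deriv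
    rw [hx, ht, ← mul_assoc, ← mul_assoc, Matrix.nonsing_inv_mul _ hinv, one_mul, one_mul]
    exact ⟨rfl, rfl⟩

/-! ### The flow as the compatibility condition of a frame -/

lemma mixed_partials {f g h : ℝ × ℝ → ℂ} (hU : IsOpen U) (hf : ContDiffOn ℝ ∞ f U) (hp : p ∈ U)
    (hd : ∀ p ∈ U, HasFDerivAt f (linComb (g p) (h p)) p) {g' h' : ℂ}
    (hg : HasDerivAt (fun t => g (p.1, t)) g' p.2) (hh : HasDerivAt (fun x => h (x, p.2)) h' p.1) :
    g' = h' := by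
  have hfp := hf.contDiffAt (hU.mem_nhds hp)
  have hsymm : IsSymmSndFDerivAt ℝ f p := hfp.isSymmSndFDerivAt (by
    rw [minSmoothness_of_isRCLikeNormedField]; exact WithTop.coe_le_coe.2 (le_top : (2 : ℕ∞) ≤ ⊤))
  have h2 : HasFDerivAt (fderiv ℝ f) (fderiv ℝ (fderiv ℝ f) p) p :=
    ((hfp.fderiv_right (m := 1) (n := ∞)
      (WithTop.coe_le_coe.2 (le_top : (2 : ℕ∞) ≤ ⊤))).differentiableAt (by simp)).hasFDerivAt
  have hx : HasDerivAt (fun x : ℝ => (x, p.2)) ((1 : ℝ), (0 : ℝ)) p.1 :=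
    (hasDerivAt_id p.1).prodMk (hasDerivAt_const p.1 p.2)
  have ht : HasDerivAt (fun t : ℝ => (p.1, t)) ((0 : ℝ), (1 : ℝ)) p.2 :=
    (hasDerivAt_const p.2 p.1).prodMk (hasDerivAt_id p.2)
  have e1 : HasDerivAt (fun t => fderiv ℝ f (p.1, t) (1, 0))
      (fderiv ℝ (fderiv ℝ f) p (0, 1) (1, 0)) p.2 := by
    have := HasFDerivAt.comp_hasDerivAt (f := fun t : ℝ => (p.1, t)) p.2 h2 ht
    simpa using this.clm_apply (hasDerivAt_const p.2 ((1 : ℝ), (0 : ℝ)))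
  have e2 : HasDerivAt (fun x => fderiv ℝ f (x, p.2) (0, 1))
      (fderiv ℝ (fderiv ℝ f) p (1, 0) (0, 1)) p.1 := by
    have := HasFDerivAt.comp_hasDerivAt (f := fun x : ℝ => (x, p.2)) p.1 h2 hx
    simpa using this.clm_apply (hasDerivAt_const p.1 ((0 : ℝ), (1 : ℝ)))
  have e1' := e1.congr_of_eventuallyEq (f₁ := fun t => g (p.1, t))
    ((eventually_slice_t hU hp).mono fun t ht => by
      simp only [(hd _ ht).fderiv, linComb_apply]; simp)
  have e2' := e2.congr_of_eventuallyEq (f₁ := fun x => h (x, p.2))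
    ((eventually_slice_x hU hp).mono fun x hx => by
      simp only [(hd _ hx).fderiv, linComb_apply]; simp)
  rw [hg.unique e1', hh.unique e2']
  exact hsymm _ _

/-- A potential with a frame solves the flow. -/
theorem IsFrame.isSolution (hU : IsOpen U) (hq : SmoothOn U q) (hb : ∀ p ∈ U, IsBPlus (q p))
    (hF : IsFrame n j U q F) : IsSolution n j U q := by
  obtain ⟨S, hS, hlax⟩ := hF.lax
  refine ⟨hq, hb, S, hS, fun p hp => ?_⟩
  have hT := hS.smoothLoop_zpow j
  set B : ℝ × ℝ → Mat n ℝ := fun p => Loop.coeff (S p ^ (2 * (j : ℤ) - 1)) 0 with hB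
  have hBs : SmoothOn U B := hT.smoothOn_coeff 0
  set A : ℝ × ℝ → Mat n ℝ := fun p => shiftMatrix n + q p with hA
  have hAs : SmoothOn U A := (SmoothOn.const _).add hq
  -- At `λ = 0` the matrix `J` reduces to `b` and the polynomial part to its coefficient of `λ^0`;
  -- the compatibility condition there is the flow itself.
  have hx : ∀ p ∈ U, partialX (fun p' => F p' 0) p = F p 0 * (A p).map Complex.ofRealHom := by
    intro p hp
    rw [deriv_of_inv_mul (hF.det_eq_one p hp 0) (hlax p hp 0).1]
    congr 1
    rw [evalJ, zero_smul, add_zero]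
    ext i k; simp [hA]
  have ht : ∀ p ∈ U, partialT (fun p' => F p' 0) p = F p 0 * (B p).map Complex.ofRealHom := by
    intro p hp
    obtain ⟨Q, hQ⟩ := exists_isPlusPart (S p ^ (2 * (j : ℤ) - 1))
    have h0 := polyEval_ofReal 0 Q
    rw [Complex.ofReal_zero] at h0
    rw [deriv_of_inv_mul (hF.det_eq_one p hp 0) (hlax p hp 0).2, hQ.plusEval, h0,
      hQ.realEval_zero]
  have hFd : ∀ p ∈ U, ∀ i k, HasFDerivAt (fun p => F p 0 i k)
      (linComb ((F p 0 * (A p).map Complex.ofRealHom) i k)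
        ((F p 0 * (B p).map Complex.ofRealHom) i k)) p := by
    intro p hp i k
    rw [← hx p hp, ← ht p hp]
    exact hasFDerivAt_of_slices (hF.smooth 0 i k) hU hp ((hF.smooth 0).hasDerivAt_x hU hp i k)
      ((hF.smooth 0).hasDerivAt_t hU hp i k)
  have dAt : HasMatDerivAt (fun t => A (p.1, t)) (partialT A p) p.2 := hAs.hasDerivAt_t hU hp
  have dBx : HasMatDerivAt (fun x => B (x, p.2)) (partialX B p) p.1 := hBs.hasDerivAt_x hU hp
  have dFx : HasMatDerivAt (fun x => F (x, p.2) 0) (F p 0 * (A p).map Complex.ofRealHom) p.1 := by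
    rw [← hx p hp]; exact (hF.smooth 0).hasDerivAt_x hU hp
  have dFt : HasMatDerivAt (fun t => F (p.1, t) 0) (F p 0 * (B p).map Complex.ofRealHom) p.2 := by
    rw [← ht p hp]; exact (hF.smooth 0).hasDerivAt_t hU hp
  have d1 := dFt.mul dAt.ofReal
  have d2 := dFx.mul dBx.ofReal
  have hmix : F p 0 * (B p).map Complex.ofRealHom * (A p).map Complex.ofRealHom
        + F p 0 * (partialT A p).map Complex.ofRealHom
      = F p 0 * (A p).map Complex.ofRealHom * (B p).map Complex.ofRealHom
        + F p 0 * (partialX B p).map Complex.ofRealHom := by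
    ext i k
    exact mixed_partials hU (hF.smooth 0 i k) hp (fun p hp => hFd p hp i k) (d1 i k) (d2 i k)
  have hu : IsUnit (F p 0) := by
    rw [Matrix.isUnit_iff_isUnit_det, hF.det_eq_one p hp 0]; exact isUnit_one
  have hreal : B p * A p + partialT A p = A p * B p + partialX B p := by
    apply map_ofReal_injective
    simp only [Matrix.map_mul, Matrix.map_add _ (map_add Complex.ofRealHom)]
    refine hu.mul_left_cancel ?_
    simpa only [mul_add, mul_assoc] using hmix
  have hqA : partialT q p = partialT A p := by
    ext i k
    exact (((hq.hasDerivAt_t hU hp i k).const_add (shiftMatrix n i k)).unique (dAt i k))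
  rw [hqA, Ring.lie_def]
  exact (eq_sub_of_add_eq' hreal).trans (by simp only [hA, hB]; abel)

end BacklundStep

/-! ### Permutability -/

section Permutability

variable {n j : ℕ} {U : Set (ℝ × ℝ)} {q : ℝ × ℝ → Mat n ℝ} {F : ℝ × ℝ → ℂ → Mat n ℂ}
  {α α₁ α₂ : ℝ} {P P₁ P₂ : Mat n ℝ} {p : ℝ × ℝ}

lemma dress_form_real (hP : IsFormProj P₁) (h1 : α₂ ≠ α₁) (h2 : α₂ ≠ -α₁) :
    (dress (RingHom.id ℝ) (-α₂) α₁ P₁)ᵀ * formMatrix n * dress (RingHom.id ℝ) α₂ α₁ P₁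
      = formMatrix n := by
  have h := dress_form (c := RingHom.id ℝ) hP h1 h2
  have e : (formMatrix n).map (RingHom.id ℝ) = formMatrix n := Matrix.map_id _
  rwa [e] at h

/-- `φπ₂ = (α₁ + α₂ - 2α₁π₁)π₂` and `φ(1 - π₂) = (α₁ - α₂ - 2α₁π₁)(1 - π₂)`. The two brackets are
`g_{α₁,π₁}(±α₂)` multiplied by their denominators `±α₂ - α₁`, which accounts for the weights. -/
lemma phi_eq_splitMap (h1 : α₂ ≠ α₁) (h2 : α₂ ≠ -α₁) :
    phi α₁ α₂ P₁ P₂ = splitMap (α₂ - α₁) (-α₂ - α₁) (dress (RingHom.id ℝ) α₂ α₁ P₁)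
      (dress (RingHom.id ℝ) (-α₂) α₁ P₁) P₂ := by
  have n1 : α₂ - α₁ ≠ 0 := sub_ne_zero.2 h1
  have n2 : -α₂ - α₁ ≠ 0 := fun h => h2 (by linarith)
  have e : P₁.map (RingHom.id ℝ) = P₁ := Matrix.map_id _
  have e1 : (α₂ - α₁) • dress (RingHom.id ℝ) α₂ α₁ P₁
      = (α₂ - α₁) • (1 : Mat n ℝ) + (2 * α₁) • (1 - P₁) := by
    rw [dress, smul_add, smul_smul, e, RingHom.id_apply, mul_div_cancel₀ _ n1]
  have e2 : (-α₂ - α₁) • dress (RingHom.id ℝ) (-α₂) α₁ P₁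
      = (-α₂ - α₁) • (1 : Mat n ℝ) + (2 * α₁) • (1 - P₁) := by
    rw [dress, smul_add, smul_smul, e, RingHom.id_apply, mul_div_cancel₀ _ n2]
  rw [splitMap, ← Matrix.smul_mul, ← Matrix.smul_mul, e1, e2, phi]
  simp only [add_mul, mul_sub, mul_one, Matrix.smul_mul, one_mul, sub_mul]
  module

lemma phi_swap : phi α₂ α₁ P₂ P₁ = -phi α₁ α₂ P₁ P₂ := by
  simp only [phi]; module

lemma conj_neg (A : Mat n ℝ) {Ψ : Mat n ℝ} (h : IsUnit Ψ) :
    (-Ψ) * A * (-Ψ)⁻¹ = Ψ * A * Ψ⁻¹ := by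
  have h1 : (-Ψ)⁻¹ = -Ψ⁻¹ := Matrix.inv_eq_right_inv (by
    rw [neg_mul_neg, Matrix.mul_nonsing_inv _ ((Matrix.isUnit_iff_isUnit_det _).1 h)])
  rw [h1]
  noncomm_ring

lemma isFormProj_conj_phi (hP₁ : IsFormProj P₁) (hP₂ : IsFormProj P₂) (h1 : α₂ ≠ α₁)
    (h2 : α₂ ≠ -α₁) (hφ : IsUnit (phi α₁ α₂ P₁ P₂)) :
    IsFormProj (phi α₁ α₂ P₁ P₂ * P₂ * (phi α₁ α₂ P₁ P₂)⁻¹) := by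
  rw [phi_eq_splitMap h1 h2] at hφ ⊢
  exact isFormProj_splitMap_conj hP₂ (dress_form_real hP₁ h1 h2) hφ

/-- Exchanging the indices changes only the sign of `φ`, which conjugation does not see. -/
lemma isFormProj_conj_phi' (hP₁ : IsFormProj P₁) (hP₂ : IsFormProj P₂) (h1 : α₂ ≠ α₁)
    (h2 : α₂ ≠ -α₁) (hφ : IsUnit (phi α₁ α₂ P₁ P₂)) :
    IsFormProj (phi α₁ α₂ P₁ P₂ * P₁ * (phi α₁ α₂ P₁ P₂)⁻¹) := by
  have h := isFormProj_conj_phi (α₁ := α₂) (α₂ := α₁) hP₂ hP₁ h1.symm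
    (fun h => h2 (by linarith)) (by rw [phi_swap]; exact hφ.neg)
  rwa [phi_swap, conj_neg _ hφ] at h

lemma image_tildeProj (hF : IsFrame n j U q F) (hP : IsFormProj P) (hp : p ∈ regularSet U α P F) :
    image (tildeProj α P F p) = tildeSpace α P F p := by
  rw [tildeProj_eq hF hP hp, tildeSpace_eq]
  exact image_splitMap_conj hP.1 one_ne_zero ((mem_regularSet_iff hF hP).1 hp).2

lemma frameRe_backlundFrame (hα₁ : α₁ ≠ 0) (hF : IsFrame n j U q F) (hP₁ : IsFormProj P₁)
    (h1 : α₂ ≠ α₁) (h2 : α₂ ≠ -α₁) (hp : p ∈ regularSet U α₁ P₁ F) :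
    frameRe (backlundFrame α₁ P₁ F) α₂ p = dress (RingHom.id ℝ) α₂ α₁ P₁ * frameRe F α₂ p
      * dress (RingHom.id ℝ) α₂ (-α₁) (tildeProj α₁ P₁ F p) := by
  have hz : (α₂ : ℂ) ≠ α₁ := fun h => h1 (Complex.ofReal_injective h)
  have hz' : (α₂ : ℂ) ≠ -α₁ := fun h => h2 (Complex.ofReal_injective (by rw [h]; simp))
  have hd : ∀ (a : ℝ) (Q : Mat n ℝ), dress Complex.ofRealHom (α₂ : ℂ) a Q
      = (dress (RingHom.id ℝ) α₂ a Q).map Complex.ofRealHom := fun a Q => by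
    rw [map_dress]; rfl
  rw [frameRe, (backlundFrame_spec hα₁ hF hP₁ hp).2 _ hz hz', hd, hd, ← hF.map_frameRe hp.1,
    ← Matrix.map_mul, ← Matrix.map_mul]
  ext i k
  exact Complex.ofReal_re _

/-- The space of the second transformation, in terms of the first step. -/
lemma tildeSpace_backlundFrame (hα₁ : α₁ ≠ 0) (hF : IsFrame n j U q F) (hP₁ : IsFormProj P₁)
    (hP₂ : IsFormProj P₂) (h1 : α₂ ≠ α₁) (h2 : α₂ ≠ -α₁) (hφ : IsUnit (phi α₁ α₂ P₁ P₂))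
    (hp₁ : p ∈ regularSet U α₁ P₁ F) (hp₂ : p ∈ regularSet U α₂ P₂ F) :
    tildeSpace α₂ (phi α₁ α₂ P₁ P₂ * P₂ * (phi α₁ α₂ P₁ P₂)⁻¹) (backlundFrame α₁ P₁ F) p
      = image (dress (RingHom.id ℝ) α₂ α₁ (tildeProj α₁ P₁ F p) * tildeProj α₂ P₂ F p) := by
  -- `Im τ₂` is the image of `Im π₂` under `g_{α₁,π₁}(α₂)`, the left factor of the new frame at
  -- `α₂`; the inverse frame removes it.
  have hτ : image (phi α₁ α₂ P₁ P₂ * P₂ * (phi α₁ α₂ P₁ P₂)⁻¹)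
      = image (dress (RingHom.id ℝ) α₂ α₁ P₁ * P₂) := by
    rw [phi_eq_splitMap h1 h2] at hφ ⊢
    exact image_splitMap_conj hP₂.1 (sub_ne_zero.2 h1) hφ
  have hu := (isUnit_of_form (dress_form_real hP₁ h1 h2)).1
  have hg := Matrix.nonsing_inv_mul _ ((Matrix.isUnit_iff_isUnit_det _).1 hu)
  have hi : (dress (RingHom.id ℝ) α₂ (-α₁) (tildeProj α₁ P₁ F p))⁻¹
      = dress (RingHom.id ℝ) α₂ α₁ (tildeProj α₁ P₁ F p) :=
    Matrix.inv_eq_right_inv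
      (dress_neg_mul_dress (c := RingHom.id ℝ) (isFormProj_tildeProj hp₁).1 h1 h2)
  have hre := frameRe_backlundFrame hα₁ hF hP₁ h1 h2 hp₁
  rw [← map_image, image_tildeProj hF hP₂ hp₂, tildeSpace_eq, tildeSpace_eq, ← map_image, hτ,
    map_image, map_image, hre, Matrix.mul_inv_rev, Matrix.mul_inv_rev, hi]
  simp only [mul_assoc]
  rw [← mul_assoc _⁻¹ _ P₂, hg, one_mul]

/-- The space of the second step stands to `π̃₁`, `π̃₂` as `Im τ₂` stands to `π₁`, `π₂`, so the
nondegeneracy criterion applies with `φ̃` in place of `φ`. -/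
lemma mem_regularSet_backlundFrame (hα₁ : α₁ ≠ 0) (hF : IsFrame n j U q F)
    (hP₁ : IsFormProj P₁) (hP₂ : IsFormProj P₂) (h1 : α₂ ≠ α₁) (h2 : α₂ ≠ -α₁)
    (hφ : IsUnit (phi α₁ α₂ P₁ P₂)) (hp₁ : p ∈ regularSet U α₁ P₁ F)
    (hp₂ : p ∈ regularSet U α₂ P₂ F) :
    p ∈ regularSet (regularSet U α₁ P₁ F) α₂
        (phi α₁ α₂ P₁ P₂ * P₂ * (phi α₁ α₂ P₁ P₂)⁻¹) (backlundFrame α₁ P₁ F) ↔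
      IsUnit (phi α₁ α₂ (tildeProj α₁ P₁ F p) (tildeProj α₂ P₂ F p)) := by
  rw [regularSet, Set.mem_ofPred_eq, tildeSpace_backlundFrame hα₁ hF hP₁ hP₂ h1 h2 hφ hp₁ hp₂,
    phi_eq_splitMap h1 h2]
  have hb : -α₂ - α₁ ≠ 0 := fun h => h2 (by linarith)
  exact (and_iff_right hp₁).trans (isCompl_iff_isUnit_splitMap (isFormProj_tildeProj hp₂)
    (dress_form_real (isFormProj_tildeProj hp₁) h1 h2) (sub_ne_zero.2 h1) hb)

lemma tildeProj_backlundFrame (hα₁ : α₁ ≠ 0) (hF : IsFrame n j U q F)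
    (hP₁ : IsFormProj P₁) (hP₂ : IsFormProj P₂) (h1 : α₂ ≠ α₁) (h2 : α₂ ≠ -α₁)
    (hφ : IsUnit (phi α₁ α₂ P₁ P₂)) (hp₁ : p ∈ regularSet U α₁ P₁ F)
    (hp₂ : p ∈ regularSet U α₂ P₂ F)
    (hφ' : IsUnit (phi α₁ α₂ (tildeProj α₁ P₁ F p) (tildeProj α₂ P₂ F p))) :
    tildeProj α₂ (phi α₁ α₂ P₁ P₂ * P₂ * (phi α₁ α₂ P₁ P₂)⁻¹) (backlundFrame α₁ P₁ F) p
      = phi α₁ α₂ (tildeProj α₁ P₁ F p) (tildeProj α₂ P₂ F p) * tildeProj α₂ P₂ F p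
        * (phi α₁ α₂ (tildeProj α₁ P₁ F p) (tildeProj α₂ P₂ F p))⁻¹ := by
  rw [phi_eq_splitMap h1 h2] at hφ'
  rw [tildeProj, tildeSpace_backlundFrame hα₁ hF hP₁ hP₂ h1 h2 hφ hp₁ hp₂,
    orthProj_image_mul (isFormProj_tildeProj hp₂)
      (dress_form_real (isFormProj_tildeProj hp₁) h1 h2) (sub_ne_zero.2 h1) hφ',
    ← phi_eq_splitMap h1 h2]

/-- The combination `α₁ P₁ - α₂ P₂` commutes with `φ`. -/
lemma phi_conj_sub (hφ : IsUnit (phi α₁ α₂ P₁ P₂)) :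
    α₁ • (phi α₁ α₂ P₁ P₂ * P₁ * (phi α₁ α₂ P₁ P₂)⁻¹)
      - α₂ • (phi α₁ α₂ P₁ P₂ * P₂ * (phi α₁ α₂ P₁ P₂)⁻¹) = α₁ • P₁ - α₂ • P₂ := by
  have hd := Matrix.mul_nonsing_inv _ ((Matrix.isUnit_iff_isUnit_det _).1 hφ)
  -- `φ` is a polynomial in the combination, hence commutes with it.
  have hX : phi α₁ α₂ P₁ P₂ = (α₁ - α₂) • (1 : Mat n ℝ) - (2 : ℝ) • (α₁ • P₁ - α₂ • P₂) := by
    simp only [phi]; module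
  have hc : phi α₁ α₂ P₁ P₂ * (α₁ • P₁ - α₂ • P₂)
      = (α₁ • P₁ - α₂ • P₂) * phi α₁ α₂ P₁ P₂ := by
    rw [hX]
    simp only [sub_mul, mul_sub, Matrix.smul_mul, Matrix.mul_smul, one_mul, mul_one]
    module
  calc _ = phi α₁ α₂ P₁ P₂ * (α₁ • P₁ - α₂ • P₂) * (phi α₁ α₂ P₁ P₂)⁻¹ := by
        simp only [mul_sub, sub_mul, Matrix.mul_smul, Matrix.smul_mul]
    _ = _ := by rw [hc, mul_assoc, hd, mul_one]

lemma IsSolution.backlund (hU : IsOpen U) (hq : IsSolution n j U q) (hF : IsFrame n j U q F)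
    (hα : α ≠ 0) (hP : IsFormProj P) :
    IsSolution n j (regularSet U α P F) (backlund α P F q) :=
  (hF.backlund hU hq.1 hα hP).isSolution (isOpen_regularSet hU hF hP)
    (smoothOn_backlund hq.1 hF hP) fun p hp => (hq.2.1 p hp.1).backlund hp

end Permutability

end IsotropicKdV

end

/-! ### The permutability theorem -/

theorem mainTheorem12 (n j : ℕ) (hj : ¬ ((2 * (n : ℤ) + 1) ∣ (2 * (j : ℤ) - 1)))
    (U : Set (ℝ × ℝ)) (hU : IsOpen U)
    (q : ℝ × ℝ → IsotropicKdV.Mat n ℝ) (hq : IsotropicKdV.IsSolution n j U q)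
    (F : ℝ × ℝ → ℂ → IsotropicKdV.Mat n ℂ) (hF : IsotropicKdV.IsFrame n j U q F)
    (α₁ α₂ : ℝ) (hα₁ : α₁ ≠ 0) (hα₂ : α₂ ≠ 0) (hα : |α₁| ≠ |α₂|)
    (π₁ π₂ : IsotropicKdV.Mat n ℝ)
    (hπ₁ : IsotropicKdV.IsOProjection π₁) (hπ₂ : IsotropicKdV.IsOProjection π₂)
    (hφ : IsUnit (IsotropicKdV.phi α₁ α₂ π₁ π₂)) :
    let φ := IsotropicKdV.phi α₁ α₂ π₁ π₂
    let τ₁ := φ * π₁ * φ⁻¹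
    let τ₂ := φ * π₂ * φ⁻¹
    -- the two one-step transformations, and their domains
    let U₁ := IsotropicKdV.regularSet U α₁ π₁ F
    let U₂ := IsotropicKdV.regularSet U α₂ π₂ F
    let q₁ := IsotropicKdV.backlund α₁ π₁ F q
    let q₂ := IsotropicKdV.backlund α₂ π₂ F q
    let F₁ := IsotropicKdV.backlundFrame α₁ π₁ F
    let F₂ := IsotropicKdV.backlundFrame α₂ π₂ F
    -- the two two-step transformations, and their domains
    let U₁₂ := IsotropicKdV.regularSet U₁ α₂ τ₂ F₁
    let U₂₁ := IsotropicKdV.regularSet U₂ α₁ τ₁ F₂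
    let q₁₂ := IsotropicKdV.backlund α₂ τ₂ F₁ q₁
    let q₂₁ := IsotropicKdV.backlund α₁ τ₁ F₂ q₂
    let e := IsotropicKdV.cornerMatrix n
    let πt₁ := IsotropicKdV.tildeProj α₁ π₁ F
    let πt₂ := IsotropicKdV.tildeProj α₂ π₂ F
    let φt := fun p => IsotropicKdV.phi α₁ α₂ (πt₁ p) (πt₂ p)
    let τt₁ := fun p => φt p * πt₁ p * (φt p)⁻¹
    let τt₂ := fun p => φt p * πt₂ p * (φt p)⁻¹
    (IsotropicKdV.IsOProjection τ₁ ∧ IsotropicKdV.IsOProjection τ₂) ∧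
    (IsOpen U₁ ∧ IsotropicKdV.IsSolution n j U₁ q₁ ∧ IsotropicKdV.IsFrame n j U₁ q₁ F₁) ∧
    (IsOpen U₂ ∧ IsotropicKdV.IsSolution n j U₂ q₂ ∧ IsotropicKdV.IsFrame n j U₂ q₂ F₂) ∧
    (IsOpen U₁₂ ∧ IsotropicKdV.IsSolution n j U₁₂ q₁₂) ∧
    (IsOpen U₂₁ ∧ IsotropicKdV.IsSolution n j U₂₁ q₂₁) ∧
    (∀ p ∈ U₁ ∩ U₂, (p ∈ U₁₂ ↔ IsUnit (φt p)) ∧ (p ∈ U₂₁ ↔ IsUnit (φt p))) ∧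
    (∀ p ∈ U₁ ∩ U₂, IsUnit (φt p) →
      IsotropicKdV.IsOProjection (τt₁ p) ∧ IsotropicKdV.IsOProjection (τt₂ p) ∧
      q₁₂ p = q₂₁ p ∧
      q₁₂ p = q₁ p + (2 * α₂) • ⁅e, τt₂ p⁆ ∧
      q₁₂ p = q₂ p + (2 * α₁) • ⁅e, τt₁ p⁆) := by
  intro φ τ₁ τ₂ U₁ U₂ q₁ q₂ F₁ F₂ U₁₂ U₂₁ q₁₂ q₂₁ e πt₁ πt₂ φt τt₁ τt₂
  have hP₁ := hπ₁.isFormProj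
  have hP₂ := hπ₂.isFormProj
  -- The condition on absolute values keeps `±α₂` away from the poles `±α₁` of the first simple
  -- element and its inverse, and vice versa.
  have h1 : α₂ ≠ α₁ := fun h => hα (by rw [h])
  have h2 : α₂ ≠ -α₁ := fun h => hα (by rw [h, abs_neg])
  have h2' : α₁ ≠ -α₂ := fun h => h2 (by rw [h, neg_neg])
  have hτ₁ : IsotropicKdV.IsFormProj τ₁ := IsotropicKdV.isFormProj_conj_phi' hP₁ hP₂ h1 h2 hφ
  have hτ₂ : IsotropicKdV.IsFormProj τ₂ := IsotropicKdV.isFormProj_conj_phi hP₁ hP₂ h1 h2 hφ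
  have oU₁ : IsOpen U₁ := IsotropicKdV.isOpen_regularSet hU hF hP₁
  have oU₂ : IsOpen U₂ := IsotropicKdV.isOpen_regularSet hU hF hP₂
  have hq₁ : IsotropicKdV.IsSolution n j U₁ q₁ := hq.backlund hU hF hα₁ hP₁
  have hq₂ : IsotropicKdV.IsSolution n j U₂ q₂ := hq.backlund hU hF hα₂ hP₂
  have hF₁ : IsotropicKdV.IsFrame n j U₁ q₁ F₁ := hF.backlund hU hq.1 hα₁ hP₁
  have hF₂ : IsotropicKdV.IsFrame n j U₂ q₂ F₂ := hF.backlund hU hq.1 hα₂ hP₂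
  -- The other order is handled by the same lemmas with the indices exchanged; `φ` and `φ̃` then
  -- only change sign.
  have hφ' : IsUnit (IsotropicKdV.phi α₂ α₁ π₂ π₁) := by
    rw [IsotropicKdV.phi_swap]; exact hφ.neg
  have hτ₁' : τ₁ = IsotropicKdV.phi α₂ α₁ π₂ π₁ * π₁ * (IsotropicKdV.phi α₂ α₁ π₂ π₁)⁻¹ := by
    rw [IsotropicKdV.phi_swap, IsotropicKdV.conj_neg _ hφ]
  have hswap : ∀ p, IsotropicKdV.phi α₂ α₁ (πt₂ p) (πt₁ p) = -φt p := fun p =>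
    IsotropicKdV.phi_swap
  refine ⟨⟨hτ₁.isOProjection, hτ₂.isOProjection⟩, ⟨oU₁, hq₁, hF₁⟩, ⟨oU₂, hq₂, hF₂⟩,
    ⟨IsotropicKdV.isOpen_regularSet oU₁ hF₁ hτ₂, hq₁.backlund oU₁ hF₁ hα₂ hτ₂⟩,
    ⟨IsotropicKdV.isOpen_regularSet oU₂ hF₂ hτ₁, hq₂.backlund oU₂ hF₂ hα₁ hτ₁⟩, ?_, ?_⟩
  · rintro p ⟨hp₁, hp₂⟩
    refine ⟨IsotropicKdV.mem_regularSet_backlundFrame hα₁ hF hP₁ hP₂ h1 h2 hφ hp₁ hp₂, ?_⟩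
    have h := IsotropicKdV.mem_regularSet_backlundFrame hα₂ hF hP₂ hP₁ h1.symm h2' hφ' hp₂ hp₁
    rw [← hτ₁'] at h
    exact h.trans (by rw [hswap p]; exact IsUnit.neg_iff _)
  · rintro p ⟨hp₁, hp₂⟩ hu
    have f₁ : IsotropicKdV.IsFormProj (πt₁ p) := IsotropicKdV.isFormProj_tildeProj hp₁
    have f₂ : IsotropicKdV.IsFormProj (πt₂ p) := IsotropicKdV.isFormProj_tildeProj hp₂
    have t₂ : IsotropicKdV.tildeProj α₂ τ₂ F₁ p = τt₂ p :=
      IsotropicKdV.tildeProj_backlundFrame hα₁ hF hP₁ hP₂ h1 h2 hφ hp₁ hp₂ hu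
    have t₁ : IsotropicKdV.tildeProj α₁ τ₁ F₂ p = τt₁ p := by
      have hu' : IsUnit (IsotropicKdV.phi α₂ α₁ (πt₂ p) (πt₁ p)) := by
        rw [hswap p]; exact hu.neg
      have h := IsotropicKdV.tildeProj_backlundFrame hα₂ hF hP₂ hP₁ h1.symm h2' hφ' hp₂ hp₁ hu'
      rw [← hτ₁'] at h
      refine h.trans ?_
      change IsotropicKdV.phi α₂ α₁ (πt₂ p) (πt₁ p) * πt₁ p
        * (IsotropicKdV.phi α₂ α₁ (πt₂ p) (πt₁ p))⁻¹ = _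
      rw [hswap p, IsotropicKdV.conj_neg _ hu]
    have e₁₂ : q₁₂ p = q₁ p + (2 * α₂) • ⁅e, τt₂ p⁆ := by rw [← t₂]; rfl
    have e₂₁ : q₂₁ p = q₂ p + (2 * α₁) • ⁅e, τt₁ p⁆ := by rw [← t₁]; rfl
    have hs : α₁ • τt₁ p - α₂ • τt₂ p = α₁ • πt₁ p - α₂ • πt₂ p := IsotropicKdV.phi_conj_sub hu
    have hsum : q₁ p + (2 * α₂) • ⁅e, τt₂ p⁆ = q₂ p + (2 * α₁) • ⁅e, τt₁ p⁆ := by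
      have d₁ : q₁ p = q p + (2 * α₁) • ⁅e, πt₁ p⁆ := rfl
      have d₂ : q₂ p = q p + (2 * α₂) • ⁅e, πt₂ p⁆ := rfl
      -- The potentials differ by `2[e, ·]` applied to the two sides of `hs`, so the identity for
      -- `α₁τ̃₁ - α₂τ̃₂` is all that is needed.
      have hb := congrArg (fun X => (2 : ℝ) • ⁅e, X⁆) hs
      simp only [Ring.lie_def, mul_sub, sub_mul, Matrix.mul_smul, Matrix.smul_mul] at hb
      rw [d₁, d₂]
      simp only [Ring.lie_def]
      rw [← sub_eq_zero] at hb ⊢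
      rw [← neg_eq_zero, ← hb]
      module
    exact ⟨(IsotropicKdV.isFormProj_conj_phi' f₁ f₂ h1 h2 hu).isOProjection,
      (IsotropicKdV.isFormProj_conj_phi f₁ f₂ h1 h2 hu).isOProjection,
      e₁₂.trans (hsum.trans e₂₁.symm), e₁₂, e₁₂.trans hsum⟩
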